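/- Let $(\omega_e)_{e\in E}$ be i.i.d. uniform random variables on $[0,1]$, with joint law $\mathbb{P}$, indexed by the edges of the complete graph $K_n$ on $n$ vertices. Given $\omega$ and $\beta\ge 0$, let $\mathcal{T}$ be the random spanning tree of $K_n$ with quenched law $$\mathbf{P}^{\omega}_{n,\beta}(\mathcal{T}=T)=\frac{\prod_{e\in T}e^{-\beta\omega_e}}{\sum_{T'}\prod_{e\in T'}e^{-\beta\omega_e}},$$ where $T'$ runs over all spanning trees of $K_n$. Let $\mathbf{E}^{\omega}_{n,\beta}$ be the corresponding expectation and let $L(\mathcal{T})=\sum_{e\in\mathcal{T}}\omega_e$ be the total length. For random variables $X_n$ depending on $\omega$ and positive numbers $a_n$, we say that $X_n=(1+o(1))a_n$ *with high probability* if for every $\varepsilon>0$ the probability that $|X_n-a_n|\le\varepsilon a_n$ tends to $1$ as $n\to\infty$, and *in $\mathbb{P}$-expectation* if $\mathbb{E}[X_n]=(1+o(1))a_n$. **Theorem 1.3.** If $0<\beta=\beta(n)=o(n/\log n)$, then, with high probability and in $\mathbb{P}$-expectation, $$\mathbf{E}^{\omega}_{n,\beta}[L(\mathcal{T})]=(1+o(1))\,\frac{n}{\beta}\cdot\frac{1-\beta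 e^{-\beta}-e^{-\beta}}{1-e^{-\beta}}.$$ If instead $\beta=\beta(n)\ge 0$ and $n(\log n)^5=o(\beta)$, then, with high probability and in $\mathbb{P}$-expectation, $$\mathbf{E}^{\omega}_{n,\beta}[L(\mathcal{T})]=(1+o(1))\,\zeta(3),\qquad \zeta(3)=\sum_{k=1}^{\infty}k^{-3}.$$ -/

import Mathlib

open Filter Topology MeasureTheory Asymptotics
open scoped BigOperators

noncomputable section

namespace RSTRE

/-- The edges of the complete graph on `n` vertices. -/
abbrev Edge (n : ℕ) : Type := (⊤ : SimpleGraph (Fin n)).edgeSet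

/-- An environment: a real number `ω e` for every edge `e` of the complete graph. -/
abbrev Env (n : ℕ) : Type := Edge n → ℝ

/-- The law `ℙ` of the environment: the `ω e` are i.i.d. uniform on `[0, 1]`. -/
def envLaw (n : ℕ) : Measure (Env n) :=
  Measure.pi fun _ : Edge n => (volume : Measure ℝ).restrict (Set.Icc 0 1)

open Classical in
/-- The spanning trees of the complete graph on `n` vertices, each one a graph on the whole
vertex set. -/
def spanningTrees (n : ℕ) : Finset (SimpleGraph (Fin n)) :=
  Finset.univ.filter fun T => T.IsTree

open Classical in
/-- The edges of a spanning tree `T`, as a set of edges of the complete graph. -/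
def treeEdges {n : ℕ} (T : SimpleGraph (Fin n)) : Finset (Edge n) :=
  Finset.univ.filter fun e => (e : Sym2 (Fin n)) ∈ T.edgeSet

/-- The unnormalized weight `∏_{e ∈ T} exp (-β ω_e)`. -/
def treeWeight {n : ℕ} (β : ℝ) (ω : Env n) (T : SimpleGraph (Fin n)) : ℝ :=
  ∏ e ∈ treeEdges T, Real.exp (-β * ω e)

/-- The partition function. -/
def partitionFunction {n : ℕ} (β : ℝ) (ω : Env n) : ℝ :=
  ∑ T ∈ spanningTrees n, treeWeight β ω T

/-- The quenched probability of the spanning tree `T`. -/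
def quenchedProb {n : ℕ} (β : ℝ) (ω : Env n) (T : SimpleGraph (Fin n)) : ℝ :=
  treeWeight β ω T / partitionFunction β ω

/-- The total length `L(T) = ∑_{e ∈ T} ω_e`. -/
def treeLength {n : ℕ} (ω : Env n) (T : SimpleGraph (Fin n)) : ℝ :=
  ∑ e ∈ treeEdges T, ω e

/-- The quenched expectation of the total length. -/
def quenchedLength {n : ℕ} (β : ℝ) (ω : Env n) : ℝ :=
  ∑ T ∈ spanningTrees n, quenchedProb β ω T * treeLength ω T

/-- `X_n = (1 + o(1)) a_n` with high probability, for functions `X_n` of the environment and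
positive numbers `a_n`: for every `ε > 0` the event `|X_n - a_n| ≤ ε a_n` has probability tending
to one. The event depends on the environment only, so its probability under the averaged law of
the environment and the tree is its probability under the law of the environment. -/
def AsympWHP (X : ∀ n : ℕ, Env n → ℝ) (a : ℕ → ℝ) : Prop :=
  ∀ ε : ℝ, 0 < ε →
    Tendsto (fun n => envLaw n {ω | |X n ω - a n| ≤ ε * a n}) atTop (𝓝 1)

/-- `X_n = (1 + o(1)) a_n` in expectation: `𝔼[X_n] = (1 + o(1)) a_n`. -/
def AsympExp (X : ∀ n : ℕ, Env n → ℝ) (a : ℕ → ℝ) : Prop :=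
  (∀ n, Integrable (X n) (envLaw n)) ∧
    (fun n => ∫ ω, X n ω ∂(envLaw n)) ~[atTop] a

/-- Apéry's constant `ζ(3) = ∑_{k ≥ 1} k⁻³`. -/
def zetaThree : ℝ := ∑' k : ℕ, 1 / ((k : ℝ) + 1) ^ 3

end RSTRE

end

/-! In both regimes the quenched length is compared, in mean absolute deviation, with a
deterministic quantity; Markov's inequality and the triangle inequality then give both modes of
convergence (`asymp_of_integral_abs_sub`).

High temperature. The map β ↦ log Z(β) is convex with derivative minus the quenched length, so the
length is squeezed between difference quotients of log Z (`log_partitionFunction_sub_ge`). It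
therefore suffices to know log Z up to o(n), namely log Z(γ) ≈ (n - 1) log(n φ(γ)) with φ the
Laplace transform of the uniform law. The upper bound is annealed: Cayley's formula bounds the mean
of Z (`integral_partitionFunction_le`). For the lower bound on the mean of log Z, a spanning tree is
seen as a forest growing from a root generation by generation (`forestSum_eq_sum_powerset`), only
prescribed generation sizes are kept, and the logarithm is moved inside the sum over generations of
each size by Jensen. What remains is the mean logarithm of a sum of independent weights exp(-γ ω),
bounded below by Jensen at the means of the order statistics (`integral_log_sum_exp_ge`), with loss
about |γ|/m for m weights. Generations double up to size about n/K and then stay constant, so there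
are O(K + log n) of them; as γ = o(n / log n), the total loss is at most a small multiple of n for
large K. Since log y ≤ y - 1, this bound on the mean upgrades to an L¹ bound
(`integral_abs_freeEnergyError_le`). Finally -n (log φ)' is the announced value, and it is stable
under shifts of β by η max(1, β).

Low temperature. Z(0) is at most n^n and Z(β) is at least the weight of the minimal spanning tree,
so by convexity the quenched length is within n log n / β of the minimal length
(`abs_quenchedLength_sub_percolationLength_le`). By Kruskal's algorithm the minimal length is the
integral over p in [0, 1] of (number of components of the graph of edges of length at most p) - 1.
With p = x/n, a second moment computation gives the limit of the number of components per vertex as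
the sum over k of k^(k-2) x^(k-1) e^(-kx) / k! (`tendsto_integral_abs_numComponents`), and a first
moment bound decaying like e^(-x/4) allows dominated convergence
(`tendsto_lintegral_componentExcess`). Integrating the k-th term gives k⁻³, hence ζ(3)
(`integral_componentDensity`). -/

noncomputable section

namespace RSTRE

/-! ### Rooted forests as parent functions, and spanning trees. -/

section ParentFunctions

variable {V : Type*} [Fintype V] [DecidableEq V]

open Classical in
/-- The parent functions of the forests on `A ∪ R` in which every tree contains exactly one
element of `R`, its root; they are the identity outside `A`. -/
def parentFns (A R : Finset V) : Finset (V → V) :=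
  Finset.univ.filter fun f => (∀ v, v ∉ A → f v = v) ∧
    ∃ l : V → ℕ, ∀ v ∈ A, f v ∈ R ∨ (f v ∈ A ∧ l (f v) < l v)

/-- The sum of the weights of all forests on `A ∪ R` rooted at `R`. -/
def forestSum (c : V → V → ℝ) (A R : Finset V) : ℝ :=
  ∑ f ∈ parentFns A R, ∏ v ∈ A, c v (f v)

lemma mem_parentFns {A R : Finset V} {f : V → V} :
    f ∈ parentFns A R ↔ (∀ v, v ∉ A → f v = v) ∧
      ∃ l : V → ℕ, ∀ v ∈ A, f v ∈ R ∨ (f v ∈ A ∧ l (f v) < l v) := by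
  simp [parentFns]

/-- A vertex of least level has no admissible parent when there are no roots. This removes the term
J = ∅ from the generation decomposition. -/
lemma parentFns_empty_right {A : Finset V} (hA : A.Nonempty) : parentFns A ∅ = ∅ := by
  rw [Finset.eq_empty_iff_forall_notMem]
  intro f hf
  obtain ⟨-, l, hl⟩ := mem_parentFns.1 hf
  obtain ⟨v, hv, hmin⟩ := Finset.exists_min_image A l hA
  rcases hl v hv with h | ⟨h1, h2⟩
  · simp at h
  · exact absurd (hmin _ h1) (by omega)

lemma parentFns_empty_left (R : Finset V) : parentFns ∅ R = {id} := by
  ext f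
  simp [mem_parentFns, funext_iff]

lemma forestSum_empty_left (c : V → V → ℝ) (R : Finset V) : forestSum c ∅ R = 1 := by
  simp [forestSum, parentFns_empty_left]

lemma forestSum_empty_right (c : V → V → ℝ) {A : Finset V} (hA : A.Nonempty) :
    forestSum c A ∅ = 0 := by
  simp [forestSum, parentFns_empty_right hA]

lemma parentFns_nonempty (A : Finset V) {R : Finset V} (hR : R.Nonempty) :
    (parentFns A R).Nonempty := by
  obtain ⟨r, hr⟩ := hR
  refine ⟨fun v => if v ∈ A then r else v, mem_parentFns.2 ⟨fun v hv => by simp [hv], 0, ?_⟩⟩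
  intro v hv
  simp [hv, hr]

lemma apply_ne_of_mem_parentFns {A R : Finset V} (hAR : Disjoint A R) {f : V → V}
    (hf : f ∈ parentFns A R) {v : V} (hv : v ∈ A) : f v ≠ v := by
  obtain ⟨-, l, hl⟩ := mem_parentFns.1 hf
  intro h
  rcases hl v hv with h1 | ⟨-, h2⟩
  · rw [h] at h1
    exact Finset.disjoint_left.1 hAR hv h1
  · rw [h] at h2
    exact lt_irrefl _ h2

/-- Levels exclude 2-cycles; hence distinct vertices have distinct edges to their parents. -/
lemma apply_apply_ne_of_mem_parentFns {A R : Finset V} (hAR : Disjoint A R) {f : V → V}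
    (hf : f ∈ parentFns A R) {v w : V} (hv : v ∈ A) (hw : w ∈ A) (hvw : f v = w) : f w ≠ v := by
  obtain ⟨-, l, hl⟩ := mem_parentFns.1 hf
  intro h
  rcases hl v hv with h1 | ⟨-, h2⟩
  · exact Finset.disjoint_left.1 hAR hw (hvw ▸ h1)
  · rcases hl w hw with h3 | ⟨-, h4⟩
    · exact Finset.disjoint_left.1 hAR hv (h ▸ h3)
    · rw [hvw] at h2; rw [h] at h4; omega

/-- Decomposition of the rooted forests according to the set `J` of children of the roots. -/
lemma forestSum_eq_sum_powerset (c : V → V → ℝ) {A R : Finset V} (hAR : Disjoint A R) :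
    forestSum c A R =
      ∑ J ∈ A.powerset, (∏ v ∈ J, ∑ u ∈ R, c v u) * forestSum c (A \ J) J := by
  classical
  have hmap : ∀ f ∈ parentFns A R, A.filter (fun v => f v ∈ R) ∈ A.powerset := by
    intro f _
    simp
  rw [forestSum, ← Finset.sum_fiberwise_of_maps_to hmap]
  refine Finset.sum_congr rfl fun J hJ => ?_
  rw [Finset.mem_powerset] at hJ
  -- The product of sums is expanded over choices of a root for each v in J. The singleton {v} off J
  -- pins the choice to the identity there, so each choice is counted once.
  have hprod : (∏ v ∈ J, ∑ u ∈ R, c v u) =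
      ∑ g ∈ Fintype.piFinset (fun v => if v ∈ J then R else {v}), ∏ v ∈ J, c v (g v) := by
    have h := Finset.prod_univ_sum (fun v => if v ∈ J then R else {v})
      (fun v u => if v ∈ J then c v u else 1)
    have h1 : ∀ x : V → V, (∏ v, if v ∈ J then c v (x v) else 1) = ∏ v ∈ J, c v (x v) := by
      intro x
      rw [Finset.prod_ite_mem, Finset.univ_inter]
    simp only [h1] at h
    rw [← h, ← Finset.prod_subset (Finset.subset_univ J)]
    · exact Finset.prod_congr rfl fun v hv => by simp [hv]
    · intro v _ hv
      simp [hv]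
  rw [hprod, forestSum, Finset.sum_mul_sum, ← Finset.sum_product']
  refine Finset.sum_nbij' (fun f => (fun v => if v ∈ J then f v else v,
    fun v => if v ∈ J then v else f v)) (fun p v => if v ∈ J then p.1 v else p.2 v) ?_ ?_ ?_ ?_ ?_
  · intro f hf
    obtain ⟨hf, hJf⟩ := Finset.mem_filter.1 hf
    obtain ⟨hoff, l, hl⟩ := mem_parentFns.1 hf
    have hJ' : ∀ v, v ∈ J ↔ v ∈ A ∧ f v ∈ R := fun v => by rw [← hJf]; simp
    refine Finset.mem_product.2 ⟨?_, mem_parentFns.2 ⟨?_, l, ?_⟩⟩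
    · rw [Fintype.mem_piFinset]
      intro v
      by_cases hv : v ∈ J
      · simpa [hv] using ((hJ' v).1 hv).2
      · simp [hv]
    · intro v hv
      by_cases hvJ : v ∈ J
      · simp [hvJ]
      · simp only [hvJ, if_false]
        exact hoff v fun h => hv (by simp [h, hvJ])
    · intro v hv
      obtain ⟨hvA, hvJ⟩ := Finset.mem_sdiff.1 hv
      simp only [hvJ, if_false]
      rcases hl v hvA with h | ⟨h1, h2⟩
      · exact absurd ((hJ' v).2 ⟨hvA, h⟩) hvJ
      · by_cases h3 : f v ∈ J
        · exact Or.inl h3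
        · exact Or.inr ⟨by simp [h1, h3], h2⟩
  · rintro ⟨g, h⟩ hgh
    obtain ⟨hg, hh⟩ := Finset.mem_product.1 hgh
    obtain ⟨hoff, l, hl⟩ := mem_parentFns.1 hh
    rw [Fintype.mem_piFinset] at hg
    have hgR : ∀ v ∈ J, g v ∈ R := fun v hv => by simpa [hv] using hg v
    have hhA : ∀ v ∈ A, v ∉ J → h v ∈ A := by
      intro v hv hvJ
      rcases hl v (by simp [hv, hvJ]) with h1 | h1
      · exact hJ h1
      · exact (Finset.mem_sdiff.1 h1.1).1
    -- Gluing back: J becomes the lowest generation, so it gets level 0 and the other levels are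
    -- raised by one to stay strictly above it.
    refine Finset.mem_filter.2 ⟨mem_parentFns.2 ⟨?_, fun v => if v ∈ J then 0 else l v + 1, ?_⟩, ?_⟩
    · intro v hv
      have hvJ : v ∉ J := fun h' => hv (hJ h')
      simp only [hvJ, if_false]
      exact hoff v (by simp [hv])
    · intro v hv
      by_cases hvJ : v ∈ J
      · simp only [hvJ, if_true]
        exact Or.inl (hgR v hvJ)
      · simp only [hvJ, if_false]
        refine Or.inr ⟨hhA v hv hvJ, ?_⟩
        rcases hl v (by simp [hv, hvJ]) with h1 | ⟨h1, h2⟩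
        · simp [h1]
        · simp [(Finset.mem_sdiff.1 h1).2, h2]
    · ext v
      simp only [Finset.mem_filter]
      constructor
      · rintro ⟨hv, hv'⟩
        by_contra hvJ
        simp only [hvJ, if_false] at hv'
        exact Finset.disjoint_left.1 hAR (hhA v hv hvJ) hv'
      · intro hv
        simpa [hv, hJ hv] using hgR v hv
  · intro f _
    funext v
    by_cases hv : v ∈ J <;> simp [hv]
  · rintro ⟨g, h⟩ hgh
    obtain ⟨hg, hh⟩ := Finset.mem_product.1 hgh
    rw [Fintype.mem_piFinset] at hg
    obtain ⟨hoff, -⟩ := mem_parentFns.1 hh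
    refine Prod.ext ?_ ?_ <;> funext v <;> by_cases hv : v ∈ J <;> simp only [hv, if_true, if_false]
    · have h1 : g v = v := by simpa [hv] using hg v
      exact h1.symm
    · exact (hoff v (by simp [hv])).symm
  · intro f _
    dsimp only
    rw [← Finset.prod_sdiff hJ, mul_comm]
    congr 1
    · exact Finset.prod_congr rfl fun v hv => by simp [hv]
    · exact Finset.prod_congr rfl fun v hv => by simp [(Finset.mem_sdiff.1 hv).2]

/-- The binomial theorem differentiated in x and multiplied by x, through j C(a, j) = a C(a - 1, j -
1). It closes the recursion in Cayley's formula. -/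
lemma sum_range_choose_mul_id_mul_pow (a : ℕ) (x y : ℝ) :
    ∑ j ∈ Finset.range (a + 1), (a.choose j : ℝ) * (x ^ j * (j * y ^ (a - j))) =
      x * (a * (x + y) ^ (a - 1)) := by
  cases a with
  | zero => simp
  | succ b =>
    rw [Finset.sum_range_succ']
    simp only [Nat.cast_zero, zero_mul, mul_zero, add_zero]
    rw [add_pow, Nat.add_sub_cancel, Finset.mul_sum, Finset.mul_sum]
    refine Finset.sum_congr rfl fun j _ => ?_
    have h : ((b + 1 : ℕ) : ℝ) * (b.choose j : ℝ) =
        ((b + 1).choose (j + 1) : ℝ) * ((j + 1 : ℕ) : ℝ) := by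
      exact_mod_cast Nat.add_one_mul_choose_eq b j
    have h2 : b + 1 - (j + 1) = b - j := by omega
    rw [h2, pow_succ]
    linear_combination (-(x ^ j * x * y ^ (b - j))) * h

/-- The number of forests on `A ∪ R` rooted at `R`. -/
lemma forestSum_one {A R : Finset V} (hAR : Disjoint A R) :
    ((A.card : ℝ) + R.card) * forestSum (fun _ _ => (1 : ℝ)) A R =
      R.card * ((A.card : ℝ) + R.card) ^ A.card := by
  induction h : A.card using Nat.strong_induction_on generalizing A R with
  | _ a ih =>
    subst h
    rcases A.eq_empty_or_nonempty with rfl | hA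
    · simp [forestSum_empty_left]
    have ha : (A.card : ℝ) ≠ 0 := by exact_mod_cast hA.card_pos.ne'
    -- The factor |A| equals |A \ J| + |J|, exactly the factor on the left of the induction
    -- hypothesis for A \ J rooted at J, so no division is needed.
    have key : (A.card : ℝ) * forestSum (fun _ _ => (1 : ℝ)) A R =
        (R.card : ℝ) * (A.card * ((R.card : ℝ) + A.card) ^ (A.card - 1)) := by
      have hstep : ∀ J ∈ A.powerset,
          (A.card : ℝ) * ((∏ v ∈ J, ∑ _u ∈ R, (1 : ℝ)) *
            forestSum (fun _ _ => (1 : ℝ)) (A \ J) J) =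
          (R.card : ℝ) ^ J.card * (J.card * (A.card : ℝ) ^ (A.card - J.card)) := by
        intro J hJ
        rw [Finset.mem_powerset] at hJ
        rcases J.eq_empty_or_nonempty with rfl | hJne
        · simp [forestSum_empty_right _ hA]
        · have hlt : (A \ J).card < A.card := Finset.card_lt_card
            (Finset.sdiff_ssubset hJ hJne)
          have h1 := ih _ hlt (Finset.sdiff_disjoint : Disjoint (A \ J) J) rfl
          have h2 : ((A \ J).card : ℝ) + J.card = A.card := by
            exact_mod_cast Finset.card_sdiff_add_card_eq_card hJ
          rw [h2, Finset.card_sdiff_of_subset hJ] at h1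
          rw [← h1]
          simp only [Finset.sum_const, Finset.prod_const, nsmul_eq_mul, mul_one]
          ring
      rw [forestSum_eq_sum_powerset _ hAR, Finset.mul_sum, ← sum_range_choose_mul_id_mul_pow,
        Finset.sum_congr rfl hstep, Finset.sum_powerset_apply_card
          (fun j => (R.card : ℝ) ^ j * (j * (A.card : ℝ) ^ (A.card - j)))]
      simp only [nsmul_eq_mul]
    have h1 : forestSum (fun _ _ => (1 : ℝ)) A R =
        (R.card : ℝ) * ((R.card : ℝ) + A.card) ^ (A.card - 1) := by
      apply mul_left_cancel₀ ha
      rw [key]; ring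
    rw [h1]
    obtain ⟨b, hb⟩ := Nat.exists_eq_succ_of_ne_zero hA.card_pos.ne'
    rw [hb, Nat.succ_sub_one, pow_succ]
    ring

/-- The graph with an edge from every `v ≠ r` to its parent `f v`. -/
def parentGraph (r : V) (f : V → V) : SimpleGraph V :=
  SimpleGraph.fromEdgeSet ((fun v => s(v, f v)) '' {v | v ≠ r})

section Trees

variable {r : V} {f : V → V}

lemma ne_of_mem_parentFns_singleton (hf : f ∈ parentFns (Finset.univ.erase r) {r}) {v : V}
    (hv : v ≠ r) : f v ≠ v :=
  apply_ne_of_mem_parentFns (by simp) hf (by simp [hv])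

lemma edgeSet_parentGraph (hf : f ∈ parentFns (Finset.univ.erase r) {r}) :
    (parentGraph r f).edgeSet = (fun v => s(v, f v)) '' {v | v ≠ r} := by
  rw [parentGraph, SimpleGraph.edgeSet_fromEdgeSet, sdiff_eq_left, Set.disjoint_left]
  rintro _ ⟨v, hv, rfl⟩ h
  exact ne_of_mem_parentFns_singleton hf hv (by simpa using h.symm)

lemma parentEdge_injOn (hf : f ∈ parentFns (Finset.univ.erase r) {r}) :
    Set.InjOn (fun v => s(v, f v)) {v | v ≠ r} := by
  intro v hv w hw h
  rcases Sym2.eq_iff.1 h with ⟨h1, -⟩ | ⟨h1, h2⟩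
  · exact h1
  · exact absurd h1.symm (apply_apply_ne_of_mem_parentFns (by simp) hf (by simpa using hv)
      (by simpa using hw) h2)

/-- Following parents lowers the level until r is reached, so the graph is connected; it has one
edge per vertex other than r. -/
lemma parentGraph_isTree (hf : f ∈ parentFns (Finset.univ.erase r) {r}) :
    (parentGraph r f).IsTree := by
  rw [SimpleGraph.isTree_iff_connected_and_card]
  constructor
  · obtain ⟨-, l, hl⟩ := mem_parentFns.1 hf
    have hadj : ∀ v, v ≠ r → (parentGraph r f).Adj v (f v) := by
      intro v hv
      rw [← SimpleGraph.mem_edgeSet, edgeSet_parentGraph hf]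
      exact ⟨v, hv, rfl⟩
    have hreach : ∀ k : ℕ, ∀ v, l v = k → (parentGraph r f).Reachable v r := by
      intro k
      induction k using Nat.strong_induction_on with
      | _ k ih =>
        intro v hk
        by_cases hv : v = r
        · rw [hv]
        · refine (hadj v hv).reachable.trans ?_
          rcases hl v (by simp [hv]) with h | ⟨-, h⟩
          · rw [Finset.mem_singleton.1 h]
          · exact ih _ (hk ▸ h) _ rfl
    have : Nonempty V := ⟨r⟩
    exact ⟨fun u v => (hreach _ u rfl).trans (hreach _ v rfl).symm⟩
  · rw [edgeSet_parentGraph hf, Nat.card_image_of_injOn (parentEdge_injOn hf)]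
    have h1 : Nat.card {v : V | v ≠ r} = Fintype.card V - 1 := by
      have h2 : {v : V | v ≠ r} = ((Finset.univ.erase r : Finset V) : Set V) := by ext; simp
      rw [h2, Nat.card_coe_set_eq, Set.ncard_coe_finset, Finset.card_erase_of_mem (by simp),
        Finset.card_univ]
    rw [h1, Nat.card_eq_fintype_card]
    have : 0 < Fintype.card V := Fintype.card_pos_iff.2 ⟨r⟩
    omega

/-- Among the vertices where f and g differ, take v of least level for g. The edge {v, g v} can only
be the parent edge of g v under f, so f and g differ at g v too, which is either the root or has a
smaller level: a contradiction. -/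
lemma parentGraph_injOn (r : V) :
    Set.InjOn (parentGraph r) (parentFns (Finset.univ.erase r) {r} : Finset (V → V)) := by
  intro f hf g hg hfg
  rw [Finset.mem_coe] at hf hg
  have hE : (fun v => s(v, f v)) '' {v | v ≠ r} = (fun v => s(v, g v)) '' {v | v ≠ r} := by
    rw [← edgeSet_parentGraph hf, ← edgeSet_parentGraph hg, hfg]
  obtain ⟨hgo, l, hl⟩ := mem_parentFns.1 hg
  have hfo := (mem_parentFns.1 hf).1
  have hr : f r = g r := by rw [hfo r (by simp), hgo r (by simp)]
  by_contra hne
  obtain ⟨v₀, hv₀⟩ := Function.ne_iff.1 hne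
  obtain ⟨v, hv, hmin⟩ := Finset.exists_min_image (Finset.univ.filter fun v => f v ≠ g v) l
    ⟨v₀, by simpa using hv₀⟩
  simp only [Finset.mem_filter, Finset.mem_univ, true_and] at hv hmin
  have hvr : v ≠ r := fun h => hv (h ▸ hr)
  have hmem : s(v, g v) ∈ (fun v => s(v, f v)) '' {v | v ≠ r} := by
    rw [hE]; exact ⟨v, hvr, rfl⟩
  obtain ⟨w, hw, hvw⟩ := hmem
  rcases Sym2.eq_iff.1 hvw with ⟨h1, h2⟩ | ⟨h1, h2⟩
  · exact hv (h1 ▸ h2)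
  · have hgw : g w ≠ v := apply_apply_ne_of_mem_parentFns (by simp) hg (by simpa using hvr)
      (by simpa using hw) h1.symm
    have h3 := hmin w (by rw [h2]; exact hgw.symm)
    rcases hl v (by simp [hvr]) with h | ⟨-, h⟩
    · exact hw (by rw [h1]; simpa using h)
    · rw [← h1] at h
      omega

/-- Sending each vertex to a neighbour closer to r gives a spanning tree inside T, and a tree is a
minimal connected graph. -/
lemma exists_parentGraph_eq {T : SimpleGraph V} (hT : T.IsTree) (r : V) :
    ∃ f ∈ parentFns (Finset.univ.erase r) {r}, parentGraph r f = T := by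
  have hex : ∀ v, v ≠ r → ∃ w, T.Adj v w ∧ T.dist w r < T.dist v r := by
    intro v hv
    obtain ⟨p, hp⟩ := hT.connected.exists_walk_length_eq_dist v r
    cases p with
    | nil => exact absurd rfl hv
    | cons h q =>
      refine ⟨_, h, ?_⟩
      rw [← hp, SimpleGraph.Walk.length_cons]
      exact Nat.lt_succ_of_le (SimpleGraph.dist_le q)
  choose! g hg using hex
  let f : V → V := fun v => if v = r then r else g v
  have hfv : ∀ v, v ≠ r → f v = g v := fun v hv => by simp [f, hv]
  have hf : f ∈ parentFns (Finset.univ.erase r) {r} := by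
    refine mem_parentFns.2 ⟨fun v hv => ?_, fun v => T.dist v r, fun v hv => ?_⟩
    · have : v = r := by simpa using hv
      simp [f, this]
    · have hv' : v ≠ r := by simpa using hv
      rw [hfv v hv']
      by_cases h : g v = r
      · exact Or.inl (by simp [h])
      · exact Or.inr ⟨by simp [h], (hg v hv').2⟩
  refine ⟨f, hf, ?_⟩
  have hle : parentGraph r f ≤ T := by
    rw [← SimpleGraph.edgeSet_subset_edgeSet, edgeSet_parentGraph hf]
    rintro _ ⟨v, hv, rfl⟩
    simp only [hfv v hv, SimpleGraph.mem_edgeSet]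
    exact (hg v hv).1
  exact le_antisymm hle ((SimpleGraph.isTree_iff_minimal_connected.1 hT).2
    (parentGraph_isTree hf).connected hle)

open Classical in
/-- Spanning trees are the same as rooted forests with a single root `r`. -/
lemma sum_isTree_eq_forestSum (w : Sym2 V → ℝ) (r : V) :
    ∑ T ∈ Finset.univ.filter (fun T : SimpleGraph V => T.IsTree), ∏ e ∈ T.edgeFinset, w e =
      forestSum (fun u v => w s(u, v)) (Finset.univ.erase r) {r} := by
  rw [forestSum]
  symm
  refine Finset.sum_bij (fun f _ => parentGraph r f) ?_ ?_ ?_ ?_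
  · intro f hf
    simpa using parentGraph_isTree hf
  · intro f hf g hg h
    exact parentGraph_injOn r hf hg h
  · intro T hT
    obtain ⟨f, hf, h⟩ := exists_parentGraph_eq (Finset.mem_filter.1 hT).2 r
    exact ⟨f, hf, h⟩
  · intro f hf
    have h1 : (parentGraph r f).edgeFinset = (Finset.univ.erase r).image fun v => s(v, f v) := by
      ext e
      rw [SimpleGraph.mem_edgeFinset, edgeSet_parentGraph hf]
      simp
    rw [h1, Finset.prod_image]
    intro v hv w hw h
    exact parentEdge_injOn hf (by simpa using hv) (by simpa using hw) h

end Trees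

end ParentFunctions

/-! ### The partition function as a forest sum, and Cayley's formula. -/

/-- Extension of an environment by zero to all unordered pairs. -/
def extendEnv {n : ℕ} (ω : Env n) (e : Sym2 (Fin n)) : ℝ :=
  if h : e ∈ (⊤ : SimpleGraph (Fin n)).edgeSet then ω ⟨e, h⟩ else 0

/-- The weight of the edge between `u` and `v`. -/
def pairWeight {n : ℕ} (β : ℝ) (ω : Env n) (u v : Fin n) : ℝ :=
  Real.exp (-β * extendEnv ω s(u, v))

lemma extendEnv_coe {n : ℕ} (ω : Env n) (e : Edge n) : extendEnv ω e = ω e := by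
  rw [extendEnv, dif_pos e.2]

open Classical in
lemma map_treeEdges {n : ℕ} (T : SimpleGraph (Fin n)) :
    (treeEdges T).map (Function.Embedding.subtype _) = T.edgeFinset := by
  ext e
  simp only [treeEdges, Finset.mem_map, Finset.mem_filter, Finset.mem_univ, true_and,
    Function.Embedding.coe_subtype, SimpleGraph.mem_edgeFinset]
  constructor
  · rintro ⟨a, ha, rfl⟩
    exact ha
  · intro he
    exact ⟨⟨e, SimpleGraph.edgeSet_mono le_top he⟩, he, rfl⟩

open Classical in
lemma prod_treeEdges {n : ℕ} (T : SimpleGraph (Fin n)) (g : Sym2 (Fin n) → ℝ) :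
    ∏ e ∈ treeEdges T, g e = ∏ e ∈ T.edgeFinset, g e := by
  rw [← map_treeEdges, Finset.prod_map]
  rfl

/-- Any vertex can serve as the root; this opens the partition function to the generation
decomposition. -/
lemma partitionFunction_eq_forestSum {n : ℕ} (β : ℝ) (ω : Env n) (r : Fin n) :
    partitionFunction β ω = forestSum (pairWeight β ω) (Finset.univ.erase r) {r} := by
  classical
  have h := sum_isTree_eq_forestSum (fun e => Real.exp (-β * extendEnv ω e)) r
  refine Eq.trans ?_ h
  refine Finset.sum_congr rfl fun T _ => ?_
  rw [treeWeight, ← prod_treeEdges]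
  exact Finset.prod_congr rfl fun e _ => by rw [extendEnv_coe]

/-- **Cayley's formula**. -/
lemma card_spanningTrees {n : ℕ} (hn : 0 < n) :
    (n : ℝ) * (spanningTrees n).card = (n : ℝ) ^ (n - 1) := by
  classical
  have h := sum_isTree_eq_forestSum (fun _ => (1 : ℝ)) (⟨0, hn⟩ : Fin n)
  have h1 := forestSum_one (A := Finset.univ.erase (⟨0, hn⟩ : Fin n)) (R := {⟨0, hn⟩}) (by simp)
  rw [← h] at h1
  have h2 : (Finset.univ.erase (⟨0, hn⟩ : Fin n)).card = n - 1 := by simp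
  have h3 : ((n - 1 : ℕ) : ℝ) + 1 = n := by
    rw [Nat.cast_sub hn]; simp
  rw [h2, Finset.card_singleton, Nat.cast_one, h3, one_mul] at h1
  simpa [spanningTrees] using h1

lemma card_treeEdges {n : ℕ} {T : SimpleGraph (Fin n)} (hT : T.IsTree) :
    (treeEdges T).card + 1 = n := by
  classical
  rw [← Finset.card_map (Function.Embedding.subtype _), map_treeEdges]
  simpa using hT.card_edgeFinset

lemma mem_spanningTrees {n : ℕ} {T : SimpleGraph (Fin n)} : T ∈ spanningTrees n ↔ T.IsTree := by
  simp [spanningTrees]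

/-! ### Independent uniform variables. -/

section UniformCube

variable {ι : Type*} [Fintype ι]

/-- The joint law of independent uniform variables on `[0, 1]` indexed by `ι`. -/
abbrev unifLaw (ι : Type*) [Fintype ι] : Measure (ι → ℝ) :=
  Measure.pi fun _ : ι => (volume : Measure ℝ).restrict (Set.Icc 0 1)

instance : IsProbabilityMeasure ((volume : Measure ℝ).restrict (Set.Icc 0 1)) :=
  ⟨by simp⟩

instance (n : ℕ) : IsProbabilityMeasure (envLaw n) :=
  inferInstanceAs (IsProbabilityMeasure (unifLaw (Edge n)))

lemma ae_mem_cube : ∀ᵐ ω ∂(unifLaw ι), ∀ e, ω e ∈ Set.Icc (0 : ℝ) 1 := by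
  rw [ae_all_iff]
  intro e
  exact (measurePreserving_eval (fun _ : ι => (volume : Measure ℝ).restrict (Set.Icc 0 1))
    e).quasiMeasurePreserving.ae (ae_restrict_mem measurableSet_Icc)

lemma integrable_of_le_on_cube {f : (ι → ℝ) → ℝ} (hf : Measurable f) (C : ℝ)
    (h : ∀ ω, (∀ e, ω e ∈ Set.Icc (0 : ℝ) 1) → |f ω| ≤ C) : Integrable f (unifLaw ι) := by
  refine Integrable.of_bound hf.aestronglyMeasurable C ?_
  filter_upwards [ae_mem_cube] with ω hω
  exact h ω hω

lemma measureReal_Iic {p : ℝ} (h0 : 0 ≤ p) (h1 : p ≤ 1) :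
    ((volume : Measure ℝ).restrict (Set.Icc 0 1)).real (Set.Iic p) = p := by
  rw [measureReal_restrict_apply measurableSet_Iic]
  have : Set.Iic p ∩ Set.Icc 0 1 = Set.Icc 0 p := by
    ext x; simp only [Set.mem_inter_iff, Set.mem_Iic, Set.mem_Icc]; constructor
    · rintro ⟨h, h', -⟩; exact ⟨h', h⟩
    · rintro ⟨h, h'⟩; exact ⟨h', h, h'.trans h1⟩
  rw [this]
  simp [h0]

lemma measureReal_Ioi {p : ℝ} (h0 : 0 ≤ p) (h1 : p ≤ 1) :
    ((volume : Measure ℝ).restrict (Set.Icc 0 1)).real (Set.Ioi p) = 1 - p := by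
  rw [← Set.compl_Iic, probReal_compl_eq_one_sub measurableSet_Iic, measureReal_Iic h0 h1]

/-- Probability that given coordinates are at most `p` and given others exceed `p`. -/
lemma measureReal_cylinder [DecidableEq ι] {A B : Finset ι} (hAB : Disjoint A B) {p : ℝ}
    (h0 : 0 ≤ p) (h1 : p ≤ 1) :
    (unifLaw ι).real {ω | (∀ e ∈ A, ω e ≤ p) ∧ ∀ e ∈ B, p < ω e} =
      p ^ A.card * (1 - p) ^ B.card := by
  have hset : {ω : ι → ℝ | (∀ e ∈ A, ω e ≤ p) ∧ ∀ e ∈ B, p < ω e} =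
      (((A ∪ B : Finset ι) : Set ι)).pi fun e => if e ∈ A then Set.Iic p else Set.Ioi p := by
    ext ω
    simp only [Set.mem_ofPred_eq, Set.mem_pi, Finset.coe_union, Set.mem_union, Finset.mem_coe]
    constructor
    · rintro ⟨hA, hB⟩ e he
      by_cases h : e ∈ A
      · simpa [h] using hA e h
      · simpa [h] using hB e (he.resolve_left h)
    · intro h
      refine ⟨fun e he => by simpa [he] using h e (Or.inl he), fun e he => ?_⟩
      have hA : e ∉ A := Finset.disjoint_right.1 hAB he
      simpa [hA] using h e (Or.inr he)
  rw [hset, Measure.real, Measure.pi_pi_finset, ENNReal.toReal_prod, Finset.prod_union hAB]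
  congr 1
  · rw [Finset.prod_congr rfl (g := fun _ => p), Finset.prod_const]
    intro e he
    simpa [he, Measure.real] using measureReal_Iic h0 h1
  · rw [Finset.prod_congr rfl (g := fun _ => 1 - p), Finset.prod_const]
    intro e he
    have hA : e ∉ A := Finset.disjoint_right.1 hAB he
    simpa [hA, Measure.real] using measureReal_Ioi h0 h1

lemma measurableSet_cylinder {ι : Type*} (A B : Finset ι) (p : ℝ) :
    MeasurableSet {ω : ι → ℝ | (∀ e ∈ A, ω e ≤ p) ∧ ∀ e ∈ B, p < ω e} := by
  have h : {ω : ι → ℝ | (∀ e ∈ A, ω e ≤ p) ∧ ∀ e ∈ B, p < ω e} =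
      (⋂ e ∈ A, {ω : ι → ℝ | ω e ≤ p}) ∩ ⋂ e ∈ B, {ω : ι → ℝ | p < ω e} := by
    ext ω
    simp
  rw [h]
  exact (Finset.measurableSet_biInter A fun e _ =>
    measurableSet_le (measurable_pi_apply e) measurable_const).inter
    (Finset.measurableSet_biInter B fun e _ =>
      measurableSet_lt measurable_const (measurable_pi_apply e))

/-- The number of coordinates that are at most `t` is binomial. -/
lemma measureReal_card_eq {m : ℕ} {t : ℝ} (h0 : 0 ≤ t) (h1 : t ≤ 1) (j : ℕ)
    (D : Finset ι) (hD : D.card = m) :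
    (unifLaw ι).real {ω | (D.filter fun e => ω e ≤ t).card = j} =
      (bernsteinPolynomial ℝ m j).eval t := by
  classical
  have hset : {ω : ι → ℝ | (D.filter fun e => ω e ≤ t).card = j} =
      ⋃ A ∈ D.powersetCard j, {ω : ι → ℝ | (∀ e ∈ A, ω e ≤ t) ∧ ∀ e ∈ D \ A, t < ω e} := by
    ext ω
    simp only [Set.mem_ofPred_eq, Set.mem_iUnion, Finset.mem_powersetCard, exists_prop]
    constructor
    · intro h
      refine ⟨D.filter fun e => ω e ≤ t, ⟨Finset.filter_subset _ _, h⟩, fun e he =>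
        (Finset.mem_filter.1 he).2, fun e he => ?_⟩
      simp only [Finset.mem_sdiff, Finset.mem_filter, not_and, not_le] at he
      exact he.2 he.1
    · rintro ⟨A, ⟨hAD, hA⟩, h2, h3⟩
      rw [← hA]
      congr 1
      ext e
      simp only [Finset.mem_filter]
      constructor
      · rintro ⟨he, he'⟩
        by_contra hcon
        exact absurd (h3 e (by simp [he, hcon])) (not_lt.2 he')
      · exact fun he => ⟨hAD he, h2 e he⟩
  rw [hset, measureReal_biUnion_finset]
  · rw [Finset.sum_congr rfl (g := fun _ => t ^ j * (1 - t) ^ (m - j))]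
    · simp [bernsteinPolynomial, hD, mul_assoc]
    · intro A hA
      obtain ⟨hAD, hA⟩ := Finset.mem_powersetCard.1 hA
      rw [measureReal_cylinder Finset.disjoint_sdiff h0 h1, hA, Finset.card_sdiff_of_subset hAD,
        hA, hD]
  · intro A hA B hB hne
    rw [Function.onFun, Set.disjoint_left]
    rintro ω ⟨hA1, hA2⟩ ⟨hB1, hB2⟩
    apply hne
    have hAD := (Finset.mem_powersetCard.1 hA).1
    have hBD := (Finset.mem_powersetCard.1 hB).1
    ext e
    constructor
    · intro he
      by_contra hcon
      exact absurd (hB2 e (by simp [hAD he, hcon])) (not_lt.2 (hA1 e he))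
    · intro he
      by_contra hcon
      exact absurd (hA2 e (by simp [hBD he, hcon])) (not_lt.2 (hB1 e he))
  · intro A _
    exact measurableSet_cylinder _ _ _

end UniformCube

/-- The derivative of the Bernstein polynomial B(m + 1, i + 1) is (m + 1)(B(m, i) - B(m, i + 1)),
and for i < m that polynomial vanishes at both endpoints. So all m + 1 integrals agree, and they add
up to 1. -/
lemma integral_bernsteinPolynomial {m j : ℕ} (hj : j ≤ m) :
    ∫ t in (0 : ℝ)..1, (bernsteinPolynomial ℝ m j).eval t = 1 / (m + 1) := by
  have hint : ∀ i, IntervalIntegrable (fun t : ℝ => (bernsteinPolynomial ℝ m i).eval t)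
      volume 0 1 := fun i => (Polynomial.continuous _).intervalIntegrable _ _
  have hstep : ∀ i, i < m → ∫ t in (0 : ℝ)..1, (bernsteinPolynomial ℝ m i).eval t =
      ∫ t in (0 : ℝ)..1, (bernsteinPolynomial ℝ m (i + 1)).eval t := by
    intro i hi
    have h := intervalIntegral.integral_eq_sub_of_hasDerivAt (a := 0) (b := 1)
      (fun t _ => (bernsteinPolynomial ℝ (m + 1) (i + 1)).hasDerivAt t)
      ((Polynomial.continuous _).intervalIntegrable _ _)
    rw [bernsteinPolynomial.derivative_succ, bernsteinPolynomial.eval_at_0,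
      bernsteinPolynomial.eval_at_1, if_neg (by omega), if_neg (by omega)] at h
    simp only [Nat.add_sub_cancel, Polynomial.eval_mul, Polynomial.eval_sub,
      Polynomial.eval_natCast, intervalIntegral.integral_const_mul, sub_zero] at h
    rw [intervalIntegral.integral_sub (hint _) (hint _)] at h
    have hm : ((m + 1 : ℕ) : ℝ) ≠ 0 := by positivity
    have := (mul_eq_zero.1 h).resolve_left hm
    linarith
  have heq : ∀ i, i ≤ m → ∫ t in (0 : ℝ)..1, (bernsteinPolynomial ℝ m i).eval t =
      ∫ t in (0 : ℝ)..1, (bernsteinPolynomial ℝ m 0).eval t := by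
    intro i
    induction i with
    | zero => intro _; rfl
    | succ i ih => intro hi; rw [← hstep i (by omega), ih (by omega)]
  have hsum : ∑ i ∈ Finset.range (m + 1), ∫ t in (0 : ℝ)..1, (bernsteinPolynomial ℝ m i).eval t
      = 1 := by
    rw [← intervalIntegral.integral_finsetSum fun i _ => hint i]
    simp_rw [← Polynomial.eval_finsetSum, bernsteinPolynomial.sum]
    simp
  rw [Finset.sum_congr rfl (g := fun _ => ∫ t in (0 : ℝ)..1, (bernsteinPolynomial ℝ m 0).eval t)
    fun i hi => heq i (by simpa [Nat.lt_succ_iff] using hi)] at hsum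
  rw [heq j hj, eq_div_iff (by positivity)]
  simpa [mul_comm] using hsum

/-- Jensen's inequality for the logarithm of a sum of exponentials. -/
lemma log_sum_exp_ge {α : Type*} {s : Finset α} (hs : s.Nonempty) (y z : α → ℝ) :
    Real.log (∑ k ∈ s, Real.exp (z k)) +
      ∑ k ∈ s, Real.exp (z k) / (∑ k ∈ s, Real.exp (z k)) * (y k - z k) ≤
    Real.log (∑ k ∈ s, Real.exp (y k)) := by
  set W := ∑ k ∈ s, Real.exp (z k) with hW
  have hWpos : 0 < W := Finset.sum_pos (fun _ _ => Real.exp_pos _) hs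
  have hS : 0 < ∑ k ∈ s, Real.exp (y k) := Finset.sum_pos (fun _ _ => Real.exp_pos _) hs
  -- With the Gibbs weights of z, the average of exp(y - z) is the ratio of the two exponential
  -- sums.
  have h := convexOn_exp.map_sum_le (t := s) (w := fun k => Real.exp (z k) / W)
    (p := fun k => y k - z k) (fun k _ => by positivity)
    (by rw [← Finset.sum_div, ← hW, div_self hWpos.ne']) (fun _ _ => Set.mem_univ _)
  simp only [smul_eq_mul] at h
  have h2 : ∑ k ∈ s, Real.exp (z k) / W * Real.exp (y k - z k) =
      (∑ k ∈ s, Real.exp (y k)) / W := by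
    rw [Finset.sum_div]
    refine Finset.sum_congr rfl fun k _ => ?_
    rw [Real.exp_sub]
    field_simp
  rw [h2] at h
  have h3 := Real.log_le_log (Real.exp_pos _) h
  rw [Real.log_exp, Real.log_div hS.ne' hWpos.ne'] at h3
  linarith

/-- Jensen's inequality for the logarithm of a finite sum. -/
lemma log_sum_ge {α : Type*} {s : Finset α} (hs : s.Nonempty) (x : α → ℝ) (hx : ∀ k ∈ s, 0 < x k) :
    Real.log s.card + (∑ k ∈ s, Real.log (x k)) / s.card ≤ Real.log (∑ k ∈ s, x k) := by
  have h := log_sum_exp_ge hs (fun k => Real.log (x k)) (fun _ => 0)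
  rw [Finset.sum_congr rfl (fun k hk => Real.exp_log (hx k hk))] at h
  simp only [Real.exp_zero, Finset.sum_const, nsmul_eq_mul, mul_one, sub_zero] at h
  refine le_trans (le_of_eq ?_) h
  rw [Finset.sum_div]
  congr 1
  exact Finset.sum_congr rfl fun k _ => by ring

/-! ### Means of uniform order statistics. -/

section OrderStatistics

variable {ι : Type*} [Fintype ι]

/-- The order statistics of the coordinates enumerated by `g`. -/
def orderStat {m : ℕ} (g : Fin m → ι) (ω : ι → ℝ) (k : Fin m) : ℝ :=
  ω (g (Tuple.sort (ω ∘ g) k))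

lemma orderStat_le_iff {ι : Type*} {m : ℕ} (g : Fin m → ι) (ω : ι → ℝ) (k : Fin m) (t : ℝ) :
    orderStat g ω k ≤ t ↔ (k : ℕ) < (Finset.univ.filter fun i => ω (g i) ≤ t).card := by
  have h := Tuple.lt_card_le_iff_apply_le_of_monotone (a := t) (j := k) (Tuple.monotone_sort (ω ∘ g))
  have h2 : (Finset.univ.filter fun i => ω (g i) ≤ t).card =
      (Finset.univ.filter fun i => ((ω ∘ g) ∘ Tuple.sort (ω ∘ g)) i ≤ t).card := by
    refine (Finset.card_bij (fun i _ => Tuple.sort (ω ∘ g) i) ?_ ?_ ?_).symm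
    · intro i hi; simpa using hi
    · intro i _ j _ hij; exact (Tuple.sort (ω ∘ g)).injective hij
    · intro i hi
      exact ⟨(Tuple.sort (ω ∘ g)).symm i, by simpa using hi, by simp⟩
  rw [h2]
  exact h.symm

lemma measurable_orderStat {ι : Type*} {m : ℕ} (g : Fin m → ι) (k : Fin m) :
    Measurable fun ω : ι → ℝ => orderStat g ω k := by
  refine measurable_of_Iic fun t => ?_
  have : (fun ω : ι → ℝ => orderStat g ω k) ⁻¹' Set.Iic t =
      {ω | (k : ℕ) < ∑ i, if ω (g i) ≤ t then 1 else 0} := by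
    ext ω
    simp only [Set.mem_preimage, Set.mem_Iic, orderStat_le_iff, Set.mem_ofPred_eq,
      Finset.card_filter]
  rw [this]
  refine measurableSet_lt measurable_const (Finset.measurable_sum _ fun i _ => ?_)
  exact Measurable.ite (measurableSet_le (measurable_pi_apply _) measurable_const)
    measurable_const measurable_const

lemma integrable_orderStat {m : ℕ} (g : Fin m → ι) (k : Fin m) :
    Integrable (fun ω : ι → ℝ => orderStat g ω k) (unifLaw ι) := by
  refine integrable_of_le_on_cube (measurable_orderStat g k) 1 fun ω hω => ?_
  have := hω (g (Tuple.sort (ω ∘ g) k))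
  rw [orderStat, abs_le]
  exact ⟨by linarith [this.1], this.2⟩

/-- The expectation of the order statistics of independent uniform variables. -/
lemma integral_orderStat {m : ℕ} {g : Fin m → ι} (hg : Function.Injective g) (k : Fin m) :
    ∫ ω, orderStat g ω k ∂(unifLaw ι) = (k + 1) / (m + 1) := by
  classical
  have hprob : ∀ t ∈ Set.Icc (0 : ℝ) 1, (unifLaw ι).real {ω | t < orderStat g ω k} =
      ∑ j ∈ Finset.range (k + 1), (bernsteinPolynomial ℝ m j).eval t := by
    intro t ht
    have hset : {ω : ι → ℝ | t < orderStat g ω k} = ⋃ j ∈ Finset.range (k + 1),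
        {ω : ι → ℝ | ((Finset.univ.image g).filter fun e => ω e ≤ t).card = j} := by
      ext ω
      simp only [Set.mem_ofPred_eq, Set.mem_iUnion, Finset.mem_range, exists_prop,
        exists_eq_right', ← not_le, orderStat_le_iff]
      rw [Finset.filter_image, Finset.card_image_of_injective _ hg]
      simp
    rw [hset, measureReal_biUnion_finset]
    · exact Finset.sum_congr rfl fun j _ => measureReal_card_eq ht.1 ht.2 j _
        (by rw [Finset.card_image_of_injective _ hg]; simp)
    · intro i _ j _ hij
      rw [Function.onFun, Set.disjoint_left]
      intro ω h1 h2
      exact hij (h1.symm.trans h2)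
    · intro j _
      simp only [Finset.card_filter]
      refine measurableSet_eq_fun (Finset.measurable_sum _ fun i _ => ?_) measurable_const
      exact Measurable.ite (measurableSet_le (measurable_pi_apply _) measurable_const)
        measurable_const measurable_const
  have hnn : 0 ≤ᵐ[unifLaw ι] fun ω => orderStat g ω k := by
    filter_upwards [ae_mem_cube] with ω hω
    exact (hω _).1
  -- Layer-cake formula: the tail probability is a sum of k + 1 Bernstein polynomials, each of
  -- integral 1/(m + 1).
  rw [(integrable_orderStat g k).integral_eq_integral_meas_lt hnn,
    setIntegral_eq_of_subset_of_forall_sdiff_eq_zero measurableSet_Ioi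
      (Set.Ioc_subset_Ioi_self : Set.Ioc (0 : ℝ) 1 ⊆ _)]
  · rw [setIntegral_congr_fun measurableSet_Ioc fun t ht => hprob t ⟨ht.1.le, ht.2⟩,
      ← intervalIntegral.integral_of_le zero_le_one, intervalIntegral.integral_finsetSum
        fun i _ => (Polynomial.continuous _).intervalIntegrable _ _,
      Finset.sum_congr rfl fun j hj => integral_bernsteinPolynomial (m := m) (j := j)
        (by have := Finset.mem_range.1 hj; omega)]
    simp [div_eq_mul_inv]
  · intro t ht
    have h1 : 1 < t := by
      by_contra h
      exact ht.2 ⟨ht.1, not_lt.1 h⟩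
    rw [measureReal_eq_zero_iff]
    refine measure_mono_null (t := {ω | ¬ ∀ e, ω e ∈ Set.Icc (0 : ℝ) 1}) ?_ ae_mem_cube
    intro ω hω hcube
    exact absurd (lt_trans h1 hω) (not_lt.2 (hcube _).2)

end OrderStatistics

/-! ### The mean logarithm of a sum of independent weights. -/

/-- The Laplace transform of the uniform law on `[0, 1]`. -/
def unifLaplace (γ : ℝ) : ℝ := ∫ x in (0 : ℝ)..1, Real.exp (-γ * x)

lemma unifLaplace_pos (γ : ℝ) : 0 < unifLaplace γ :=
  intervalIntegral.intervalIntegral_pos_of_pos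
    ((by fun_prop : Continuous fun x => Real.exp (-γ * x)).intervalIntegrable _ _)
    (fun _ => Real.exp_pos _) zero_lt_one

/-- A Riemann sum comparison: (k + 1)/(m + 1) is within 1/(m + 1) of every point of [k/m, (k +
1)/m], which costs a factor at most exp(|γ|/(m + 1)). -/
lemma mul_unifLaplace_le (γ : ℝ) {m : ℕ} (hm : 0 < m) :
    m * unifLaplace γ ≤
      Real.exp (|γ| / (m + 1)) * ∑ k : Fin m, Real.exp (-γ * (((k : ℕ) + 1) / (m + 1))) := by
  have hm' : (0 : ℝ) < m := by exact_mod_cast hm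
  have hcont : Continuous fun x => Real.exp (-γ * x) := by fun_prop
  have h := intervalIntegral.sum_integral_adjacent_intervals (a := fun k : ℕ => (k : ℝ) / m)
    (n := m) (f := fun x => Real.exp (-γ * x)) (μ := volume)
    (fun k _ => hcont.intervalIntegrable _ _)
  simp only [Nat.cast_zero, zero_div, div_self hm'.ne'] at h
  rw [unifLaplace, ← h, Finset.mul_sum, Finset.mul_sum, ← Fin.sum_univ_eq_sum_range
    (fun k => (m : ℝ) * ∫ x in ((k : ℕ) : ℝ) / m..((k + 1 : ℕ) : ℝ) / m, Real.exp (-γ * x))]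
  refine Finset.sum_le_sum fun k _ => ?_
  have hk : ((k : ℕ) : ℝ) + 1 ≤ m := by exact_mod_cast k.2
  have hlen : (((k : ℕ) + 1 : ℕ) : ℝ) / m - ((k : ℕ) : ℝ) / m = 1 / m := by
    push_cast; ring
  have hle : ((k : ℕ) : ℝ) / m ≤ (((k : ℕ) + 1 : ℕ) : ℝ) / m := by
    have : (0 : ℝ) < 1 / m := by positivity
    linarith
  have hbd : ∫ x in ((k : ℕ) : ℝ) / m..(((k : ℕ) + 1 : ℕ) : ℝ) / m, Real.exp (-γ * x) ≤
      ∫ _x in ((k : ℕ) : ℝ) / m..(((k : ℕ) + 1 : ℕ) : ℝ) / m,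
        Real.exp (|γ| / (m + 1)) * Real.exp (-γ * (((k : ℕ) + 1) / (m + 1))) := by
    refine intervalIntegral.integral_mono_on hle (hcont.intervalIntegrable _ _)
      (by simp) fun x hx => ?_
    rw [← Real.exp_add]
    refine Real.exp_le_exp.2 ?_
    have hx1 : ((k : ℕ) : ℝ) ≤ x * m := (div_le_iff₀ hm').1 hx.1
    have hx2 : x * m ≤ (k : ℕ) + 1 := by
      have := (le_div_iff₀ hm').1 hx.2
      push_cast at this
      exact this
    have hdist : |(((k : ℕ) : ℝ) + 1) / (m + 1) - x| ≤ 1 / (m + 1) := by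
      have hk0 : (0 : ℝ) ≤ (k : ℕ) := Nat.cast_nonneg _
      rw [abs_le]
      constructor
      · rw [neg_le_sub_iff_le_add, ← add_div, le_div_iff₀ (by positivity)]
        nlinarith
      · rw [sub_le_iff_le_add, ← sub_le_iff_le_add', ← sub_div, div_le_iff₀ (by positivity)]
        nlinarith
    have h1 : γ * ((((k : ℕ) : ℝ) + 1) / (m + 1) - x) ≤ |γ| * (1 / (m + 1)) :=
      (le_abs_self _).trans (by rw [abs_mul]; gcongr)
    have h2 : |γ| / (m + 1) = |γ| * (1 / (m + 1)) := by ring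
    rw [h2]
    linarith
  rw [intervalIntegral.integral_const, hlen, smul_eq_mul] at hbd
  calc (m : ℝ) * _ ≤ m * (1 / m * (Real.exp (|γ| / (m + 1)) *
        Real.exp (-γ * (((k : ℕ) + 1) / (m + 1))))) := by gcongr
    _ = _ := by field_simp

lemma measurable_sum_exp {ι : Type*} (γ : ℝ) (D : Finset ι) :
    Measurable fun ω : ι → ℝ => ∑ e ∈ D, Real.exp (-γ * ω e) := by
  refine Finset.measurable_sum _ fun e _ => ?_
  exact Real.measurable_exp.comp ((measurable_pi_apply e).const_mul _)

lemma integrable_log_sum_exp {ι : Type*} [Fintype ι] (γ : ℝ) {D : Finset ι} (hD : D.Nonempty) :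
    Integrable (fun ω : ι → ℝ => Real.log (∑ e ∈ D, Real.exp (-γ * ω e))) (unifLaw ι) := by
  have hc : (0 : ℝ) < D.card := by exact_mod_cast hD.card_pos
  refine integrable_of_le_on_cube (Real.measurable_log.comp (measurable_sum_exp γ D))
    (|γ| + |Real.log D.card|) fun ω hω => ?_
  have hb : ∀ e, |-γ * ω e| ≤ |γ| := by
    intro e
    rw [abs_mul, abs_neg]
    exact mul_le_of_le_one_right (abs_nonneg _) (abs_le.2 ⟨by linarith [(hω e).1], (hω e).2⟩)
  have h1 : D.card * Real.exp (-|γ|) ≤ ∑ e ∈ D, Real.exp (-γ * ω e) := by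
    rw [← nsmul_eq_mul]
    exact Finset.card_nsmul_le_sum _ _ _ fun e _ => Real.exp_le_exp.2 (neg_le_of_abs_le (hb e))
  have h2 : ∑ e ∈ D, Real.exp (-γ * ω e) ≤ D.card * Real.exp |γ| := by
    rw [← nsmul_eq_mul]
    exact Finset.sum_le_card_nsmul _ _ _ fun e _ => Real.exp_le_exp.2 (le_of_abs_le (hb e))
  have h3 := Real.log_le_log (by positivity) h1
  have h4 := Real.log_le_log (lt_of_lt_of_le (by positivity) h1) h2
  rw [Real.log_mul hc.ne' (Real.exp_pos _).ne', Real.log_exp] at h3 h4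
  rw [abs_le]
  constructor <;> cases abs_cases (Real.log D.card) <;> linarith

/-- Lower bound for the expected logarithm of a sum of weights. -/
lemma integral_log_sum_exp_ge {ι : Type*} [Fintype ι] (γ : ℝ) {D : Finset ι} (hD : D.Nonempty) :
    Real.log (D.card * unifLaplace γ) - |γ| / (D.card + 1) ≤
      ∫ ω, Real.log (∑ e ∈ D, Real.exp (-γ * ω e)) ∂(unifLaw ι) := by
  set m := D.card with hm
  have hmpos : 0 < m := hD.card_pos
  have : Nonempty (Fin m) := ⟨⟨0, hmpos⟩⟩
  let g : Fin m → ι := fun i => (D.equivFin.symm i : ι)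
  have hg : Function.Injective g := fun i j h => D.equivFin.symm.injective (Subtype.ext h)
  -- The reference point is -γ times the mean of each order statistic, so the linear correction in
  -- Jensen's inequality has mean zero.
  let z : Fin m → ℝ := fun k => -γ * (((k : ℕ) + 1) / (m + 1))
  set W := ∑ k, Real.exp (z k) with hW
  have hsum : ∀ ω : ι → ℝ, ∑ e ∈ D, Real.exp (-γ * ω e) =
      ∑ k, Real.exp (-γ * orderStat g ω k) := by
    intro ω
    rw [← Finset.sum_coe_sort D, ← Equiv.sum_comp D.equivFin.symm,
      ← Equiv.sum_comp (Tuple.sort (ω ∘ g))]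
    rfl
  have hpt : ∀ ω : ι → ℝ, Real.log W + ∑ k, Real.exp (z k) / W * (-γ * orderStat g ω k - z k) ≤
      Real.log (∑ e ∈ D, Real.exp (-γ * ω e)) := by
    intro ω
    rw [hsum]
    exact log_sum_exp_ge Finset.univ_nonempty _ _
  have hint : ∀ k, Integrable (fun ω : ι → ℝ =>
      Real.exp (z k) / W * (-γ * orderStat g ω k - z k)) (unifLaw ι) := fun k =>
    (((integrable_orderStat g k).const_mul _).sub (integrable_const _)).const_mul _
  have hexp : ∫ ω, (Real.log W + ∑ k, Real.exp (z k) / W * (-γ * orderStat g ω k - z k))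
      ∂(unifLaw ι) = Real.log W := by
    rw [integral_add (integrable_const _) (integrable_finsetSum _ fun k _ => hint k),
      integral_finsetSum _ fun k _ => hint k]
    have h0 : ∀ k, ∫ ω, Real.exp (z k) / W * (-γ * orderStat g ω k - z k) ∂(unifLaw ι) = 0 := by
      intro k
      rw [integral_const_mul, integral_sub ((integrable_orderStat g k).const_mul _)
        (integrable_const _), integral_const_mul, integral_orderStat hg]
      simp [z]
    rw [Finset.sum_eq_zero fun k _ => h0 k]
    simp
  have hle := integral_mono ((integrable_const (Real.log W)).add
    (integrable_finsetSum _ fun k _ => hint k)) (integrable_log_sum_exp γ hD) hpt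
  refine le_trans ?_ (hexp ▸ hle)
  have h1 := mul_unifLaplace_le γ hmpos
  have hWpos : 0 < W := Finset.sum_pos (fun _ _ => Real.exp_pos _) Finset.univ_nonempty
  have h2 := Real.log_le_log (mul_pos (by exact_mod_cast hmpos) (unifLaplace_pos γ)) h1
  rw [Real.log_mul (Real.exp_pos _).ne' hWpos.ne', Real.log_exp] at h2
  linarith

/-- A crude form of Stirling suffices: the excess log m + 1 is paid once per generation. -/
lemma log_factorial_le {m : ℕ} (hm : 0 < m) :
    Real.log m.factorial ≤ m * Real.log m - m + Real.log m + 1 := by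
  induction m, hm using Nat.le_induction with
  | base => simp
  | succ m hm ih =>
    have h0 : (0 : ℝ) < m := by exact_mod_cast hm
    rw [Nat.factorial_succ, Nat.cast_mul, Real.log_mul (by positivity) (by positivity)]
    have h1 : 1 - ((m : ℝ) + 1)⁻¹ * m ≤ Real.log (m + 1) - Real.log m := by
      have := Real.one_sub_inv_le_log_of_pos (x := ((m : ℝ) + 1) / m) (by positivity)
      rw [Real.log_div (by positivity) (by positivity), inv_div, div_eq_inv_mul] at this
      exact this
    have h2 : ((m : ℝ) + 1) * (1 - ((m : ℝ) + 1)⁻¹ * m) = 1 := by field_simp; ring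
    have h3 := mul_le_mul_of_nonneg_left h1 (by positivity : (0 : ℝ) ≤ m + 1)
    push_cast
    linarith

lemma le_log_factorial (m : ℕ) : m * Real.log m - m ≤ Real.log m.factorial := by
  induction m with
  | zero => simp
  | succ m ih =>
    rcases Nat.eq_zero_or_pos m with rfl | hm
    · simp
    have h0 : (0 : ℝ) < m := by exact_mod_cast hm
    rw [Nat.factorial_succ, Nat.cast_mul, Real.log_mul (by positivity) (by positivity)]
    have h1 : Real.log (m + 1) - Real.log m ≤ ((m : ℝ) + 1) / m - 1 := by
      have := Real.log_le_sub_one_of_pos (x := ((m : ℝ) + 1) / m) (by positivity)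
      rwa [Real.log_div (by positivity) (by positivity)] at this
    have h2 : (m : ℝ) * (((m : ℝ) + 1) / m - 1) = 1 := by field_simp; ring
    have h3 := mul_le_mul_of_nonneg_left h1 h0.le
    push_cast
    linarith

/-! ### Lower bound for the mean logarithm of the forest sum. -/

section Forests

variable {n : ℕ}

lemma measurable_extendEnv (e : Sym2 (Fin n)) : Measurable fun ω : Env n => extendEnv ω e := by
  unfold extendEnv
  split_ifs
  · exact measurable_pi_apply _
  · exact measurable_const

lemma extendEnv_mem_Icc {ω : Env n} (hω : ∀ e, ω e ∈ Set.Icc (0 : ℝ) 1) (e : Sym2 (Fin n)) :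
    extendEnv ω e ∈ Set.Icc (0 : ℝ) 1 := by
  unfold extendEnv
  split_ifs
  · exact hω _
  · simp

lemma pairWeight_pos (γ : ℝ) (ω : Env n) (u v : Fin n) : 0 < pairWeight γ ω u v :=
  Real.exp_pos _

lemma measurable_pairWeight (γ : ℝ) (u v : Fin n) :
    Measurable fun ω : Env n => pairWeight γ ω u v :=
  Real.measurable_exp.comp ((measurable_extendEnv _).const_mul _)

lemma pairWeight_mem_Icc (γ : ℝ) {ω : Env n} (hω : ∀ e, ω e ∈ Set.Icc (0 : ℝ) 1) (u v : Fin n) :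
    pairWeight γ ω u v ∈ Set.Icc (Real.exp (-|γ|)) (Real.exp |γ|) := by
  have h := extendEnv_mem_Icc hω s(u, v)
  have hb : |-γ * extendEnv ω s(u, v)| ≤ |γ| := by
    rw [abs_mul, abs_neg]
    exact mul_le_of_le_one_right (abs_nonneg _) (abs_le.2 ⟨by linarith [h.1], h.2⟩)
  exact ⟨Real.exp_le_exp.2 (neg_le_of_abs_le hb), Real.exp_le_exp.2 (le_of_abs_le hb)⟩

lemma measurable_forestSum (γ : ℝ) (A R : Finset (Fin n)) :
    Measurable fun ω : Env n => forestSum (pairWeight γ ω) A R :=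
  Finset.measurable_sum _ fun _ _ => Finset.measurable_prod _ fun _ _ => measurable_pairWeight _ _ _

lemma forestSum_pos (γ : ℝ) (ω : Env n) (A : Finset (Fin n)) {R : Finset (Fin n)}
    (hR : R.Nonempty) : 0 < forestSum (pairWeight γ ω) A R :=
  Finset.sum_pos (fun _ _ => Finset.prod_pos fun _ _ => pairWeight_pos _ _ _ _)
    (parentFns_nonempty A hR)

lemma integrable_log_forestSum (γ : ℝ) (A : Finset (Fin n)) {R : Finset (Fin n)}
    (hR : R.Nonempty) :
    Integrable (fun ω : Env n => Real.log (forestSum (pairWeight γ ω) A R)) (envLaw n) := by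
  have hc : (0 : ℝ) < (parentFns A R).card := by exact_mod_cast (parentFns_nonempty A hR).card_pos
  refine integrable_of_le_on_cube (Real.measurable_log.comp (measurable_forestSum γ A R))
    (|Real.log (parentFns A R).card| + A.card * |γ|) fun ω hω => ?_
  have h1 : (parentFns A R).card * Real.exp (-|γ|) ^ A.card ≤ forestSum (pairWeight γ ω) A R := by
    rw [← nsmul_eq_mul]
    refine Finset.card_nsmul_le_sum _ _ _ fun f _ => ?_
    rw [← Finset.prod_const]
    exact Finset.prod_le_prod (fun _ _ => (Real.exp_pos _).le)
      fun v _ => (pairWeight_mem_Icc γ hω _ _).1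
  have h2 : forestSum (pairWeight γ ω) A R ≤ (parentFns A R).card * Real.exp |γ| ^ A.card := by
    rw [← nsmul_eq_mul]
    refine Finset.sum_le_card_nsmul _ _ _ fun f _ => ?_
    rw [← Finset.prod_const]
    exact Finset.prod_le_prod (fun _ _ => (pairWeight_pos _ _ _ _).le)
      fun v _ => (pairWeight_mem_Icc γ hω _ _).2
  have h3 := Real.log_le_log (by positivity) h1
  have h4 := Real.log_le_log (lt_of_lt_of_le (by positivity) h1) h2
  rw [Real.log_mul hc.ne' (by positivity), Real.log_pow, Real.log_exp] at h3 h4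
  rw [abs_le]
  constructor <;> cases abs_cases (Real.log (parentFns A R).card) <;> nlinarith

/-- The edges between `v` and the vertices in `R`. -/
lemma exists_star_edges (v : Fin n) {R : Finset (Fin n)} (hv : v ∉ R) :
    ∃ D : Finset (Edge n), D.card = R.card ∧ ∀ (γ : ℝ) (ω : Env n),
      ∑ u ∈ R, pairWeight γ ω v u = ∑ e ∈ D, Real.exp (-γ * ω e) := by
  have hmem : ∀ u : R, s(v, (u : Fin n)) ∈ (⊤ : SimpleGraph (Fin n)).edgeSet := by
    intro u
    rw [SimpleGraph.mem_edgeSet, SimpleGraph.top_adj]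
    exact fun h => hv (h ▸ u.2)
  let g : R ↪ Edge n := ⟨fun u => ⟨s(v, (u : Fin n)), hmem u⟩, fun a b hab => by
    have h := congrArg Subtype.val hab
    exact Subtype.ext (Sym2.congr_right.1 h)⟩
  refine ⟨Finset.univ.map g, by simp, fun γ ω => ?_⟩
  rw [Finset.sum_map, ← Finset.sum_coe_sort R]
  refine Finset.sum_congr rfl fun u _ => ?_
  rw [pairWeight, ← extendEnv_coe ω (g u)]
  rfl

lemma integrable_log_star (γ : ℝ) (v : Fin n) {R : Finset (Fin n)} (hv : v ∉ R)
    (hR : R.Nonempty) :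
    Integrable (fun ω : Env n => Real.log (∑ u ∈ R, pairWeight γ ω v u)) (envLaw n) := by
  obtain ⟨D, hD, h⟩ := exists_star_edges v hv
  simp only [h]
  exact integrable_log_sum_exp γ (Finset.card_pos.1 (hD ▸ hR.card_pos))

lemma integral_log_star_ge (γ : ℝ) (v : Fin n) {R : Finset (Fin n)} (hv : v ∉ R)
    (hR : R.Nonempty) :
    Real.log (R.card * unifLaplace γ) - |γ| / (R.card + 1) ≤
      ∫ ω, Real.log (∑ u ∈ R, pairWeight γ ω v u) ∂(envLaw n) := by
  obtain ⟨D, hD, h⟩ := exists_star_edges v hv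
  simp only [h]
  rw [← hD]
  exact integral_log_sum_exp_ge γ (Finset.card_pos.1 (hD ▸ hR.card_pos))

/-- Lower bound for the expected logarithm of the forest sum, by choosing a first layer of
size `j`. -/
lemma integral_log_forestSum_layer (γ : ℝ) {A R : Finset (Fin n)} (hAR : Disjoint A R)
    (hR : R.Nonempty) {j : ℕ} (hj : 0 < j) (hjA : j ≤ A.card) {L : ℝ}
    (hL : ∀ J ⊆ A, J.card = j →
      L ≤ ∫ ω, Real.log (forestSum (pairWeight γ ω) (A \ J) J) ∂(envLaw n)) :
    Real.log (A.card.choose j) + j * (Real.log (R.card * unifLaplace γ) - |γ| / (R.card + 1)) + L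
      ≤ ∫ ω, Real.log (forestSum (pairWeight γ ω) A R) ∂(envLaw n) := by
  classical
  set S := A.powersetCard j with hS
  have hScard : S.card = A.card.choose j := Finset.card_powersetCard _ _
  have hSne : S.Nonempty := Finset.powersetCard_nonempty.2 hjA
  have hSpos : (0 : ℝ) < S.card := by exact_mod_cast hSne.card_pos
  have hJ : ∀ J ∈ S, J ⊆ A ∧ J.card = j := fun J h => Finset.mem_powersetCard.1 h
  have hJne : ∀ J ∈ S, J.Nonempty := fun J h => Finset.card_pos.1 ((hJ J h).2 ▸ hj)
  have hstar : ∀ (ω : Env n) (v : Fin n), 0 < ∑ u ∈ R, pairWeight γ ω v u := fun ω v =>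
    Finset.sum_pos (fun _ _ => pairWeight_pos _ _ _ _) hR
  -- Only first generations of size exactly j are kept; concavity of the logarithm is then used with
  -- equal weights on these sets.
  have hpt : ∀ ω : Env n, Real.log S.card + (∑ J ∈ S,
      (∑ v ∈ J, Real.log (∑ u ∈ R, pairWeight γ ω v u) +
        Real.log (forestSum (pairWeight γ ω) (A \ J) J))) / S.card ≤
      Real.log (forestSum (pairWeight γ ω) A R) := by
    intro ω
    have h1 := log_sum_ge hSne (fun J => (∏ v ∈ J, ∑ u ∈ R, pairWeight γ ω v u) *
      forestSum (pairWeight γ ω) (A \ J) J) fun J hJS =>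
        mul_pos (Finset.prod_pos fun v _ => hstar ω v) (forestSum_pos γ ω _ (hJne J hJS))
    have h2 : ∑ J ∈ S, (∏ v ∈ J, ∑ u ∈ R, pairWeight γ ω v u) *
        forestSum (pairWeight γ ω) (A \ J) J ≤ forestSum (pairWeight γ ω) A R := by
      rw [forestSum_eq_sum_powerset _ hAR]
      refine Finset.sum_le_sum_of_subset_of_nonneg (fun J hJS => Finset.mem_powerset.2 (hJ J hJS).1)
        fun J _ _ => mul_nonneg (Finset.prod_nonneg fun v _ => (hstar ω v).le) ?_
      exact Finset.sum_nonneg fun _ _ => Finset.prod_nonneg fun _ _ => (pairWeight_pos _ _ _ _).le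
    have h3 := Real.log_le_log (Finset.sum_pos (fun J hJS =>
        mul_pos (Finset.prod_pos fun v _ => hstar ω v) (forestSum_pos γ ω _ (hJne J hJS))) hSne) h2
    refine le_trans (le_of_eq ?_) (h1.trans h3)
    congr 2
    refine Finset.sum_congr rfl fun J hJS => ?_
    rw [Real.log_mul (Finset.prod_pos fun v _ => hstar ω v).ne'
      (forestSum_pos γ ω _ (hJne J hJS)).ne', Real.log_prod fun v _ => (hstar ω v).ne']
  have hdisj : ∀ J ∈ S, ∀ v ∈ J, v ∉ R := fun J hJS v hv =>
    Finset.disjoint_left.1 hAR ((hJ J hJS).1 hv)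
  have hi1 : ∀ J ∈ S, Integrable (fun ω : Env n =>
      ∑ v ∈ J, Real.log (∑ u ∈ R, pairWeight γ ω v u)) (envLaw n) := fun J hJS =>
    integrable_finsetSum _ fun v hv => integrable_log_star γ v (hdisj J hJS v hv) hR
  have hi2 : ∀ J ∈ S, Integrable (fun ω : Env n =>
      Real.log (forestSum (pairWeight γ ω) (A \ J) J)) (envLaw n) := fun J hJS =>
    integrable_log_forestSum γ _ (hJne J hJS)
  have hi12 : ∀ J ∈ S, Integrable (fun ω : Env n =>
      ∑ v ∈ J, Real.log (∑ u ∈ R, pairWeight γ ω v u) +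
        Real.log (forestSum (pairWeight γ ω) (A \ J) J)) (envLaw n) := fun J hJS =>
    (hi1 J hJS).add (hi2 J hJS)
  have hi3 : Integrable (fun ω : Env n => (∑ J ∈ S,
      (∑ v ∈ J, Real.log (∑ u ∈ R, pairWeight γ ω v u) +
        Real.log (forestSum (pairWeight γ ω) (A \ J) J))) / S.card) (envLaw n) :=
    (integrable_finsetSum _ hi12).div_const _
  have hint := integral_mono ((integrable_const (Real.log S.card)).add hi3)
    (integrable_log_forestSum γ A hR) hpt
  refine le_trans ?_ hint
  simp only [Pi.add_apply]
  rw [integral_add (integrable_const _) hi3, integral_div, integral_finsetSum _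
    hi12, hScard]
  simp only [integral_const, probReal_univ, one_smul]
  rw [add_assoc]
  gcongr
  rw [← hScard, le_div_iff₀ hSpos, mul_comm, ← nsmul_eq_mul]
  refine Finset.card_nsmul_le_sum _ _ _ fun J hJS => ?_
  rw [integral_add (hi1 J hJS) (hi2 J hJS), integral_finsetSum _
    fun v hv => integrable_log_star γ v (hdisj J hJS v hv) hR]
  gcongr
  · rw [← (hJ J hJS).2, ← nsmul_eq_mul]
    exact Finset.card_nsmul_le_sum _ _ _ fun v hv =>
      integral_log_star_ge γ v (hdisj J hJS v hv) hR
  · exact hL J (hJ J hJS).1 (hJ J hJS).2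

/-- Writing log C(a, j) = log a! - log j! - log (a - j)! makes the leading terms telescope over
generations, so only the net gain j log |R| - log j! minus the star error has to be tracked. -/
lemma integral_log_forestSum_layer' (γ : ℝ) {A R : Finset (Fin n)} (hAR : Disjoint A R)
    (hR : R.Nonempty) {j : ℕ} (hj : 0 < j) (hjA : j ≤ A.card) {B : ℝ}
    (hB : ∀ J ⊆ A, J.card = j →
      (A.card - j : ℕ) * Real.log (unifLaplace γ) + Real.log (A.card - j).factorial + B ≤
        ∫ ω, Real.log (forestSum (pairWeight γ ω) (A \ J) J) ∂(envLaw n)) :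
    A.card * Real.log (unifLaplace γ) + Real.log A.card.factorial +
      (B + (j * Real.log R.card - Real.log j.factorial - j * |γ| / (R.card + 1)))
      ≤ ∫ ω, Real.log (forestSum (pairWeight γ ω) A R) ∂(envLaw n) := by
  refine le_trans (le_of_eq ?_) (integral_log_forestSum_layer γ hAR hR hj hjA hB)
  have hr : (R.card : ℝ) ≠ 0 := by exact_mod_cast hR.card_pos.ne'
  have hfac : Real.log A.card.factorial = Real.log (A.card.choose j) + Real.log j.factorial +
      Real.log (A.card - j).factorial := by
    have hch : (A.card.choose j : ℝ) ≠ 0 := by exact_mod_cast (Nat.choose_pos hjA).ne'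
    rw [← Real.log_mul hch (by positivity), ← Real.log_mul (by positivity) (by positivity)]
    congr 1
    exact_mod_cast (Nat.choose_mul_factorial_mul_factorial hjA).symm
  rw [hfac, Real.log_mul hr (unifLaplace_pos γ).ne', Nat.cast_sub hjA]
  ring

/-- Layers of constant size `m`. -/
lemma integral_log_forestSum_ge_of_card_eq (γ : ℝ) {m : ℕ} (hm : 0 < m) {A R : Finset (Fin n)}
    (hAR : Disjoint A R) (hR : R.card = m) :
    A.card * Real.log (unifLaplace γ) + Real.log A.card.factorial +
      (A.card - (Real.log m + 1 + |γ|) * ((A.card / m : ℕ) + 1)) ≤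
      ∫ ω, Real.log (forestSum (pairWeight γ ω) A R) ∂(envLaw n) := by
  have hlog : 0 ≤ Real.log m := Real.log_natCast_nonneg m
  have hγ := abs_nonneg γ
  induction h : A.card using Nat.strong_induction_on generalizing A R with
  | _ a ih =>
    subst h
    have hRne : R.Nonempty := Finset.card_pos.1 (hR ▸ hm)
    rcases A.eq_empty_or_nonempty with rfl | hA
    · simp [forestSum_empty_left]
      linarith
    -- Stirling with j ≤ m = |R| gives j log m - log j! ≥ j - log m - 1, and the star error is at
    -- most |γ|. The gains j add up to |A|, which later turns log |A|! into |A| log |A|.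
    have hgain : ∀ j : ℕ, 0 < j → j ≤ m → (j : ℝ) - (Real.log m + 1 + |γ|) ≤
        j * Real.log R.card - Real.log j.factorial - j * |γ| / (R.card + 1) := by
      intro j hj hjm
      have hj' : (0 : ℝ) < j := by exact_mod_cast hj
      have hjm' : (j : ℝ) ≤ m := by exact_mod_cast hjm
      have h1 := log_factorial_le hj
      have h2 : Real.log j ≤ Real.log m := Real.log_le_log hj' hjm'
      have h3 : j * |γ| / (R.card + 1) ≤ |γ| := by
        rw [div_le_iff₀ (by positivity), hR]
        nlinarith
      rw [hR] at h3 ⊢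
      nlinarith
    rcases lt_or_ge A.card m with hlt | hge
    · have h1 := integral_log_forestSum_layer' γ hAR hRne hA.card_pos le_rfl (B := 0) (by
        intro J hJA hJ
        have : A \ J = ∅ := by
          rw [Finset.eq_of_subset_of_card_le hJA hJ.ge]; simp
        simp [this, forestSum_empty_left])
      refine le_trans ?_ h1
      have h2 := hgain _ hA.card_pos hlt.le
      rw [Nat.div_eq_of_lt hlt]
      push_cast
      linarith
    · have h1 := integral_log_forestSum_layer' γ hAR hRne hm hge
        (B := (A.card - m : ℕ) - (Real.log m + 1 + |γ|) * (((A.card - m) / m : ℕ) + 1)) (by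
        intro J hJA hJ
        have hc : (A \ J).card = A.card - m := by rw [Finset.card_sdiff_of_subset hJA, hJ]
        have := ih (A.card - m) (by omega) (Finset.sdiff_disjoint : Disjoint (A \ J) J) hJ hc
        exact this)
      refine le_trans ?_ h1
      have h2 := hgain _ hm le_rfl
      have h3 : (((A.card - m) / m : ℕ) : ℝ) + 1 = (A.card / m : ℕ) := by
        rw [← Nat.cast_add_one]
        congr 1
        rw [Nat.div_eq_sub_div hm hge]
      rw [h3, Nat.cast_sub hge]
      linarith

/-- Layers of doubling size, up to the size `m = r 2 ^ k`, followed by layers of size `m`. -/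
lemma integral_log_forestSum_ge_of_doubling (γ : ℝ) {m : ℕ} (k : ℕ) {r : ℕ} (hr : 0 < r)
    (hm : r * 2 ^ k = m) {A R : Finset (Fin n)} (hAR : Disjoint A R) (hR : R.card = r)
    (hA : 2 * m ≤ A.card + 2 * r) :
    A.card * Real.log (unifLaplace γ) + Real.log A.card.factorial +
      (A.card - (Real.log m + 1 + |γ|) * ((A.card / m : ℕ) + 1 + 2 * k) - (2 * m - 2 * r)) ≤
      ∫ ω, Real.log (forestSum (pairWeight γ ω) A R) ∂(envLaw n) := by
  have hγ := abs_nonneg γ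
  induction k generalizing r A R with
  | zero =>
    have hm' : r = m := by simpa using hm
    subst hm'
    have := integral_log_forestSum_ge_of_card_eq γ hr hAR hR
    refine le_trans (le_of_eq ?_) this
    simp
  | succ k ih =>
    have hmk : 2 * r * 2 ^ k = m := by rw [← hm, pow_succ]; ring
    have h2k : 1 ≤ 2 ^ k := Nat.one_le_two_pow
    have hrm : 2 * r ≤ m := by nlinarith
    have hRne : R.Nonempty := Finset.card_pos.1 (hR ▸ hr)
    have hjA : 2 * r ≤ A.card := by omega
    -- A generation of size 2r below one of size r loses a further 2r log 2 ≤ 2r, and these losses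
    -- telescope to 2m - 2r. The star error is now up to 2|γ|, hence the coefficient 2k.
    have h1 := integral_log_forestSum_layer' γ hAR hRne (j := 2 * r) (by omega) hjA
      (B := (A.card - 2 * r : ℕ) - (Real.log m + 1 + |γ|) *
        (((A.card - 2 * r) / m : ℕ) + 1 + 2 * k) - (2 * m - 2 * (2 * r : ℕ))) (by
      intro J hJA hJ
      have hc : (A \ J).card = A.card - 2 * r := by rw [Finset.card_sdiff_of_subset hJA, hJ]
      have := ih (r := 2 * r) (by omega) hmk (Finset.sdiff_disjoint : Disjoint (A \ J) J) hJ
        (by omega)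
      rw [hc] at this
      exact this)
    refine le_trans ?_ h1
    have hr' : (0 : ℝ) < r := by exact_mod_cast hr
    have hdiv : (((A.card - 2 * r) / m : ℕ) : ℝ) ≤ (A.card / m : ℕ) := by
      exact_mod_cast Nat.div_le_div_right (Nat.sub_le _ _)
    have hfac := log_factorial_le (m := 2 * r) (by omega)
    have hlogm : Real.log ((2 * r : ℕ) : ℝ) ≤ Real.log m :=
      Real.log_le_log (by exact_mod_cast (by omega : 0 < 2 * r)) (by exact_mod_cast hrm)
    have hlog2 : Real.log ((2 * r : ℕ) : ℝ) = Real.log 2 + Real.log r := by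
      push_cast
      rw [Real.log_mul (by norm_num) hr'.ne']
    have hlt : Real.log 2 < 1 := Real.log_two_lt_d9.trans (by norm_num)
    have hlogr : 0 ≤ Real.log m := Real.log_natCast_nonneg m
    have h3 : ((2 * r : ℕ) : ℝ) * |γ| / (R.card + 1) ≤ 2 * |γ| := by
      rw [div_le_iff₀ (by positivity), hR]
      push_cast
      nlinarith
    have h4 : (Real.log m + 1 + |γ|) * (((A.card - 2 * r) / m : ℕ) + 1 + 2 * (k : ℝ)) ≤
        (Real.log m + 1 + |γ|) * ((A.card / m : ℕ) + 1 + 2 * (k : ℝ)) := by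
      have : 0 ≤ Real.log m + 1 + |γ| := by linarith
      gcongr
    rw [hR] at h3 ⊢
    rw [hlog2] at hfac hlogm
    have h5 : (r : ℝ) * Real.log 2 ≤ r := by nlinarith
    rw [Nat.cast_sub hjA]
    push_cast at *
    nlinarith

end Forests

/-! ### The quenched measure, convexity, and the annealed bound. -/

section Quenched

variable {n : ℕ}

lemma treeWeight_eq_exp (γ : ℝ) (ω : Env n) (T : SimpleGraph (Fin n)) :
    treeWeight γ ω T = Real.exp (-γ * treeLength ω T) := by
  rw [treeWeight, treeLength, Finset.mul_sum, Real.exp_sum]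

lemma treeWeight_pos (γ : ℝ) (ω : Env n) (T : SimpleGraph (Fin n)) : 0 < treeWeight γ ω T := by
  rw [treeWeight_eq_exp]
  exact Real.exp_pos _

lemma spanningTrees_nonempty (hn : 0 < n) : (spanningTrees n).Nonempty := by
  have : Nonempty (Fin n) := ⟨⟨0, hn⟩⟩
  obtain ⟨T, -, hT⟩ := (SimpleGraph.connected_top (V := Fin n)).exists_isTree_le
  exact ⟨T, mem_spanningTrees.2 hT⟩

lemma partitionFunction_pos (hn : 0 < n) (γ : ℝ) (ω : Env n) : 0 < partitionFunction γ ω :=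
  Finset.sum_pos (fun _ _ => treeWeight_pos _ _ _) (spanningTrees_nonempty hn)

lemma quenchedProb_nonneg (γ : ℝ) (ω : Env n) (T : SimpleGraph (Fin n)) :
    0 ≤ quenchedProb γ ω T :=
  div_nonneg (treeWeight_pos _ _ _).le (Finset.sum_nonneg fun _ _ => (treeWeight_pos _ _ _).le)

lemma sum_quenchedProb (hn : 0 < n) (γ : ℝ) (ω : Env n) :
    ∑ T ∈ spanningTrees n, quenchedProb γ ω T = 1 := by
  simp only [quenchedProb]
  rw [← Finset.sum_div]
  exact div_self (partitionFunction_pos hn γ ω).ne'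

lemma measurable_treeLength (T : SimpleGraph (Fin n)) :
    Measurable fun ω : Env n => treeLength ω T :=
  Finset.measurable_sum _ fun e _ => measurable_pi_apply e

lemma measurable_treeWeight (γ : ℝ) (T : SimpleGraph (Fin n)) :
    Measurable fun ω : Env n => treeWeight γ ω T := by
  simp only [treeWeight_eq_exp]
  exact Real.measurable_exp.comp ((measurable_treeLength T).const_mul _)

lemma measurable_partitionFunction (γ : ℝ) :
    Measurable fun ω : Env n => partitionFunction γ ω :=
  Finset.measurable_sum _ fun _ _ => measurable_treeWeight _ _

lemma measurable_quenchedLength (γ : ℝ) : Measurable fun ω : Env n => quenchedLength γ ω :=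
  Finset.measurable_sum _ fun _ _ =>
    ((measurable_treeWeight _ _).div (measurable_partitionFunction _)).mul (measurable_treeLength _)

lemma treeLength_mem_Icc {ω : Env n} (hω : ∀ e, ω e ∈ Set.Icc (0 : ℝ) 1)
    {T : SimpleGraph (Fin n)} (hT : T.IsTree) : treeLength ω T ∈ Set.Icc (0 : ℝ) n := by
  constructor
  · exact Finset.sum_nonneg fun e _ => (hω e).1
  · calc treeLength ω T ≤ (treeEdges T).card • (1 : ℝ) :=
        Finset.sum_le_card_nsmul _ _ _ fun e _ => (hω e).2
      _ ≤ n := by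
        rw [nsmul_eq_mul, mul_one]
        exact_mod_cast (by have := card_treeEdges hT; omega : (treeEdges T).card ≤ n)

lemma integrable_quenchedLength (γ : ℝ) :
    Integrable (fun ω : Env n => quenchedLength γ ω) (envLaw n) := by
  refine integrable_of_le_on_cube (measurable_quenchedLength γ) n fun ω hω => ?_
  rcases Nat.eq_zero_or_pos n with rfl | hn
  · have : spanningTrees 0 = ∅ := by
      rw [Finset.eq_empty_iff_forall_notMem]
      intro T hT
      exact (mem_spanningTrees.1 hT).nonempty.elim fun v => v.elim0
    simp [quenchedLength, this]
  have hL : ∀ T ∈ spanningTrees n, treeLength ω T ∈ Set.Icc (0 : ℝ) n := fun T hT =>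
    treeLength_mem_Icc hω (mem_spanningTrees.1 hT)
  rw [quenchedLength, abs_of_nonneg (Finset.sum_nonneg fun T hT =>
    mul_nonneg (quenchedProb_nonneg γ ω T) (hL T hT).1)]
  calc _ ≤ ∑ T ∈ spanningTrees n, quenchedProb γ ω T * n :=
        Finset.sum_le_sum fun T hT =>
          mul_le_mul_of_nonneg_left (hL T hT).2 (quenchedProb_nonneg γ ω T)
    _ = n := by rw [← Finset.sum_mul, sum_quenchedProb hn, one_mul]

/-- Convexity of the free energy. -/
lemma log_partitionFunction_sub_ge (hn : 0 < n) (γ γ' : ℝ) (ω : Env n) :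
    -(γ - γ') * quenchedLength γ' ω ≤
      Real.log (partitionFunction γ ω) - Real.log (partitionFunction γ' ω) := by
  have h := log_sum_exp_ge (spanningTrees_nonempty hn) (fun T => -γ * treeLength ω T)
    (fun T => -γ' * treeLength ω T)
  simp only [← treeWeight_eq_exp] at h
  have h2 : -(γ - γ') * quenchedLength γ' ω = ∑ T ∈ spanningTrees n,
      treeWeight γ' ω T / (∑ T ∈ spanningTrees n, treeWeight γ' ω T) *
        (-γ * treeLength ω T - -γ' * treeLength ω T) := by
    rw [quenchedLength, Finset.mul_sum]
    refine Finset.sum_congr rfl fun T _ => ?_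
    rw [quenchedProb, partitionFunction]
    ring
  rw [h2]
  unfold partitionFunction
  linarith

lemma integral_treeWeight (γ : ℝ) (T : SimpleGraph (Fin n)) :
    ∫ ω, treeWeight γ ω T ∂(envLaw n) = unifLaplace γ ^ (treeEdges T).card := by
  classical
  have h1 : ∀ ω : Env n, treeWeight γ ω T =
      ∏ e, (if e ∈ treeEdges T then Real.exp (-γ * ω e) else 1) := by
    intro ω
    rw [Finset.prod_ite_mem, Finset.univ_inter, treeWeight]
  simp only [h1]
  rw [envLaw, integral_fintype_prod_eq_prod (𝕜 := ℝ)
    (f := fun e x => if e ∈ treeEdges T then Real.exp (-γ * x) else 1),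
    ← Finset.prod_const, ← Finset.univ_inter (treeEdges T), ← Finset.prod_ite_mem]
  refine Finset.prod_congr rfl fun e _ => ?_
  rw [Finset.univ_inter]
  split_ifs
  · rw [unifLaplace, intervalIntegral.integral_of_le zero_le_one, integral_Icc_eq_integral_Ioc]
  · simp

lemma integrable_treeWeight (γ : ℝ) (T : SimpleGraph (Fin n)) :
    Integrable (fun ω : Env n => treeWeight γ ω T) (envLaw n) := by
  refine integrable_of_le_on_cube (measurable_treeWeight γ T)
    (Real.exp (|γ| * (treeEdges T).card)) fun ω hω => ?_
  rw [treeWeight_eq_exp, abs_of_pos (Real.exp_pos _)]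
  refine Real.exp_le_exp.2 ((le_abs_self _).trans ?_)
  rw [abs_mul, abs_neg]
  gcongr
  rw [treeLength, abs_of_nonneg (Finset.sum_nonneg fun e _ => (hω e).1)]
  simpa using Finset.sum_le_card_nsmul (treeEdges T) ω 1 fun e _ => (hω e).2

/-- Each tree has mean weight φ(γ)^(n-1), and Cayley's formula counts the trees. The bound gives
away a factor n, which is negligible at exponential scale. -/
lemma integral_partitionFunction_le (hn : 0 < n) (γ : ℝ) :
    ∫ ω, partitionFunction γ ω ∂(envLaw n) ≤ ((n : ℝ) * unifLaplace γ) ^ (n - 1) := by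
  have hn1 : (1 : ℝ) ≤ n := by exact_mod_cast hn
  simp only [partitionFunction]
  rw [integral_finsetSum _ fun T _ => integrable_treeWeight γ T,
    Finset.sum_congr rfl (g := fun _ => unifLaplace γ ^ (n - 1)), Finset.sum_const, nsmul_eq_mul,
    mul_pow, ← card_spanningTrees hn]
  · have : 0 ≤ unifLaplace γ ^ (n - 1) := by have := unifLaplace_pos γ; positivity
    gcongr
    nlinarith [(Nat.cast_nonneg (spanningTrees n).card : (0 : ℝ) ≤ _)]
  · intro T hT
    rw [integral_treeWeight]
    congr 1
    have := card_treeEdges (mem_spanningTrees.1 hT)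
    omega

/-- The deviation of the free energy from its annealed approximation. -/
def freeEnergyError (γ : ℝ) (ω : Env n) : ℝ :=
  Real.log (partitionFunction γ ω) - ((n : ℝ) - 1) * Real.log (n * unifLaplace γ)

lemma integrable_freeEnergyError (hn : 0 < n) (γ : ℝ) :
    Integrable (fun ω : Env n => freeEnergyError γ ω) (envLaw n) := by
  simp only [freeEnergyError, partitionFunction_eq_forestSum γ _ (⟨0, hn⟩ : Fin n)]
  exact (integrable_log_forestSum γ _ (by simp)).sub (integrable_const _)

/-- Generations of sizes 2, 4, ..., 2^i below a single root must fit into the n - 1 other vertices;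
this is the condition on i. The remaining generations have size 2^i, with a possibly shorter last
one, so there are about n/2^i of them. -/
lemma integral_freeEnergyError_ge (γ : ℝ) {i : ℕ} (hi : 2 * 2 ^ i ≤ n + 1) :
    -(1 + 2 * 2 ^ i + (Real.log n + 1 + |γ|) * ((n : ℝ) / 2 ^ i + 1 + 2 * i)) ≤
      ∫ ω, freeEnergyError γ ω ∂(envLaw n) := by
  have h1 : 1 ≤ 2 ^ i := Nat.one_le_two_pow
  have hn : 0 < n := by omega
  have hγ := abs_nonneg γ
  let r : Fin n := ⟨0, hn⟩
  have hcard : (Finset.univ.erase r).card = n - 1 := by simp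
  have h := integral_log_forestSum_ge_of_doubling γ (m := 2 ^ i) i (r := 1) one_pos (by simp)
    (A := Finset.univ.erase r) (R := {r}) (by simp) (by simp) (by rw [hcard]; omega)
  simp only [freeEnergyError, partitionFunction_eq_forestSum γ _ r]
  rw [integral_sub (integrable_log_forestSum γ _ (by simp)) (integrable_const _)]
  simp only [integral_const, probReal_univ, one_smul]
  have hn' : (0 : ℝ) < n := by exact_mod_cast hn
  have hc : ((n - 1 : ℕ) : ℝ) = n - 1 := by rw [Nat.cast_sub hn]; simp
  rw [hcard, hc] at h
  have hfac := le_log_factorial (n - 1)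
  rw [hc] at hfac
  have hlog : ((n : ℝ) - 1) * Real.log n - 1 ≤ (n - 1) * Real.log (n - 1) := by
    rcases Nat.lt_or_ge 1 n with h2 | h2
    · have h2' : (1 : ℝ) < n := by exact_mod_cast h2
      have h3 := Real.log_le_sub_one_of_pos (x := (n : ℝ) / (n - 1))
        (div_pos hn' (by linarith))
      rw [Real.log_div hn'.ne' (by linarith)] at h3
      have h4 : ((n : ℝ) - 1) * (n / (n - 1) - 1) = 1 := by
        field_simp [show (n : ℝ) - 1 ≠ 0 by linarith]
        ring
      have := mul_le_mul_of_nonneg_left h3 (by linarith : (0 : ℝ) ≤ n - 1)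
      linarith
    · have : n = 1 := by omega
      subst this
      simp
  have hm : Real.log ((2 ^ i : ℕ) : ℝ) ≤ Real.log n :=
    Real.log_le_log (by positivity) (by exact_mod_cast (by omega : 2 ^ i ≤ n))
  have hm0 : 0 ≤ Real.log ((2 ^ i : ℕ) : ℝ) := Real.log_natCast_nonneg _
  have hdiv : (((n - 1) / 2 ^ i : ℕ) : ℝ) ≤ (n : ℝ) / 2 ^ i := by
    have := Nat.cast_div_le (α := ℝ) (m := n) (n := 2 ^ i)
    push_cast at this
    refine le_trans ?_ this
    exact_mod_cast Nat.div_le_div_right (Nat.sub_le _ _)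
  have hprod : (Real.log ((2 ^ i : ℕ) : ℝ) + 1 + |γ|) * ((((n - 1) / 2 ^ i : ℕ) : ℝ) + 1 + 2 * i) ≤
      (Real.log n + 1 + |γ|) * ((n : ℝ) / 2 ^ i + 1 + 2 * i) := by
    gcongr
  rw [Real.log_mul hn'.ne' (unifLaplace_pos γ).ne']
  push_cast at h hprod ⊢
  linarith

/-- The error is log y with y = Z/M and y of mean at most 1. Since log y ≤ y, one has |log y| ≤ 2y -
log y, so a lower bound on the mean of log y controls its L¹ norm without any concentration
estimate. -/
lemma integral_abs_freeEnergyError_le (γ : ℝ) {i : ℕ} (hi : 2 * 2 ^ i ≤ n + 1) :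
    ∫ ω, |freeEnergyError γ ω| ∂(envLaw n) ≤
      3 + 2 * 2 ^ i + (Real.log n + 1 + |γ|) * ((n : ℝ) / 2 ^ i + 1 + 2 * i) := by
  have h1 : 1 ≤ 2 ^ i := Nat.one_le_two_pow
  have hn : 0 < n := by omega
  have hn' : (0 : ℝ) < n := by exact_mod_cast hn
  set M : ℝ := ((n : ℝ) * unifLaplace γ) ^ (n - 1) with hM
  have hMpos : 0 < M := pow_pos (mul_pos hn' (unifLaplace_pos γ)) _
  have hint := integrable_freeEnergyError hn γ
  have hZ : Integrable (fun ω : Env n => partitionFunction γ ω) (envLaw n) :=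
    integrable_finsetSum _ fun T _ => integrable_treeWeight γ T
  have hpt : ∀ ω : Env n, |freeEnergyError γ ω| ≤
      2 * (partitionFunction γ ω / M) - freeEnergyError γ ω := by
    intro ω
    have hZpos := partitionFunction_pos hn γ ω
    have h2 : freeEnergyError γ ω ≤ partitionFunction γ ω / M := by
      have h3 := Real.log_le_sub_one_of_pos (div_pos hZpos hMpos)
      rw [Real.log_div hZpos.ne' hMpos.ne', hM, Real.log_pow, Nat.cast_sub hn, Nat.cast_one] at h3
      rw [freeEnergyError]
      linarith
    have h4 : 0 ≤ partitionFunction γ ω / M := by positivity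
    rw [abs_le]
    constructor <;> linarith
  have h5 := integral_mono hint.abs (((hZ.div_const M).const_mul 2).sub hint) hpt
  simp only [Pi.sub_apply] at h5
  rw [integral_sub ((hZ.div_const M).const_mul 2) hint, integral_const_mul, integral_div] at h5
  have h6 : (∫ ω, partitionFunction γ ω ∂(envLaw n)) / M ≤ 1 := by
    rw [div_le_one hMpos]
    exact integral_partitionFunction_le hn γ
  have h7 := integral_freeEnergyError_ge γ hi
  linarith

end Quenched

/-- Asymptotics of the free energy in mean. -/
lemma eventually_integral_abs_freeEnergyError_le {γ : ℕ → ℝ}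
    (hγ : γ =o[atTop] fun n : ℕ => (n : ℝ) / Real.log n) {ε : ℝ} (hε : 0 < ε) :
    ∀ᶠ n : ℕ in atTop, ∫ ω, |freeEnergyError (γ n) ω| ∂(envLaw n) ≤ ε * n := by
  -- The bound K > 4/ε makes the doubling loss 2 · 2^i ≤ 2n/K at most εn/2; K > 2 makes the
  -- generations fit.
  obtain ⟨K, hK⟩ := exists_nat_gt (max 2 (4 / ε))
  have hK2 : (2 : ℝ) < K := (le_max_left _ _).trans_lt hK
  have hKε : 2 / (K : ℝ) ≤ ε / 2 := by
    have h1 : 4 / ε < K := (le_max_right _ _).trans_lt hK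
    rw [div_lt_iff₀ hε] at h1
    rw [div_le_iff₀ (by linarith)]
    linarith
  -- With log² n, |γ| log n and the constant 3 each at most δn, the remaining error is at most Cδn,
  -- which equals εn/2. The bound on |γ| log n is where γ = o(n / log n) enters: about log n
  -- generations each cost a multiple of |γ|.
  set C : ℝ := 1 + 3 * (2 * K + 5) with hC
  have hCpos : 0 < C := by positivity
  set δ : ℝ := ε / (2 * C) with hδ
  have hδpos : 0 < δ := by positivity
  have hcast : Tendsto (fun n : ℕ => (n : ℝ)) atTop atTop := tendsto_natCast_atTop_atTop
  have hlogt : Tendsto (fun n : ℕ => Real.log n) atTop atTop := Real.tendsto_log_atTop.comp hcast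
  have hl2 : ∀ᶠ n : ℕ in atTop, Real.log n ^ 2 ≤ δ * n := by
    have h := ((Real.isLittleO_pow_log_id_atTop (n := 2)).comp_tendsto hcast).bound hδpos
    filter_upwards [h] with n hn
    simpa using hn
  filter_upwards [hl2, hγ.bound hδpos, hlogt.eventually_ge_atTop 1,
    hcast.eventually_ge_atTop (3 / δ), eventually_ge_atTop K] with n h1 h2 h3 h4 h5
  have hKpos : 0 < K := by
    by_contra h
    have : K = 0 := by omega
    rw [this] at hK2
    norm_num at hK2
  have hn : 0 < n := by omega
  have hn' : (0 : ℝ) < n := by exact_mod_cast hn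
  -- The constant generations have size between n/(2K) and n/K, so about 2K of them suffice.
  set i := Nat.log 2 (n / K) with hi
  have hq : n / K ≠ 0 := (Nat.div_pos h5 hKpos).ne'
  have hlow : 2 ^ i ≤ n / K := Nat.pow_log_le_self 2 hq
  have hup : n / K < 2 ^ (i + 1) := Nat.lt_pow_succ_log_self one_lt_two _
  have hlow' : (2 : ℝ) ^ i ≤ n / K := by
    calc (2 : ℝ) ^ i = ((2 ^ i : ℕ) : ℝ) := by push_cast; ring
      _ ≤ ((n / K : ℕ) : ℝ) := by exact_mod_cast hlow
      _ ≤ n / K := Nat.cast_div_le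
  have hup' : (n : ℝ) / 2 ^ i ≤ 2 * K := by
    rw [div_le_iff₀ (by positivity)]
    have h6 : n < K * 2 ^ (i + 1) := by
      rw [mul_comm]
      exact (Nat.div_lt_iff_lt_mul hKpos).1 hup
    have h7 : (n : ℝ) ≤ K * 2 ^ (i + 1) := by exact_mod_cast h6.le
    rw [pow_succ] at h7
    linarith
  have hi2 : 2 * 2 ^ i ≤ n + 1 := by
    have h6 : 2 ≤ K := by exact_mod_cast hK2.le
    have h7 : n / K * K ≤ n := Nat.div_mul_le_self n K
    nlinarith
  have hilog : (i : ℝ) ≤ 2 * Real.log n := by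
    have h6 : (2 : ℝ) ^ i ≤ n := hlow'.trans (div_le_self hn'.le (by linarith))
    have h7 := Real.log_le_log (by positivity) h6
    rw [Real.log_pow] at h7
    have h8 : (1 : ℝ) / 2 < Real.log 2 := lt_trans (by norm_num) Real.log_two_gt_d9
    have h9 : (0 : ℝ) ≤ i := Nat.cast_nonneg _
    nlinarith
  have h := integral_abs_freeEnergyError_le (γ n) hi2
  have hγn : |γ n| * Real.log n ≤ δ * n := by
    rw [Real.norm_eq_abs, Real.norm_eq_abs,
      abs_of_nonneg (div_nonneg hn'.le (by linarith))] at h2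
    calc |γ n| * Real.log n ≤ δ * (n / Real.log n) * Real.log n := by gcongr
      _ = δ * n := by field_simp
  have h6 : (n : ℝ) / 2 ^ i + 1 + 2 * i ≤ (2 * K + 5) * Real.log n := by nlinarith
  have h7 : (Real.log n + 1 + |γ n|) * ((n : ℝ) / 2 ^ i + 1 + 2 * i) ≤
      (2 * Real.log n + |γ n|) * ((2 * K + 5) * Real.log n) := by
    have := abs_nonneg (γ n)
    have : 0 ≤ (n : ℝ) / 2 ^ i + 1 + 2 * i := by positivity
    gcongr
    linarith
  have h8 : (2 * Real.log n + |γ n|) * ((2 * K + 5) * Real.log n) ≤ 3 * (2 * K + 5) * (δ * n) := by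
    have : (2 * Real.log n + |γ n|) * ((2 * K + 5) * Real.log n) =
      (2 * K + 5) * (2 * Real.log n ^ 2 + |γ n| * Real.log n) := by ring
    rw [this]
    have : (0 : ℝ) ≤ 2 * K + 5 := by positivity
    nlinarith
  have h9 : 3 ≤ δ * n := by
    rw [div_le_iff₀ hδpos] at h4
    linarith
  have h10 : 2 * (2 : ℝ) ^ i ≤ ε / 2 * n := by
    calc 2 * (2 : ℝ) ^ i ≤ 2 * (n / K) := by gcongr
      _ = 2 / K * n := by ring
      _ ≤ ε / 2 * n := by gcongr
  have h11 : C * δ = ε / 2 := by rw [hδ]; field_simp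
  have h12 : δ * n + 3 * (2 * K + 5) * (δ * n) = ε / 2 * n := by
    rw [← h11, hC]; ring
  linarith

/-- Convergence in mean implies the asymptotics with high probability and in expectation. -/
lemma asymp_of_integral_abs_sub {X : ∀ n : ℕ, Env n → ℝ} {a : ℕ → ℝ}
    (hX : ∀ n, Integrable (X n) (envLaw n)) (ha : ∀ᶠ n in atTop, 0 < a n)
    (h : ∀ ε : ℝ, 0 < ε → ∀ᶠ n in atTop, ∫ ω, |X n ω - a n| ∂(envLaw n) ≤ ε * a n) :
    AsympWHP X a ∧ AsympExp X a := by
  have hint : ∀ n, Integrable (fun ω => X n ω - a n) (envLaw n) := fun n =>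
    (hX n).sub (integrable_const _)
  refine ⟨fun ε hε => ?_, hX, ?_⟩
  · rw [← ENNReal.tendsto_toReal_iff (fun n => measure_ne_top _ _) ENNReal.one_ne_top,
      ENNReal.toReal_one, Metric.tendsto_atTop']
    intro δ hδ
    obtain ⟨N, hN⟩ := eventually_atTop.1 (ha.and (h (ε * (δ / 2)) (by positivity)))
    refine ⟨N, fun n hn => ?_⟩
    obtain ⟨hpos, hle⟩ := hN n hn.le
    set S : Set (Env n) := {ω | |X n ω - a n| ≤ ε * a n} with hS
    have hmarkov := mul_meas_ge_le_integral_of_nonneg (μ := envLaw n)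
      (f := fun ω => |X n ω - a n|) (ae_of_all _ fun ω => abs_nonneg _) (hint n).abs (ε * a n)
    have h1 : 1 ≤ (envLaw n).real S + (envLaw n).real {ω | ε * a n ≤ |X n ω - a n|} := by
      have huniv : (Set.univ : Set (Env n)) ⊆ S ∪ {ω | ε * a n ≤ |X n ω - a n|} := by
        intro ω _
        exact le_total (|X n ω - a n|) (ε * a n)
      calc (1 : ℝ) = (envLaw n).real Set.univ := probReal_univ.symm
        _ ≤ _ := measureReal_mono huniv
        _ ≤ _ := measureReal_union_le _ _
    have h2 : (envLaw n).real S ≤ 1 := measureReal_le_one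
    have h3 : (envLaw n).real {ω | ε * a n ≤ |X n ω - a n|} ≤ δ / 2 := by
      have hp : 0 < ε * a n := by positivity
      have h4 : ε * a n * (envLaw n).real {ω | ε * a n ≤ |X n ω - a n|} ≤ ε * a n * (δ / 2) := by
        refine hmarkov.trans (hle.trans (le_of_eq ?_))
        ring
      exact le_of_mul_le_mul_left h4 hp
    rw [Real.dist_eq, abs_lt]
    change -δ < (envLaw n).real S - 1 ∧ (envLaw n).real S - 1 < δ
    constructor <;> linarith
  · rw [IsEquivalent, isLittleO_iff]
    intro ε hε
    filter_upwards [ha, h ε hε] with n hpos hle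
    rw [Pi.sub_apply, Real.norm_eq_abs, Real.norm_eq_abs, abs_of_pos hpos]
    have h1 : ∫ ω, X n ω ∂(envLaw n) - a n = ∫ ω, (X n ω - a n) ∂(envLaw n) := by
      rw [integral_sub (hX n) (integrable_const _)]
      simp
    rw [h1]
    exact abs_integral_le_integral_abs.trans hle

/-! ### The mean of the exponentially tilted uniform law. -/

section TiltedMean

/-- The mean of the law on `[0, 1]` with density proportional to `exp (-γ x)`. -/
def tiltedMean (γ : ℝ) : ℝ := (∫ x in (0 : ℝ)..1, x * Real.exp (-γ * x)) / unifLaplace γ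

lemma intervalIntegrable_mul_exp (γ : ℝ) (a b : ℝ) :
    IntervalIntegrable (fun x => x * Real.exp (-γ * x)) volume a b :=
  (by fun_prop : Continuous fun x => x * Real.exp (-γ * x)).intervalIntegrable _ _

lemma intervalIntegrable_exp_mul (γ : ℝ) (a b : ℝ) :
    IntervalIntegrable (fun x => Real.exp (-γ * x)) volume a b :=
  (by fun_prop : Continuous fun x => Real.exp (-γ * x)).intervalIntegrable _ _

lemma integral_mul_exp_nonneg (γ : ℝ) : 0 ≤ ∫ x in (0 : ℝ)..1, x * Real.exp (-γ * x) :=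
  intervalIntegral.integral_nonneg zero_le_one fun _ hx => mul_nonneg hx.1 (Real.exp_pos _).le

lemma tiltedMean_nonneg (γ : ℝ) : 0 ≤ tiltedMean γ :=
  div_nonneg (integral_mul_exp_nonneg γ) (unifLaplace_pos γ).le

/-- Convexity of the logarithm of the Laplace transform. -/
lemma log_unifLaplace_sub_ge (γ γ' : ℝ) :
    -(γ - γ') * tiltedMean γ' ≤ Real.log (unifLaplace γ) - Real.log (unifLaplace γ') := by
  set ψ := tiltedMean γ' with hψ
  set d := γ - γ' with hd
  have hpos := unifLaplace_pos γ'
  -- The bound exp(-d(x - ψ)) ≥ 1 - d(x - ψ) is integrated against the weight exp(-γ' x); the linear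
  -- term vanishes because ψ is the tilted mean.
  have h1 : ∫ x in (0 : ℝ)..1, Real.exp (-d * ψ) * ((1 + d * ψ) * Real.exp (-γ' * x) -
      d * (x * Real.exp (-γ' * x))) ≤ unifLaplace γ := by
    refine intervalIntegral.integral_mono_on zero_le_one ?_ (intervalIntegrable_exp_mul _ _ _) ?_
    · exact (((intervalIntegrable_exp_mul _ _ _).const_mul _).sub
        ((intervalIntegrable_mul_exp _ _ _).const_mul _)).const_mul _
    · intro x _
      have h2 := Real.add_one_le_exp (-d * (x - ψ))
      have h3 : Real.exp (-γ * x) = Real.exp (-d * ψ) * Real.exp (-γ' * x) *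
          Real.exp (-d * (x - ψ)) := by
        rw [← Real.exp_add, ← Real.exp_add]
        congr 1
        rw [hd]; ring
      rw [h3]
      have h4 : Real.exp (-d * ψ) * ((1 + d * ψ) * Real.exp (-γ' * x) -
          d * (x * Real.exp (-γ' * x))) = Real.exp (-d * ψ) * Real.exp (-γ' * x) *
          (-d * (x - ψ) + 1) := by ring
      rw [h4]
      gcongr
  rw [intervalIntegral.integral_const_mul, intervalIntegral.integral_sub
    ((intervalIntegrable_exp_mul _ _ _).const_mul _)
    ((intervalIntegrable_mul_exp _ _ _).const_mul _), intervalIntegral.integral_const_mul,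
    intervalIntegral.integral_const_mul] at h1
  have h5 : ∫ x in (0 : ℝ)..1, x * Real.exp (-γ' * x) = ψ * unifLaplace γ' := by
    rw [hψ, tiltedMean, div_mul_cancel₀ _ hpos.ne']
  have h6 : Real.exp (-d * ψ) * unifLaplace γ' ≤ unifLaplace γ := by
    refine le_trans (le_of_eq ?_) h1
    rw [h5, unifLaplace]
    ring
  have h7 := Real.log_le_log (by positivity) h6
  rw [Real.log_mul (Real.exp_pos _).ne' hpos.ne', Real.log_exp] at h7
  linarith

/-- On [0, 1] lowering the parameter by δ multiplies the weight by a factor between 1 and exp δ. -/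
lemma tiltedMean_sub_le (γ : ℝ) {δ : ℝ} (hδ : 0 ≤ δ) :
    tiltedMean (γ - δ) ≤ Real.exp δ * tiltedMean γ := by
  rw [tiltedMean, tiltedMean, ← mul_div_assoc]
  have hle : ∀ x ∈ Set.Icc (0 : ℝ) 1, Real.exp (-γ * x) ≤ Real.exp (-(γ - δ) * x) := fun x hx =>
    Real.exp_le_exp.2 (by nlinarith [hx.1])
  refine div_le_div₀ (mul_nonneg (Real.exp_pos _).le (integral_mul_exp_nonneg γ)) ?_
    (unifLaplace_pos γ) (intervalIntegral.integral_mono_on zero_le_one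
      (intervalIntegrable_exp_mul _ _ _) (intervalIntegrable_exp_mul _ _ _) hle)
  rw [← intervalIntegral.integral_const_mul]
  refine intervalIntegral.integral_mono_on zero_le_one (intervalIntegrable_mul_exp _ _ _)
    ((intervalIntegrable_mul_exp _ _ _).const_mul _) fun x hx => ?_
  have h1 : Real.exp (-(γ - δ) * x) ≤ Real.exp δ * Real.exp (-γ * x) := by
    rw [← Real.exp_add]
    exact Real.exp_le_exp.2 (by nlinarith [hx.1, hx.2])
  have := mul_le_mul_of_nonneg_left h1 hx.1
  linarith

lemma tiltedMean_zero : tiltedMean 0 = 1 / 2 := by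
  simp [tiltedMean, unifLaplace]

/-- Both integrals have explicit primitives; n times this is the announced high-temperature value.
-/
lemma tiltedMean_eq {β : ℝ} (hβ : 0 < β) :
    tiltedMean β = 1 / β * ((1 - β * Real.exp (-β) - Real.exp (-β)) / (1 - Real.exp (-β))) := by
  have hexp : ∀ x : ℝ, HasDerivAt (fun x => Real.exp (-β * x)) (Real.exp (-β * x) * -β) x :=
    fun x => by simpa using ((hasDerivAt_id x).const_mul (-β)).exp
  have h1 : unifLaplace β = (1 - Real.exp (-β)) / β := by
    have h := intervalIntegral.integral_eq_sub_of_hasDerivAt (a := 0) (b := 1)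
      (f := fun x => -(Real.exp (-β * x) / β)) (f' := fun x => Real.exp (-β * x)) (fun x _ =>
        ((hexp x).div_const β).neg.congr_deriv (by field_simp)) (intervalIntegrable_exp_mul _ _ _)
    rw [unifLaplace, h]
    simp
    ring
  have h2 : ∫ x in (0 : ℝ)..1, x * Real.exp (-β * x) =
      (1 - β * Real.exp (-β) - Real.exp (-β)) / β ^ 2 := by
    have h := intervalIntegral.integral_eq_sub_of_hasDerivAt (a := 0) (b := 1)
      (f := fun x => -((β * x + 1) * Real.exp (-β * x) / β ^ 2))
      (f' := fun x => x * Real.exp (-β * x)) (fun x _ => by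
        have h3 : HasDerivAt (fun x => β * x + 1) β x := by
          simpa using ((hasDerivAt_id x).const_mul β).add_const 1
        exact ((h3.mul (hexp x)).div_const (β ^ 2)).neg.congr_deriv (by field_simp; ring)) (intervalIntegrable_mul_exp _ _ _)
    rw [h]
    simp
    field_simp
    ring
  have h3 : 1 - Real.exp (-β) ≠ 0 := by
    have : Real.exp (-β) < 1 := Real.exp_lt_one_iff.2 (by linarith)
    linarith
  rw [tiltedMean, h1, h2]
  field_simp

lemma mul_tiltedMean_eq {β : ℝ} (hβ : 0 < β) :
    β * tiltedMean β = 1 - β / (Real.exp β - 1) := by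
  have h3 : Real.exp β - 1 ≠ 0 := by
    have := Real.add_one_lt_exp hβ.ne'
    linarith
  have h4 : 1 - Real.exp (-β) = Real.exp (-β) * (Real.exp β - 1) := by
    rw [mul_sub, ← Real.exp_add]
    simp
  have h6 : Real.exp (-β) * Real.exp β = 1 := by rw [← Real.exp_add]; simp
  rw [tiltedMean_eq hβ, h4]
  have h5 := Real.exp_pos (-β)
  field_simp
  linear_combination -h6

/-- Equivalent to β/(exp β - 1) being decreasing, which follows from the convexity of exp. It
controls relative changes of large β, where the additive estimate is too weak. -/
lemma mul_tiltedMean_mono {a b : ℝ} (ha : 0 < a) (hab : a ≤ b) :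
    a * tiltedMean a ≤ b * tiltedMean b := by
  have hb : 0 < b := ha.trans_le hab
  rw [mul_tiltedMean_eq ha, mul_tiltedMean_eq hb]
  have h1 := Real.add_one_lt_exp ha.ne'
  have h2 := Real.add_one_lt_exp hb.ne'
  have hconv := convexOn_exp.2 (Set.mem_univ b) (Set.mem_univ 0)
    (by positivity : 0 ≤ a / b) (by rw [sub_nonneg, div_le_one hb]; exact hab : 0 ≤ 1 - a / b)
    (by ring)
  simp only [smul_eq_mul, mul_zero, add_zero, Real.exp_zero, mul_one] at hconv
  rw [div_mul_cancel₀ _ hb.ne'] at hconv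
  gcongr 1 - ?_
  rw [div_le_div_iff₀ (by linarith) (by linarith)]
  have h3 : b * Real.exp a ≤ a * Real.exp b + (b - a) := by
    have := mul_le_mul_of_nonneg_left hconv hb.le
    field_simp at this
    linarith
  linarith

/-- The scale on which the tilted mean varies. -/
lemma one_sixth_le_max_mul_tiltedMean {β : ℝ} (hβ : 0 < β) : 1 / 6 ≤ max 1 β * tiltedMean β := by
  -- The value 1/2 at zero can drop by a factor at most exp 1 ≤ 3 on [0, 1].
  have h1 : ∀ b : ℝ, 0 ≤ b → b ≤ 1 → 1 / 6 ≤ tiltedMean b := by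
    intro b hb hb1
    have h := tiltedMean_sub_le b hb
    rw [sub_self, tiltedMean_zero] at h
    have h2 : Real.exp b ≤ 3 :=
      (Real.exp_le_exp.2 hb1).trans (Real.exp_one_lt_d9.le.trans (by norm_num))
    nlinarith [tiltedMean_nonneg b]
  rcases le_total β 1 with h | h
  · rw [max_eq_left h, one_mul]
    exact h1 β hβ.le h
  · rw [max_eq_right h]
    have := mul_tiltedMean_mono one_pos h
    rw [one_mul] at this
    exact (h1 1 zero_le_one le_rfl).trans this

/-- For β ≤ 1 the shift is η and changes the mean by a factor at most exp η. For β ≥ 1 it is ηβ, and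
monotonicity of β times the mean gives a factor at most 1/(1 - η). -/
lemma tiltedMean_sub_le_of_scale {β η : ℝ} (hβ : 0 < β) (hη : 0 < η) (hη' : η ≤ 1 / 2) :
    tiltedMean (β - η * max 1 β) ≤ (1 + 2 * η) * tiltedMean β := by
  have hψ := tiltedMean_nonneg β
  rcases le_total β 1 with h | h
  · rw [max_eq_left h, mul_one]
    refine (tiltedMean_sub_le β hη.le).trans ?_
    gcongr
    have := Real.abs_exp_sub_one_le (x := η) (by rw [abs_of_pos hη]; linarith)
    rw [abs_of_pos hη] at this
    linarith [le_abs_self (Real.exp η - 1)]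
  · rw [max_eq_right h]
    have h1 : 0 < β - η * β := by nlinarith
    have h2 := mul_tiltedMean_mono h1 (by nlinarith : β - η * β ≤ β)
    have h3 : (1 - η) * tiltedMean (β - η * β) ≤ tiltedMean β := by
      have : β * ((1 - η) * tiltedMean (β - η * β)) ≤ β * tiltedMean β := by linarith
      exact le_of_mul_le_mul_left this hβ
    have h4 := tiltedMean_nonneg (β - η * β)
    have h5 : (1 + 2 * η) * ((1 - η) * tiltedMean (β - η * β)) ≤ (1 + 2 * η) * tiltedMean β := by
      gcongr
    have h6 : 1 ≤ (1 + 2 * η) * (1 - η) := by nlinarith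
    nlinarith

lemma tiltedMean_add_ge_of_scale {β η : ℝ} (hβ : 0 < β) (hη : 0 < η) :
    (1 - η) * tiltedMean β ≤ tiltedMean (β + η * max 1 β) := by
  have hψ := tiltedMean_nonneg β
  rcases le_total β 1 with h | h
  · rw [max_eq_left h, mul_one]
    have h1 := tiltedMean_sub_le (β + η) hη.le
    rw [add_sub_cancel_right] at h1
    have h2 : Real.exp (-η) * tiltedMean β ≤ tiltedMean (β + η) := by
      rw [Real.exp_neg, inv_mul_le_iff₀ (Real.exp_pos _)]
      exact h1
    refine le_trans ?_ h2
    gcongr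
    linarith [Real.add_one_le_exp (-η)]
  · rw [max_eq_right h]
    have h2 := mul_tiltedMean_mono hβ (by nlinarith : β ≤ β + η * β)
    have h3 : tiltedMean β ≤ (1 + η) * tiltedMean (β + η * β) := by
      have : β * tiltedMean β ≤ β * ((1 + η) * tiltedMean (β + η * β)) := by linarith
      exact le_of_mul_le_mul_left this hβ
    have h4 := tiltedMean_nonneg (β + η * β)
    rcases le_total 1 η with h5 | h5
    · nlinarith
    · have h6 := mul_le_mul_of_nonneg_left h3 (by linarith : 0 ≤ 1 - η)
      nlinarith [mul_nonneg (mul_nonneg hη.le hη.le) h4]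

end TiltedMean

/-! ### The high-temperature asymptotics. -/

section HighTemperature

variable {n : ℕ}

/-- Convexity bounds the derivative of log Z by a difference quotient over [β - δ, β]; replacing log
Z by its annealed form leaves a difference of log φ, which the slope of log φ at β - δ bounds. The
two replacement errors are divided by δ. -/
lemma quenchedLength_le (hn : 0 < n) (β : ℝ) {δ : ℝ} (hδ : 0 < δ) (ω : Env n) :
    quenchedLength β ω ≤ ((n : ℝ) - 1) * tiltedMean (β - δ) +
      (|freeEnergyError (β - δ) ω| + |freeEnergyError β ω|) / δ := by
  have hn' : (1 : ℝ) ≤ n := by exact_mod_cast hn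
  have h1 := log_partitionFunction_sub_ge hn (β - δ) β ω
  have h2 := log_unifLaplace_sub_ge β (β - δ)
  have h3 := mul_le_mul_of_nonneg_left h2 (by linarith : (0 : ℝ) ≤ n - 1)
  rw [← sub_le_iff_le_add', le_div_iff₀ hδ]
  have h4 := le_abs_self (freeEnergyError (β - δ) ω)
  have h5 := neg_abs_le (freeEnergyError β ω)
  have hlog : ∀ g, Real.log (n * unifLaplace g) = Real.log n + Real.log (unifLaplace g) :=
    fun g => Real.log_mul (by positivity) (unifLaplace_pos g).ne'
  simp only [freeEnergyError, hlog] at h4 h5 ⊢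
  linarith

lemma le_quenchedLength (hn : 0 < n) (β : ℝ) {δ : ℝ} (hδ : 0 < δ) (ω : Env n) :
    ((n : ℝ) - 1) * tiltedMean (β + δ) -
      (|freeEnergyError (β + δ) ω| + |freeEnergyError β ω|) / δ ≤ quenchedLength β ω := by
  have hn' : (1 : ℝ) ≤ n := by exact_mod_cast hn
  have h1 := log_partitionFunction_sub_ge hn (β + δ) β ω
  have h2 := log_unifLaplace_sub_ge β (β + δ)
  have h3 := mul_le_mul_of_nonneg_left h2 (by linarith : (0 : ℝ) ≤ n - 1)
  rw [sub_le_comm, le_div_iff₀ hδ]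
  have h4 := le_abs_self (freeEnergyError (β + δ) ω)
  have h5 := neg_abs_le (freeEnergyError β ω)
  have hlog : ∀ g, Real.log (n * unifLaplace g) = Real.log n + Real.log (unifLaplace g) :=
    fun g => Real.log_mul (by positivity) (unifLaplace_pos g).ne'
  simp only [freeEnergyError, hlog] at h4 h5 ⊢
  linarith

end HighTemperature

lemma eventually_integral_abs_quenchedLength_sub_le {β : ℕ → ℝ} (hpos : ∀ n, 0 < β n)
    (hβ : β =o[atTop] fun n : ℕ => (n : ℝ) / Real.log n) {ε : ℝ} (hε : 0 < ε) :
    ∀ᶠ n : ℕ in atTop, ∫ ω, |quenchedLength (β n) ω - n * tiltedMean (β n)| ∂(envLaw n) ≤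
      ε * (n * tiltedMean (β n)) := by
  -- The relative errors add up to 4η; the cap 1/2 is required by the stability estimate for
  -- decreasing β.
  set η : ℝ := min (1 / 2) (ε / 8) with hη
  have hηpos : 0 < η := by positivity
  have hη2 : η ≤ 1 / 2 := min_le_left _ _
  have hηε : η ≤ ε / 8 := min_le_right _ _
  have hcast : Tendsto (fun n : ℕ => (n : ℝ)) atTop atTop := tendsto_natCast_atTop_atTop
  have hone : (fun _ : ℕ => (1 : ℝ)) =o[atTop] fun n : ℕ => (n : ℝ) / Real.log n := by
    have h1 : (fun n : ℕ => (Real.log n)) =o[atTop] fun n : ℕ => (n : ℝ) :=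
      Real.isLittleO_log_id_atTop.comp_tendsto hcast
    rw [isLittleO_iff] at h1 ⊢
    intro c hc
    filter_upwards [h1 hc, (Real.tendsto_log_atTop.comp hcast).eventually_ge_atTop 1] with n h2 h3
    simp only [Function.comp_apply] at h3
    rw [Real.norm_eq_abs, abs_of_pos (by linarith)] at h2
    rw [norm_div, norm_one, Real.norm_eq_abs (Real.log n), abs_of_pos (by linarith),
      ← mul_div_assoc, le_div_iff₀ (by linarith), one_mul]
    exact h2
  have hmax : (fun n => η * max 1 (β n)) =o[atTop] fun n : ℕ => (n : ℝ) / Real.log n := by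
    refine IsLittleO.const_mul_left ?_ η
    refine IsBigO.trans_isLittleO (g := fun n => (1 : ℝ) + β n) ?_ (hone.add hβ)
    refine IsBigO.of_bound 1 (Eventually.of_forall fun n => ?_)
    have := hpos n
    rw [Real.norm_eq_abs, Real.norm_eq_abs, abs_of_pos (by positivity), abs_of_pos (by positivity),
      one_mul]
    exact max_le (by linarith) (by linarith)
  -- The free energy errors carry weights 1, 2, 1, so their sum is at most 4ε'n. As max(1, β) times
  -- the tilted mean is at least 1/6, the value η²/24 makes this sum divided by δ at most ηnψ.
  set ε' : ℝ := η ^ 2 / 24 with hε'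
  have hε'pos : 0 < ε' := by positivity
  filter_upwards [eventually_integral_abs_freeEnergyError_le hβ hε'pos,
    eventually_integral_abs_freeEnergyError_le (hβ.sub hmax) hε'pos,
    eventually_integral_abs_freeEnergyError_le (hβ.add hmax) hε'pos,
    eventually_gt_atTop 0, hcast.eventually_ge_atTop (1 / η)] with n h0 hm hp hn hn1
  set b := β n with hb
  have hbpos : 0 < b := hpos n
  set δ := η * max 1 b with hδ
  have hδpos : 0 < δ := by positivity
  have hn' : (1 : ℝ) ≤ n := by exact_mod_cast hn
  set ψ := tiltedMean b with hψ
  have hψ0 : 0 ≤ ψ := tiltedMean_nonneg b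
  -- Of the 3η, at most 2η comes from shifting the parameter of the tilted mean and η from replacing
  -- n - 1 by n.
  have hpt : ∀ ω : Env n, |quenchedLength b ω - n * ψ| ≤ 3 * η * (n * ψ) +
      (|freeEnergyError (b - δ) ω| + 2 * |freeEnergyError b ω| + |freeEnergyError (b + δ) ω|) / δ := by
    intro ω
    have h1 := quenchedLength_le hn b hδpos ω
    have h2 := le_quenchedLength hn b hδpos ω
    have h3 : ((n : ℝ) - 1) * tiltedMean (b - δ) ≤ (n - 1) * ((1 + 2 * η) * ψ) :=
      mul_le_mul_of_nonneg_left (tiltedMean_sub_le_of_scale hbpos hηpos hη2) (by linarith)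
    have h4 : ((n : ℝ) - 1) * ((1 - η) * ψ) ≤ (n - 1) * tiltedMean (b + δ) :=
      mul_le_mul_of_nonneg_left (tiltedMean_add_ge_of_scale hbpos hηpos) (by linarith)
    have h5 : 1 ≤ η * n := by
      rw [div_le_iff₀ hηpos] at hn1
      linarith
    have h6 : ψ ≤ η * n * ψ := by nlinarith
    have h7 : 0 ≤ η * ψ := by positivity
    have e1 : (|freeEnergyError (b - δ) ω| + 2 * |freeEnergyError b ω| +
        |freeEnergyError (b + δ) ω|) / δ = (|freeEnergyError (b - δ) ω| +
        |freeEnergyError b ω|) / δ + (|freeEnergyError (b + δ) ω| + |freeEnergyError b ω|) / δ := by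
      ring
    have e2 : 0 ≤ (|freeEnergyError (b - δ) ω| + |freeEnergyError b ω|) / δ := by positivity
    have e3 : 0 ≤ (|freeEnergyError (b + δ) ω| + |freeEnergyError b ω|) / δ := by positivity
    rw [e1, abs_le]
    constructor <;> linarith
  have hi0 := (integrable_freeEnergyError hn b).abs
  have him := (integrable_freeEnergyError hn (b - δ)).abs
  have hip := (integrable_freeEnergyError hn (b + δ)).abs
  have hi2 : Integrable (fun ω => |freeEnergyError (b - δ) ω| + 2 * |freeEnergyError b ω|)
    (envLaw n) := him.add (hi0.const_mul 2)
  have hi1 : Integrable (fun ω => |freeEnergyError (b - δ) ω| + 2 * |freeEnergyError b ω| +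
    |freeEnergyError (b + δ) ω|) (envLaw n) := hi2.add hip
  have hI := integral_mono (((integrable_quenchedLength b).sub (integrable_const (n * ψ))).abs)
    ((integrable_const (3 * η * (n * ψ))).add (hi1.div_const δ)) hpt
  refine hI.trans ?_
  simp only [Pi.add_apply]
  rw [integral_add (integrable_const _) (hi1.div_const δ), integral_div, integral_add hi2 hip,
    integral_add him (hi0.const_mul 2), integral_const_mul 2]
  simp only [integral_const, probReal_univ, one_smul]
  have h8 : (∫ ω, |freeEnergyError (b - δ) ω| ∂(envLaw n) +
      2 * ∫ ω, |freeEnergyError b ω| ∂(envLaw n) +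
      ∫ ω, |freeEnergyError (b + δ) ω| ∂(envLaw n)) / δ ≤ η * (n * ψ) := by
    rw [div_le_iff₀ hδpos]
    have h9 := one_sixth_le_max_mul_tiltedMean hbpos
    have h10 : 4 * (ε' * n) ≤ η * (n * ψ) * δ := by
      have : η * (n * ψ) * δ = η ^ 2 * n * (max 1 b * ψ) := by rw [hδ]; ring
      rw [this, hε']
      have : η ^ 2 * n * (1 / 6) ≤ η ^ 2 * n * (max 1 b * ψ) := by gcongr
      linarith
    linarith
  have h11 : 0 ≤ (n : ℝ) * ψ := by positivity
  have h12 : 4 * η * (n * ψ) ≤ ε * (n * ψ) := by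
    gcongr
    linarith
  linarith

lemma asymp_high_temperature {β : ℕ → ℝ} (hpos : ∀ n, 0 < β n)
    (hβ : β =o[atTop] fun n : ℕ => (n : ℝ) / Real.log n) :
    AsympWHP (fun n ω => quenchedLength (β n) ω)
      (fun n => (n : ℝ) / β n *
        ((1 - β n * Real.exp (-β n) - Real.exp (-β n)) / (1 - Real.exp (-β n)))) ∧
    AsympExp (fun n ω => quenchedLength (β n) ω)
      (fun n => (n : ℝ) / β n *
        ((1 - β n * Real.exp (-β n) - Real.exp (-β n)) / (1 - Real.exp (-β n)))) := by
  have heq : (fun n : ℕ => (n : ℝ) / β n *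
      ((1 - β n * Real.exp (-β n) - Real.exp (-β n)) / (1 - Real.exp (-β n)))) =
      fun n => n * tiltedMean (β n) := by
    funext n
    rw [tiltedMean_eq (hpos n)]
    ring
  rw [heq]
  refine asymp_of_integral_abs_sub (fun n => integrable_quenchedLength _) ?_
    fun ε hε => eventually_integral_abs_quenchedLength_sub_le hpos hβ hε
  filter_upwards [eventually_gt_atTop 0] with n hn
  have h1 := one_sixth_le_max_mul_tiltedMean (hpos n)
  have h2 : 0 < max 1 (β n) := by positivity
  have h3 : 0 < tiltedMean (β n) := by
    by_contra h
    nlinarith [not_lt.1 h]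
  have : (0 : ℝ) < n := by exact_mod_cast hn
  positivity

/-! ### Counting components, and Kruskal's forest. -/

section ComponentCount

variable {V : Type*}

/-- The number of connected components of a graph. -/
def numComponents (G : SimpleGraph V) : ℕ := Nat.card G.ConnectedComponent

lemma numComponents_eq_of_reachable_eq {G H : SimpleGraph V} (h : G.Reachable = H.Reachable) :
    numComponents G = numComponents H := by
  unfold numComponents SimpleGraph.ConnectedComponent
  rw [h]

lemma numComponents_le_of_le [Finite V] {G H : SimpleGraph V} (h : G ≤ H) :
    numComponents H ≤ numComponents G :=
  SimpleGraph.ConnectedComponent.card_le_card_of_le h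

lemma numComponents_bot [Finite V] : numComponents (⊥ : SimpleGraph V) = Nat.card V := by
  refine (Nat.card_eq_of_bijective (SimpleGraph.connectedComponentMk (⊥ : SimpleGraph V))
    ⟨fun u v h => ?_, Quot.mk_surjective⟩).symm
  simpa using SimpleGraph.ConnectedComponent.exact h

lemma numComponents_of_connected {G : SimpleGraph V} (h : G.Connected) : numComponents G = 1 := by
  have := h.preconnected.subsingleton_connectedComponent
  have := h.nonempty
  rw [numComponents, Nat.card_eq_one_iff_unique]
  exact ⟨inferInstance, inferInstance⟩

lemma reachable_or_of_reachable_sup_edge {G : SimpleGraph V} {u v x y : V}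
    (h : (G ⊔ SimpleGraph.fromEdgeSet {s(u, v)}).Reachable x y) :
    G.Reachable x y ∨ (G.Reachable x u ∧ G.Reachable v y) ∨
      (G.Reachable x v ∧ G.Reachable u y) := by
  obtain ⟨p⟩ := h
  induction p with
  | nil => exact Or.inl (SimpleGraph.Reachable.refl _)
  | @cons a b c hab q ih =>
    rcases hab with hab | hab
    · rcases ih with h1 | ⟨h1, h2⟩ | ⟨h1, h2⟩
      · exact Or.inl (hab.reachable.trans h1)
      · exact Or.inr (Or.inl ⟨hab.reachable.trans h1, h2⟩)
      · exact Or.inr (Or.inr ⟨hab.reachable.trans h1, h2⟩)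
    · rw [SimpleGraph.fromEdgeSet_adj, Set.mem_singleton_iff, Sym2.eq_iff] at hab
      rcases hab.1 with ⟨rfl, rfl⟩ | ⟨rfl, rfl⟩
      · rcases ih with h1 | ⟨h1, h2⟩ | ⟨h1, h2⟩
        · exact Or.inr (Or.inl ⟨SimpleGraph.Reachable.refl _, h1⟩)
        · exact Or.inr (Or.inl ⟨SimpleGraph.Reachable.refl _, h2⟩)
        · exact Or.inl h2
      · rcases ih with h1 | ⟨h1, h2⟩ | ⟨h1, h2⟩
        · exact Or.inr (Or.inr ⟨SimpleGraph.Reachable.refl _, h1⟩)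
        · exact Or.inl h2
        · exact Or.inr (Or.inr ⟨SimpleGraph.Reachable.refl _, h2⟩)

/-- A new edge {u, v} can only merge the components of u and v, so the induced map on components is
injective once that of u is discarded. -/
lemma numComponents_le_sup_edge [Finite V] (G : SimpleGraph V) (e : Sym2 V) :
    numComponents G ≤ numComponents (G ⊔ SimpleGraph.fromEdgeSet {e}) + 1 := by
  classical
  induction e with
  | _ u v =>
    set G' := G ⊔ SimpleGraph.fromEdgeSet {s(u, v)} with hG'
    have : Fintype G.ConnectedComponent := Fintype.ofFinite _
    have : Fintype G'.ConnectedComponent := Fintype.ofFinite _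
    let φ : G.ConnectedComponent → G'.ConnectedComponent :=
      SimpleGraph.ConnectedComponent.map (SimpleGraph.Hom.ofLE (le_sup_left : G ≤ G'))
    have hinj : Set.InjOn φ
        ((Finset.univ.erase (G.connectedComponentMk u) : Finset G.ConnectedComponent) :
          Set G.ConnectedComponent) := by
      intro c hc d hd h
      induction c using SimpleGraph.ConnectedComponent.ind with | _ x => ?_
      induction d using SimpleGraph.ConnectedComponent.ind with | _ y => ?_
      have hx : ¬ G.Reachable x u := fun h' => by
        simp [SimpleGraph.ConnectedComponent.eq, h'] at hc
      have hy : ¬ G.Reachable u y := fun h' => by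
        simp [SimpleGraph.ConnectedComponent.eq, h'.symm] at hd
      have hxy : G'.Reachable x y := SimpleGraph.ConnectedComponent.exact h
      rcases reachable_or_of_reachable_sup_edge hxy with h1 | ⟨h1, -⟩ | ⟨-, h1⟩
      · exact SimpleGraph.ConnectedComponent.sound h1
      · exact absurd h1 hx
      · exact absurd h1 hy
    have hcard := Finset.card_le_card_of_injOn φ (t := Finset.univ) (fun _ _ => by simp) hinj
    rw [Finset.card_erase_of_mem (Finset.mem_univ _), Finset.card_univ, Finset.card_univ] at hcard
    rw [numComponents, numComponents, Nat.card_eq_fintype_card, Nat.card_eq_fintype_card]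
    omega

lemma numComponents_le_sup [Finite V] (G : SimpleGraph V) (S : Finset (Sym2 V)) :
    numComponents G ≤ numComponents (G ⊔ SimpleGraph.fromEdgeSet (S : Set (Sym2 V))) + S.card := by
  classical
  induction S using Finset.induction_on with
  | empty => simp
  | insert e S he ih =>
    have h := numComponents_le_sup_edge (G ⊔ SimpleGraph.fromEdgeSet (S : Set (Sym2 V))) e
    have h2 : G ⊔ SimpleGraph.fromEdgeSet (S : Set (Sym2 V)) ⊔ SimpleGraph.fromEdgeSet {e} =
        G ⊔ SimpleGraph.fromEdgeSet ((insert e S : Finset (Sym2 V)) : Set (Sym2 V)) := by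
      rw [sup_assoc, ← SimpleGraph.fromEdgeSet_union, Set.union_comm, ← Set.insert_eq,
        Finset.coe_insert]
    rw [h2] at h
    rw [Finset.card_insert_of_notMem he]
    omega

/-- The number of components of a subforest of a tree. -/
lemma numComponents_add_card_of_le_tree [Fintype V] {F T : SimpleGraph V} (hT : T.IsTree)
    (hF : F ≤ T) : numComponents F + Nat.card F.edgeSet = Fintype.card V := by
  classical
  rw [Nat.card_eq_fintype_card, ← SimpleGraph.edgeFinset_card]
  -- Going from the empty graph to F and then to T, each edge lowers the count by at most one. The
  -- total drop is |V| - 1, the number of edges of T, so both inequalities are equalities.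
  have h1 := numComponents_le_sup (⊥ : SimpleGraph V) F.edgeFinset
  rw [bot_sup_eq, SimpleGraph.coe_edgeFinset, SimpleGraph.fromEdgeSet_edgeSet, numComponents_bot,
    Nat.card_eq_fintype_card] at h1
  have hsub : F.edgeFinset ⊆ T.edgeFinset := SimpleGraph.edgeFinset_mono hF
  have h2 := numComponents_le_sup F (T.edgeFinset \ F.edgeFinset)
  have h3 : F ⊔ SimpleGraph.fromEdgeSet ((T.edgeFinset \ F.edgeFinset : Finset (Sym2 V)) :
      Set (Sym2 V)) = T := by
    conv_lhs => enter [1]; rw [← SimpleGraph.fromEdgeSet_edgeSet F]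
    rw [← SimpleGraph.fromEdgeSet_union, Finset.coe_sdiff, SimpleGraph.coe_edgeFinset,
      SimpleGraph.coe_edgeFinset, Set.union_sdiff_cancel (SimpleGraph.edgeSet_mono hF),
      SimpleGraph.fromEdgeSet_edgeSet]
  rw [h3, numComponents_of_connected hT.connected, Finset.card_sdiff_of_subset hsub] at h2
  have h4 := hT.card_edgeFinset
  have h5 := Finset.card_le_card hsub
  omega

/-- A single forest spans the components of all members of a chain of graphs. -/
lemma exists_isAcyclic_forall_reachable_eq {G : ℝ → SimpleGraph V} (hG : Monotone G)
    (s : Finset ℝ) : ∃ F : SimpleGraph V, F.IsAcyclic ∧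
      (∀ p ∈ s, (F ⊓ G p).Reachable = (G p).Reachable) ∧
      ∀ q, (∀ p ∈ s, p ≤ q) → F ≤ G q := by
  classical
  induction s using Finset.induction_on_max with
  | empty => exact ⟨⊥, SimpleGraph.isAcyclic_bot, by simp, fun _ _ => bot_le⟩
  | insert a s ha ih =>
    obtain ⟨F, hF, hreach, hle⟩ := ih
    -- One round of Kruskal's algorithm: the forest built so far lies in the graph at the larger
    -- threshold a, and is extended there to a spanning forest.
    obtain ⟨F', hFF', hF'G, hF', hreach'⟩ :=
      SimpleGraph.exists_isAcyclic_reachable_eq_le_of_le_of_isAcyclic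
        (hle a fun p hp => (ha p hp).le) hF
    refine ⟨F', hF', fun p hp => ?_, fun q hq => hF'G.trans (hG (hq a (by simp)))⟩
    rcases Finset.mem_insert.1 hp with rfl | hp
    · rw [inf_eq_left.2 hF'G, hreach']
    · funext x y
      refine propext ⟨fun h => h.mono inf_le_right, fun h => ?_⟩
      rw [← hreach p hp] at h
      exact h.mono (inf_le_inf_right _ hFF')

end ComponentCount

/-! ### The minimal spanning tree through threshold graphs. -/

section OpenGraph

variable {n : ℕ}

/-- The graph of the edges with `ω e ≤ p`. -/
def openGraph (p : ℝ) (ω : Env n) : SimpleGraph (Fin n) :=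
  SimpleGraph.fromEdgeSet (Subtype.val '' {e : Edge n | ω e ≤ p})

lemma edgeSet_openGraph (p : ℝ) (ω : Env n) :
    (openGraph p ω).edgeSet = Subtype.val '' {e : Edge n | ω e ≤ p} := by
  rw [openGraph, SimpleGraph.edgeSet_fromEdgeSet, sdiff_eq_left, Set.disjoint_left]
  rintro _ ⟨e, -, rfl⟩ h
  exact SimpleGraph.not_isDiag_of_mem_edgeSet _ e.2 h

lemma openGraph_mono (ω : Env n) : Monotone fun p => openGraph p ω := by
  intro p q hpq
  rw [← SimpleGraph.edgeSet_subset_edgeSet, edgeSet_openGraph, edgeSet_openGraph]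
  exact Set.image_mono fun e he => le_trans he hpq

lemma coe_mem_edgeSet_openGraph {p : ℝ} {ω : Env n} (e : Edge n) :
    (e : Sym2 (Fin n)) ∈ (openGraph p ω).edgeSet ↔ ω e ≤ p := by
  rw [edgeSet_openGraph]
  constructor
  · rintro ⟨e', he', h⟩
    rwa [← Subtype.ext h]
  · intro h
    exact ⟨e, h, rfl⟩

lemma card_edgeSet_inf_openGraph (p : ℝ) (ω : Env n) (T : SimpleGraph (Fin n)) :
    Nat.card (T ⊓ openGraph p ω).edgeSet = ((treeEdges T).filter fun e => ω e ≤ p).card := by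
  classical
  rw [Nat.card_eq_fintype_card, ← SimpleGraph.edgeFinset_card, ← Finset.card_map (Function.Embedding.subtype _)]
  congr 1
  ext e
  simp only [SimpleGraph.mem_edgeFinset, SimpleGraph.edgeSet_inf, Set.mem_inter_iff,
    Finset.mem_map, Finset.mem_filter, Function.Embedding.coe_subtype, treeEdges,
    Finset.mem_univ, true_and]
  constructor
  · rintro ⟨h1, h2⟩
    refine ⟨⟨e, SimpleGraph.edgeSet_mono le_top h1⟩, ⟨h1, ?_⟩, rfl⟩
    exact (coe_mem_edgeSet_openGraph (⟨e, SimpleGraph.edgeSet_mono le_top h1⟩ : Edge n)).1 h2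
  · rintro ⟨e', ⟨h1, h2⟩, rfl⟩
    exact ⟨h1, (coe_mem_edgeSet_openGraph e').2 h2⟩

/-- The edges of a tree that are longer than `p` are one fewer than the components left after
their removal. -/
lemma numComponents_inf_openGraph (p : ℝ) (ω : Env n) {T : SimpleGraph (Fin n)} (hT : T.IsTree) :
    numComponents (T ⊓ openGraph p ω) = ((treeEdges T).filter fun e => p < ω e).card + 1 := by
  classical
  have h1 := numComponents_add_card_of_le_tree hT (inf_le_left : T ⊓ openGraph p ω ≤ T)
  rw [card_edgeSet_inf_openGraph, Fintype.card_fin] at h1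
  have h2 := card_treeEdges hT
  have h3 := Finset.card_filter_add_card_filter_not (s := treeEdges T) (fun e => ω e ≤ p)
  simp only [not_le] at h3
  omega

/-- The length of the minimal spanning tree, expressed through the numbers of components of
the graphs of short edges. -/
def percolationLength (ω : Env n) : ℝ :=
  ∫ p in (0 : ℝ)..1, ((numComponents (openGraph p ω) : ℝ) - 1)

lemma antitone_numComponents_openGraph (ω : Env n) :
    Antitone fun p => (numComponents (openGraph p ω) : ℝ) := fun _ _ hpq =>
  Nat.cast_le.2 (numComponents_le_of_le (openGraph_mono ω hpq))

lemma intervalIntegrable_numComponents (ω : Env n) (a b : ℝ) :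
    IntervalIntegrable (fun p => (numComponents (openGraph p ω) : ℝ) - 1) volume a b :=
  ((antitone_numComponents_openGraph ω).antitoneOn _).intervalIntegrable.sub (by simp)

/-- Each ω e is the integral of the indicator of p < ω e, and the number of tree edges longer than p
is one less than the number of pieces left by removing them. -/
lemma treeLength_eq_integral {ω : Env n} (hω : ∀ e, ω e ∈ Set.Icc (0 : ℝ) 1)
    {T : SimpleGraph (Fin n)} (hT : T.IsTree) :
    treeLength ω T = ∫ p in (0 : ℝ)..1, ((numComponents (T ⊓ openGraph p ω) : ℝ) - 1) := by
  have hcount : ∀ p, ((numComponents (T ⊓ openGraph p ω) : ℝ) - 1) =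
      ∑ e ∈ treeEdges T, Set.indicator (Set.Iio (ω e)) (fun _ => (1 : ℝ)) p := by
    intro p
    rw [numComponents_inf_openGraph p ω hT, Finset.card_filter]
    push_cast
    rw [add_sub_cancel_right]
    refine Finset.sum_congr rfl fun e _ => ?_
    simp [Set.indicator_apply]
  have hanti : ∀ e, AntitoneOn (Set.indicator (Set.Iio (ω e)) (fun _ => (1 : ℝ)))
      (Set.uIcc 0 1) := by
    intro e x _ y _ hxy
    by_cases hy : y < ω e
    · simp [hy, lt_of_le_of_lt hxy hy]
    · by_cases hx : x < ω e <;> simp [hy, hx]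
  simp only [hcount]
  rw [intervalIntegral.integral_finsetSum fun e _ => (hanti e).intervalIntegrable, treeLength]
  refine Finset.sum_congr rfl fun e _ => ?_
  have h0 := hω e
  have hset : Set.Ioc 0 1 ∩ Set.Iio (ω e) = Set.Ioo 0 (ω e) := by
    ext x
    simp only [Set.mem_inter_iff, Set.mem_Ioc, Set.mem_Iio, Set.mem_Ioo]
    exact ⟨fun h => ⟨h.1.1, h.2⟩, fun h => ⟨⟨h.1, h.2.le.trans h0.2⟩, h.2⟩⟩
  rw [intervalIntegral.integral_of_le zero_le_one, setIntegral_indicator measurableSet_Iio, hset]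
  simp [h0.1]

lemma percolationLength_le_treeLength {ω : Env n} (hω : ∀ e, ω e ∈ Set.Icc (0 : ℝ) 1)
    {T : SimpleGraph (Fin n)} (hT : T.IsTree) : percolationLength ω ≤ treeLength ω T := by
  rw [treeLength_eq_integral hω hT]
  refine intervalIntegral.integral_mono_on zero_le_one (intervalIntegrable_numComponents ω 0 1) ?_
    fun p _ => ?_
  · refine AntitoneOn.intervalIntegrable fun p _ q _ hpq => ?_
    gcongr
    exact numComponents_le_of_le (inf_le_inf_left _ (openGraph_mono ω hpq))
  · gcongr
    exact numComponents_le_of_le inf_le_right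

/-- Existence of the minimal spanning tree. -/
lemma exists_treeLength_eq_percolationLength (hn : 0 < n) {ω : Env n}
    (hω : ∀ e, ω e ∈ Set.Icc (0 : ℝ) 1) :
    ∃ T : SimpleGraph (Fin n), T.IsTree ∧ treeLength ω T = percolationLength ω := by
  classical
  -- The threshold graph changes only at values of ω, so finitely many thresholds suffice; the last
  -- one, 1, gives the complete graph and makes the forest spanning.
  obtain ⟨F, hF, hreach, -⟩ := exists_isAcyclic_forall_reachable_eq (openGraph_mono ω)
    (insert 1 (Finset.univ.image ω))
  have hall : ∀ p, (F ⊓ openGraph p ω).Reachable = (openGraph p ω).Reachable := by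
    intro p
    by_cases hne : ((Finset.univ.image ω).filter fun q => q ≤ p).Nonempty
    · set q := ((Finset.univ.image ω).filter fun q => q ≤ p).max' hne with hq
      obtain ⟨hq1, hq2⟩ := Finset.mem_filter.1 (Finset.max'_mem _ hne)
      have hpq : openGraph p ω = openGraph q ω := by
        refine le_antisymm ?_ (openGraph_mono ω hq2)
        rw [← SimpleGraph.edgeSet_subset_edgeSet, edgeSet_openGraph, edgeSet_openGraph]
        refine Set.image_mono fun e he => ?_
        exact Finset.le_max' _ (ω e) (Finset.mem_filter.2 ⟨Finset.mem_image_of_mem _ (Finset.mem_univ _), he⟩)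
      rw [hpq]
      exact hreach q (Finset.mem_insert_of_mem hq1)
    · have hbot : openGraph p ω = ⊥ := by
        rw [← SimpleGraph.edgeSet_eq_empty, edgeSet_openGraph, Set.image_eq_empty,
          Set.eq_empty_iff_forall_notMem]
        intro e he
        exact hne ⟨ω e, Finset.mem_filter.2 ⟨Finset.mem_image_of_mem _ (Finset.mem_univ _), he⟩⟩
      rw [hbot, inf_bot_eq]
  have htop : openGraph 1 ω = ⊤ := by
    rw [eq_top_iff, ← SimpleGraph.edgeSet_subset_edgeSet]
    intro e he
    exact (coe_mem_edgeSet_openGraph (⟨e, he⟩ : Edge n)).2 (hω _).2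
  have hFtree : F.IsTree := by
    have : Nonempty (Fin n) := ⟨⟨0, hn⟩⟩
    refine ⟨⟨fun u v => ?_⟩, hF⟩
    have h1 := hall 1
    rw [htop, inf_top_eq] at h1
    rw [h1]
    exact SimpleGraph.connected_top.preconnected u v
  refine ⟨F, hFtree, ?_⟩
  rw [treeLength_eq_integral hω hFtree, percolationLength]
  simp only [numComponents_eq_of_reachable_eq (hall _)]

/-- At low temperature the quenched length is close to the length of the minimal spanning tree. -/
lemma abs_quenchedLength_sub_percolationLength_le (hn : 0 < n) {β : ℝ} (hβ : 0 < β) {ω : Env n}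
    (hω : ∀ e, ω e ∈ Set.Icc (0 : ℝ) 1) :
    |quenchedLength β ω - percolationLength ω| ≤ n * Real.log n / β := by
  have hn' : (1 : ℝ) ≤ n := by exact_mod_cast hn
  have h1 : percolationLength ω ≤ quenchedLength β ω := by
    calc percolationLength ω = ∑ T ∈ spanningTrees n, quenchedProb β ω T * percolationLength ω := by
          rw [← Finset.sum_mul, sum_quenchedProb hn, one_mul]
      _ ≤ quenchedLength β ω := Finset.sum_le_sum fun T hT => mul_le_mul_of_nonneg_left
          (percolationLength_le_treeLength hω (mem_spanningTrees.1 hT)) (quenchedProb_nonneg β ω T)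
  -- Convexity between 0 and β bounds β times the quenched length by log Z(0) - log Z(β). Counting
  -- trees bounds the first term, the weight of the minimal tree the second.
  have h2 := log_partitionFunction_sub_ge hn 0 β ω
  have h3 : Real.log (partitionFunction 0 ω) ≤ n * Real.log n := by
    have h4 : partitionFunction 0 ω = (spanningTrees n).card := by
      simp [partitionFunction, treeWeight_eq_exp]
    rw [h4, ← Real.log_pow]
    have h5 : (0 : ℝ) < (spanningTrees n).card := by
      exact_mod_cast (spanningTrees_nonempty hn).card_pos
    refine Real.log_le_log h5 ?_
    calc ((spanningTrees n).card : ℝ) ≤ n * (spanningTrees n).card := by nlinarith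
      _ = (n : ℝ) ^ (n - 1) := card_spanningTrees hn
      _ ≤ (n : ℝ) ^ n := pow_le_pow_right₀ hn' (Nat.sub_le _ _)
  obtain ⟨T, hT, hTlen⟩ := exists_treeLength_eq_percolationLength hn hω
  have h6 : -β * percolationLength ω ≤ Real.log (partitionFunction β ω) := by
    rw [← hTlen, ← Real.log_exp (-β * treeLength ω T), ← treeWeight_eq_exp]
    exact Real.log_le_log (treeWeight_pos _ _ _) (Finset.single_le_sum
      (f := fun T => treeWeight β ω T) (fun T _ => (treeWeight_pos β ω T).le)
      (mem_spanningTrees.2 hT))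
  rw [abs_of_nonneg (by linarith), le_div_iff₀ hβ]
  linarith

end OpenGraph

/-! ### Components by size. -/

section ComponentSets

variable {V : Type*}

/-- `S` is the vertex set of a connected component of `G`. -/
def IsComponent (G : SimpleGraph V) (S : Finset V) : Prop :=
  ∃ c : G.ConnectedComponent, c.supp = S

lemma IsComponent.eq_of_mem {G : SimpleGraph V} {S S' : Finset V} (hS : IsComponent G S)
    (hS' : IsComponent G S') {v : V} (h : v ∈ S) (h' : v ∈ S') : S = S' := by
  obtain ⟨c, hc⟩ := hS
  obtain ⟨c', hc'⟩ := hS'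
  have h1 : v ∈ c.supp := by rw [hc]; exact h
  have h2 : v ∈ c'.supp := by rw [hc']; exact h'
  rw [SimpleGraph.ConnectedComponent.mem_supp_iff] at h1 h2
  have : c = c' := h1.symm.trans h2
  subst this
  exact_mod_cast hc.symm.trans hc'

lemma IsComponent.nonempty {G : SimpleGraph V} {S : Finset V} (hS : IsComponent G S) :
    S.Nonempty := by
  obtain ⟨c, hc⟩ := hS
  have := c.nonempty_supp
  rw [hc] at this
  exact_mod_cast this

variable [Fintype V]

open Classical in
/-- The vertex sets of the connected components of `G`. -/
def componentSets (G : SimpleGraph V) : Finset (Finset V) :=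
  Finset.univ.filter (IsComponent G)

open Classical in
/-- The number of connected components of `G` with `k` vertices. -/
def componentCount (G : SimpleGraph V) (k : ℕ) : ℕ :=
  ((Finset.univ.powersetCard k).filter (IsComponent G)).card

lemma mem_componentSets {G : SimpleGraph V} {S : Finset V} :
    S ∈ componentSets G ↔ IsComponent G S := by
  simp [componentSets]

lemma componentCount_eq (G : SimpleGraph V) (k : ℕ) :
    componentCount G k = ((componentSets G).filter fun S => S.card = k).card := by
  classical
  rw [componentCount]
  congr 1
  ext S
  simp [componentSets, Finset.mem_powersetCard, and_comm]

lemma card_componentSets (G : SimpleGraph V) : (componentSets G).card = numComponents G := by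
  classical
  rw [numComponents, Nat.card_eq_fintype_card, ← Finset.card_univ]
  symm
  refine Finset.card_bij (fun c _ => c.supp.toFinset) ?_ ?_ ?_
  · intro c _
    exact mem_componentSets.2 ⟨c, by simp⟩
  · intro c _ d _ h
    exact SimpleGraph.ConnectedComponent.supp_injective (Set.toFinset_inj.1 h)
  · intro S hS
    obtain ⟨c, hc⟩ := mem_componentSets.1 hS
    exact ⟨c, Finset.mem_univ _, by ext; simp [hc]⟩

lemma sum_card_componentSets_le (G : SimpleGraph V) :
    ∑ S ∈ componentSets G, S.card ≤ Fintype.card V := by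
  classical
  rw [← Finset.card_biUnion]
  · exact Finset.card_le_univ _
  · intro S hS S' hS' hne
    rw [Function.onFun, Finset.disjoint_left]
    intro v hv hv'
    exact hne ((mem_componentSets.1 hS).eq_of_mem (mem_componentSets.1 hS') hv hv')

lemma sum_componentCount_eq (G : SimpleGraph V) (s : Finset ℕ) :
    ∑ k ∈ s, componentCount G k = ((componentSets G).filter fun S => S.card ∈ s).card := by
  classical
  have hmaps : ∀ S ∈ (componentSets G).filter (fun S => S.card ∈ s), S.card ∈ s := fun S hS =>
    (Finset.mem_filter.1 hS).2
  rw [Finset.card_eq_sum_card_fiberwise hmaps]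
  refine Finset.sum_congr rfl fun k hk => ?_
  rw [componentCount_eq]
  congr 1
  ext S
  simp only [Finset.mem_filter]
  constructor
  · rintro ⟨h1, rfl⟩
    exact ⟨⟨h1, hk⟩, rfl⟩
  · rintro ⟨⟨h1, -⟩, h2⟩
    exact ⟨h1, h2⟩

lemma sum_componentCount_le (G : SimpleGraph V) (s : Finset ℕ) :
    ∑ k ∈ s, componentCount G k ≤ numComponents G := by
  rw [sum_componentCount_eq, ← card_componentSets]
  exact Finset.card_filter_le _ _

/-- Components with more than K vertices number at most |V|/K; multiplying by K keeps the statement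
in ℕ. -/
lemma numComponents_le_sum_add (G : SimpleGraph V) (K : ℕ) :
    K * numComponents G ≤ K * ∑ k ∈ Finset.range K, componentCount G (k + 1) +
      Fintype.card V := by
  classical
  have h0 : ∑ k ∈ Finset.range K, componentCount G (k + 1) =
      ((componentSets G).filter fun S => S.card ∈ Finset.Icc 1 K).card := by
    rw [← sum_componentCount_eq, Finset.range_eq_Ico,
      Finset.sum_Ico_add' (fun k => componentCount G k)]
    exact Finset.sum_congr (by ext; simp) fun _ _ => rfl
  have h1 := Finset.card_filter_add_card_filter_not (s := componentSets G)
    (fun S => S.card ∈ Finset.Icc 1 K)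
  have h2 : K * ((componentSets G).filter fun S => ¬ S.card ∈ Finset.Icc 1 K).card ≤
      Fintype.card V := by
    refine le_trans ?_ (sum_card_componentSets_le G)
    rw [mul_comm, ← smul_eq_mul]
    refine le_trans (Finset.card_nsmul_le_sum _ (fun S => S.card) K fun S hS => ?_)
      (Finset.sum_le_sum_of_subset (Finset.filter_subset _ _))
    obtain ⟨h3, h4⟩ := Finset.mem_filter.1 hS
    have h5 := (mem_componentSets.1 h3).nonempty.card_pos
    rw [Finset.mem_Icc] at h4
    omega
  rw [h0, ← card_componentSets, ← h1, mul_add]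
  omega

/-- Two components with more than half of the vertices each would intersect, so there is at most
one. -/
lemma numComponents_le_sum_half (G : SimpleGraph V) :
    numComponents G ≤ ∑ k ∈ (Finset.range (Fintype.card V)).filter
      (fun k => 2 * (k + 1) ≤ Fintype.card V), componentCount G (k + 1) + 1 := by
  classical
  set s := ((Finset.range (Fintype.card V)).filter
      (fun k => 2 * (k + 1) ≤ Fintype.card V)).map ⟨Nat.succ, Nat.succ_injective⟩ with hs
  have h0 : ∑ k ∈ (Finset.range (Fintype.card V)).filter
      (fun k => 2 * (k + 1) ≤ Fintype.card V), componentCount G (k + 1) =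
      ((componentSets G).filter fun S => S.card ∈ s).card := by
    rw [← sum_componentCount_eq, hs, Finset.sum_map]
    rfl
  rw [h0, ← card_componentSets, ← Finset.card_filter_add_card_filter_not (s := componentSets G)
    (fun S => S.card ∈ s)]
  gcongr
  rw [Finset.card_le_one]
  have hbig : ∀ S ∈ (componentSets G).filter (fun S => ¬ S.card ∈ s),
      IsComponent G S ∧ Fintype.card V < 2 * S.card := by
    intro S hS
    obtain ⟨h3, h4⟩ := Finset.mem_filter.1 hS
    have h5 := (mem_componentSets.1 h3).nonempty.card_pos
    refine ⟨mem_componentSets.1 h3, ?_⟩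
    by_contra hcon
    refine h4 (Finset.mem_map.2 ⟨S.card - 1, Finset.mem_filter.2 ⟨?_, ?_⟩, ?_⟩)
    · rw [Finset.mem_range]; omega
    · omega
    · simp only [Function.Embedding.coeFn_mk]; omega
  intro S hS S' hS'
  obtain ⟨h1, h2⟩ := hbig S hS
  obtain ⟨h3, h4⟩ := hbig S' hS'
  have hne : ¬ Disjoint S S' := by
    intro hd
    have := Finset.card_le_univ (S ∪ S')
    rw [Finset.card_union_of_disjoint hd] at this
    omega
  rw [Finset.not_disjoint_iff] at hne
  obtain ⟨v, hv, hv'⟩ := hne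
  exact h1.eq_of_mem h3 hv hv'

end ComponentSets

/-! ### Edge boundaries and embedded trees. -/

section Boundary

variable {n : ℕ}

open Classical in
/-- The edges between `A` and `B`. -/
def edgesBetween (A B : Finset (Fin n)) : Finset (Edge n) :=
  Finset.univ.filter fun e => ∃ u ∈ A, ∃ v ∈ B, (e : Sym2 (Fin n)) = s(u, v)

lemma mem_edgesBetween {A B : Finset (Fin n)} {e : Edge n} :
    e ∈ edgesBetween A B ↔ ∃ u ∈ A, ∃ v ∈ B, (e : Sym2 (Fin n)) = s(u, v) := by
  simp [edgesBetween]

lemma card_edgesBetween_le (A B : Finset (Fin n)) :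
    (edgesBetween A B).card ≤ A.card * B.card := by
  classical
  rw [← Finset.card_product, ← Finset.card_map (Function.Embedding.subtype _)]
  refine le_trans (Finset.card_le_card ?_) (Finset.card_image_le (s := A ×ˢ B)
    (f := fun q => s(q.1, q.2)))
  intro e he
  obtain ⟨e', he', rfl⟩ := Finset.mem_map.1 he
  obtain ⟨u, hu, v, hv, h⟩ := mem_edgesBetween.1 he'
  exact Finset.mem_image.2 ⟨(u, v), by simp [hu, hv], h.symm⟩

lemma card_edgesBetween {A B : Finset (Fin n)} (hAB : Disjoint A B) :
    (edgesBetween A B).card = A.card * B.card := by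
  refine le_antisymm (card_edgesBetween_le A B) ?_
  classical
  rw [← Finset.card_product, ← Finset.card_map (Function.Embedding.subtype _)]
  refine Finset.card_le_card_of_injOn (fun q => s(q.1, q.2)) ?_ ?_
  · rintro ⟨u, v⟩ h
    obtain ⟨hu, hv⟩ := Finset.mem_product.1 h
    have hne : u ≠ v := fun h' => Finset.disjoint_left.1 hAB hu (h' ▸ hv)
    have hmem : s(u, v) ∈ (⊤ : SimpleGraph (Fin n)).edgeSet := by
      rw [SimpleGraph.mem_edgeSet]; exact hne
    exact Finset.mem_coe.2 (Finset.mem_map.2 ⟨⟨s(u, v), hmem⟩,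
      mem_edgesBetween.2 ⟨u, hu, v, hv, rfl⟩, rfl⟩)
  · rintro ⟨u, v⟩ h ⟨u', v'⟩ h' heq
    obtain ⟨hu, hv⟩ := Finset.mem_product.1 h
    obtain ⟨hu', hv'⟩ := Finset.mem_product.1 h'
    rcases Sym2.eq_iff.1 heq with ⟨h1, h2⟩ | ⟨h1, h2⟩
    · exact Prod.ext h1 h2
    · simp only at h1
      exact absurd (h1 ▸ hv') (Finset.disjoint_left.1 hAB hu)

/-- Characterization of components by connectedness inside and closed boundary edges. -/
lemma isComponent_openGraph_iff {p : ℝ} {ω : Env n} {k : ℕ} (hk : 0 < k) {S : Finset (Fin n)}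
    {g : Fin k ↪ Fin n} (hg : Set.range g = S) :
    IsComponent (openGraph p ω) S ↔
      ((openGraph p ω).comap g).Connected ∧ ∀ e ∈ edgesBetween S Sᶜ, p < ω e := by
  set G := openGraph p ω with hG
  have hgS : ∀ i, g i ∈ S := fun i => by
    have : g i ∈ Set.range g := ⟨i, rfl⟩
    rw [hg] at this
    exact this
  have hSg : ∀ v ∈ S, ∃ i, g i = v := fun v hv => by
    have : v ∈ (S : Set (Fin n)) := hv
    rwa [← hg] at this
  have hnonempty : Nonempty (Fin k) := ⟨⟨0, hk⟩⟩
  -- If no open edge leaves S, a walk started in S stays there and lifts through g.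
  have key : (∀ u v, u ∈ S → G.Adj u v → v ∈ S) → ∀ i x, G.Reachable (g i) x →
      ∃ j, g j = x ∧ (G.comap g).Reachable i j := by
    rintro hclosed i x ⟨q⟩
    generalize hy : g i = y at q
    induction q generalizing i with
    | nil => exact ⟨i, hy, SimpleGraph.Reachable.refl _⟩
    | @cons a b c hab q ih =>
      obtain ⟨i', hi'⟩ := hSg b (hclosed a b (hy ▸ hgS i) hab)
      obtain ⟨j, hj, hr⟩ := ih i' hi'
      refine ⟨j, hj, SimpleGraph.Reachable.trans (SimpleGraph.Adj.reachable ?_) hr⟩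
      rw [SimpleGraph.comap_adj, hy, hi']
      exact hab
  have hbd : (∀ e ∈ edgesBetween S Sᶜ, p < ω e) ↔ ∀ u v, u ∈ S → G.Adj u v → v ∈ S := by
    constructor
    · intro h u v hu huv
      by_contra hv
      have hmem : s(u, v) ∈ (⊤ : SimpleGraph (Fin n)).edgeSet := by
        rw [SimpleGraph.mem_edgeSet]; exact huv.ne
      have h1 := h ⟨s(u, v), hmem⟩ (mem_edgesBetween.2 ⟨u, hu, v, by simpa using hv, rfl⟩)
      have h2 := (coe_mem_edgeSet_openGraph (p := p) (ω := ω) ⟨s(u, v), hmem⟩).1 huv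
      exact absurd h1 (not_lt.2 h2)
    · intro h e he
      obtain ⟨u, hu, v, hv, heq⟩ := mem_edgesBetween.1 he
      by_contra hcon
      have h2 := (coe_mem_edgeSet_openGraph (p := p) (ω := ω) e).2 (not_lt.1 hcon)
      rw [heq] at h2
      exact absurd (h u v hu h2) (by simpa using hv)
  rw [hbd]
  constructor
  · rintro ⟨c, hc⟩
    have hmem : ∀ v, v ∈ S ↔ G.connectedComponentMk v = c := by
      intro v
      rw [← SimpleGraph.ConnectedComponent.mem_supp_iff, hc]
      rfl
    have hclosed : ∀ u v, u ∈ S → G.Adj u v → v ∈ S := by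
      intro u v hu huv
      rw [hmem] at hu ⊢
      rw [← hu]
      exact SimpleGraph.ConnectedComponent.sound huv.symm.reachable
    refine ⟨⟨fun i j => ?_⟩, hclosed⟩
    have hr : G.Reachable (g i) (g j) := SimpleGraph.ConnectedComponent.exact
      (((hmem _).1 (hgS i)).trans ((hmem _).1 (hgS j)).symm)
    obtain ⟨j', hj', hr'⟩ := key hclosed i _ hr
    rwa [g.injective hj'] at hr'
  · rintro ⟨hconn, hclosed⟩
    refine ⟨G.connectedComponentMk (g ⟨0, hk⟩), ?_⟩
    ext x
    rw [SimpleGraph.ConnectedComponent.mem_supp_iff, SimpleGraph.ConnectedComponent.eq]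
    constructor
    · intro h
      obtain ⟨j, hj, -⟩ := key hclosed _ _ h.symm
      exact hj ▸ hgS j
    · intro h
      obtain ⟨j, rfl⟩ := hSg x h
      exact (hconn.preconnected j ⟨0, hk⟩).map ⟨g, fun {a b} hab => hab⟩

lemma treeEdges_map_subset {k : ℕ} {S : Finset (Fin n)} {g : Fin k ↪ Fin n}
    (hg : Set.range g = S) (T : SimpleGraph (Fin k)) :
    treeEdges (T.map g) ⊆ edgesBetween S S := by
  intro e he
  have he' : (e : Sym2 (Fin n)) ∈ (T.map g).edgeSet := by simpa [treeEdges] using he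
  rw [SimpleGraph.edgeSet_map] at he'
  obtain ⟨f, -, hf⟩ := he'
  induction f with
  | _ i j =>
    have hmem : ∀ i, g i ∈ S := fun i => by
      have : g i ∈ Set.range g := ⟨i, rfl⟩
      rw [hg] at this
      exact this
    exact mem_edgesBetween.2 ⟨g i, hmem i, g j, hmem j, hf.symm⟩

lemma card_treeEdges_eq {n : ℕ} (T : SimpleGraph (Fin n)) :
    (treeEdges T).card = Nat.card T.edgeSet := by
  classical
  rw [Nat.card_eq_fintype_card, ← SimpleGraph.edgeFinset_card, ← map_treeEdges, Finset.card_map]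

lemma card_treeEdges_map {k : ℕ} (g : Fin k ↪ Fin n) {T : SimpleGraph (Fin k)} (hT : T.IsTree) :
    (treeEdges (T.map g)).card = k - 1 := by
  rw [card_treeEdges_eq, SimpleGraph.edgeSet_map, Nat.card_image_of_injective g.sym2Map.injective,
    ← card_treeEdges_eq]
  have := card_treeEdges hT
  omega

lemma treeEdges_map_le_iff {k : ℕ} (g : Fin k ↪ Fin n) (T : SimpleGraph (Fin k)) (p : ℝ)
    (ω : Env n) : (∀ e ∈ treeEdges (T.map g), ω e ≤ p) ↔ T ≤ (openGraph p ω).comap g := by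
  rw [← SimpleGraph.map_le_iff_le_comap, ← SimpleGraph.edgeSet_subset_edgeSet]
  constructor
  · intro h e he
    have hmem : e ∈ (⊤ : SimpleGraph (Fin n)).edgeSet := SimpleGraph.edgeSet_mono le_top he
    exact (coe_mem_edgeSet_openGraph (⟨e, hmem⟩ : Edge n)).2
      (h ⟨e, hmem⟩ (by simpa [treeEdges] using he))
  · intro h e he
    exact (coe_mem_edgeSet_openGraph e).1 (h (by simpa [treeEdges] using he))

lemma disjoint_edgesBetween {A B C D : Finset (Fin n)} (h1 : Disjoint A C ∨ Disjoint B D)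
    (h2 : Disjoint A D ∨ Disjoint B C) : Disjoint (edgesBetween A B) (edgesBetween C D) := by
  rw [Finset.disjoint_left]
  intro e he he'
  obtain ⟨u, hu, v, hv, h⟩ := mem_edgesBetween.1 he
  obtain ⟨u', hu', v', hv', h'⟩ := mem_edgesBetween.1 he'
  rcases Sym2.eq_iff.1 (h.symm.trans h') with ⟨rfl, rfl⟩ | ⟨rfl, rfl⟩
  · rcases h1 with h1 | h1
    · exact Finset.disjoint_left.1 h1 hu hu'
    · exact Finset.disjoint_left.1 h1 hv hv'
  · rcases h2 with h2 | h2
    · exact Finset.disjoint_left.1 h2 hu hv'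
    · exact Finset.disjoint_left.1 h2 hv hu'

end Boundary

/-! ### Measurability of the threshold graph. -/

section Measurability

variable {n : ℕ}

/-- Joint measurability in the threshold and the environment is what Tonelli's theorem needs later.
-/
lemma measurableSet_openGraph_eq (H : SimpleGraph (Fin n)) :
    MeasurableSet {q : ℝ × Env n | openGraph q.1 q.2 = H} := by
  classical
  have hset : {q : ℝ × Env n | openGraph q.1 q.2 = H} =
      ⋂ e : Edge n, {q : ℝ × Env n | q.2 e ≤ q.1 ↔ (e : Sym2 (Fin n)) ∈ H.edgeSet} := by
    ext q
    simp only [Set.mem_ofPred_eq, Set.mem_iInter, ← coe_mem_edgeSet_openGraph]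
    constructor
    · intro h e
      rw [h]
    · intro h
      rw [← SimpleGraph.edgeSet_inj]
      ext e
      constructor
      · intro he
        exact (h ⟨e, SimpleGraph.edgeSet_mono le_top he⟩).1 he
      · intro he
        exact (h ⟨e, SimpleGraph.edgeSet_mono le_top he⟩).2 he
  rw [hset]
  refine MeasurableSet.iInter fun e => ?_
  have hle : MeasurableSet {q : ℝ × Env n | q.2 e ≤ q.1} :=
    measurableSet_le ((measurable_pi_apply e).comp measurable_snd) measurable_fst
  by_cases he : (e : Sym2 (Fin n)) ∈ H.edgeSet
  · simpa [he] using hle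
  · have := hle.compl
    simp only [he, iff_false]
    exact this

lemma measurable_comp_openGraph (f : SimpleGraph (Fin n) → ℝ) :
    Measurable fun q : ℝ × Env n => f (openGraph q.1 q.2) := by
  classical
  have h : (fun q : ℝ × Env n => f (openGraph q.1 q.2)) = fun q =>
      ∑ H : SimpleGraph (Fin n), if openGraph q.1 q.2 = H then f H else 0 := by
    funext q
    simp
  rw [h]
  exact Finset.measurable_sum _ fun H _ =>
    Measurable.ite (measurableSet_openGraph_eq H) measurable_const measurable_const

lemma measurable_comp_openGraph_right (f : SimpleGraph (Fin n) → ℝ) (p : ℝ) :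
    Measurable fun ω : Env n => f (openGraph p ω) :=
  (measurable_comp_openGraph f).comp measurable_prodMk_left

lemma measurableSet_setOf_openGraph (P : SimpleGraph (Fin n) → Prop) (p : ℝ) :
    MeasurableSet {ω : Env n | P (openGraph p ω)} := by
  classical
  have h := measurable_comp_openGraph_right (fun H => if P H then (1 : ℝ) else 0) p
    (measurableSet_singleton 1)
  convert h using 1
  ext ω
  by_cases hP : P (openGraph p ω) <;> simp [hP]

end Measurability

/-! ### Probability that a given set is a component. -/

section ComponentProbability

variable {n : ℕ}

lemma exists_embedding_range_eq {k : ℕ} {S : Finset (Fin n)} (hS : S.card = k) :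
    ∃ g : Fin k ↪ Fin n, Set.range g = S :=
  ⟨(S.orderEmbOfFin hS).toEmbedding, Finset.range_orderEmbOfFin S hS⟩

lemma card_boundary {k : ℕ} {S : Finset (Fin n)} (hS : S.card = k) :
    (edgesBetween S Sᶜ).card = k * (n - k) := by
  rw [card_edgesBetween disjoint_compl_right, Finset.card_compl, Fintype.card_fin, hS]

lemma disjoint_treeEdges_boundary {k : ℕ} {S : Finset (Fin n)} {g : Fin k ↪ Fin n}
    (hg : Set.range g = S) (T : SimpleGraph (Fin k)) :
    Disjoint (treeEdges (T.map g)) (edgesBetween S Sᶜ) :=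
  Disjoint.mono_left (treeEdges_map_subset hg T)
    (disjoint_edgesBetween (Or.inr disjoint_compl_right) (Or.inl disjoint_compl_right))

/-- The expected contribution of one vertex set of size `k` to the number of tree components. -/
def treeComponentProb (n k : ℕ) (p : ℝ) : ℝ :=
  (spanningTrees k).card * (p ^ (k - 1) * (1 - p) ^ (k * (n - k)))

lemma exists_tree_of_isComponent {p : ℝ} {ω : Env n} {k : ℕ} (hk : 0 < k) {S : Finset (Fin n)}
    {g : Fin k ↪ Fin n} (hg : Set.range g = S) (h : IsComponent (openGraph p ω) S) :
    ∃ T ∈ spanningTrees k, (∀ e ∈ treeEdges (T.map g), ω e ≤ p) ∧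
      ∀ e ∈ edgesBetween S Sᶜ, p < ω e := by
  obtain ⟨hconn, hbd⟩ := (isComponent_openGraph_iff hk hg).1 h
  obtain ⟨T, hle, hT⟩ := hconn.exists_isTree_le
  exact ⟨T, mem_spanningTrees.2 hT, (treeEdges_map_le_iff g T p ω).2 hle, hbd⟩

/-- Union bound over the spanning trees of S. Tree edges and boundary edges are disjoint, so each
event has probability p^(k-1) (1-p)^(k(n-k)). -/
lemma measureReal_isComponent_le {p : ℝ} (h0 : 0 ≤ p) (h1 : p ≤ 1) {k : ℕ} (hk : 0 < k)
    {S : Finset (Fin n)} (hS : S.card = k) :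
    (envLaw n).real {ω | IsComponent (openGraph p ω) S} ≤ treeComponentProb n k p := by
  classical
  obtain ⟨g, hg⟩ := exists_embedding_range_eq hS
  have hsub : {ω : Env n | IsComponent (openGraph p ω) S} ⊆ ⋃ T ∈ spanningTrees k,
      {ω : Env n | (∀ e ∈ treeEdges (T.map g), ω e ≤ p) ∧ ∀ e ∈ edgesBetween S Sᶜ, p < ω e} := by
    intro ω hω
    obtain ⟨T, hT, h⟩ := exists_tree_of_isComponent hk hg hω
    exact Set.mem_biUnion hT h
  refine (measureReal_mono hsub (measure_ne_top _ _)).trans ((measureReal_biUnion_finset_le _ _).trans ?_)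
  rw [treeComponentProb, ← nsmul_eq_mul]
  refine Finset.sum_le_card_nsmul _ _ _ fun T hT => le_of_eq ?_
  rw [envLaw, measureReal_cylinder (disjoint_treeEdges_boundary hg T) h0 h1,
    card_treeEdges_map g (mem_spanningTrees.1 hT), card_boundary hS]

/-- Asking in addition that all other edges inside S be closed makes the events for different trees
disjoint; there are at most k² such edges. -/
lemma le_measureReal_isComponent {p : ℝ} (h0 : 0 ≤ p) (h1 : p ≤ 1) {k : ℕ} (hk : 0 < k)
    {S : Finset (Fin n)} (hS : S.card = k) :
    treeComponentProb n k p * (1 - p) ^ (k * k) ≤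
      (envLaw n).real {ω | IsComponent (openGraph p ω) S} := by
  classical
  obtain ⟨g, hg⟩ := exists_embedding_range_eq hS
  let B : SimpleGraph (Fin k) → Finset (Edge n) := fun T =>
    (edgesBetween S S \ treeEdges (T.map g)) ∪ edgesBetween S Sᶜ
  have hmap : ∀ (T : SimpleGraph (Fin k)) (ω : Env n), (∀ e ∈ treeEdges (T.map g), ω e ≤ p) →
      (∀ e ∈ B T, p < ω e) → (openGraph p ω).comap g = T := by
    intro T ω h2 h3
    refine le_antisymm ?_ ((treeEdges_map_le_iff g T p ω).1 h2)
    intro i j hij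
    rw [SimpleGraph.comap_adj] at hij
    have hmem : s(g i, g j) ∈ (⊤ : SimpleGraph (Fin n)).edgeSet := by
      rw [SimpleGraph.mem_edgeSet]; exact hij.ne
    have hle := (coe_mem_edgeSet_openGraph (p := p) (ω := ω) ⟨s(g i, g j), hmem⟩).1 hij
    have hgS : ∀ i, g i ∈ S := fun i => by
      have : g i ∈ Set.range g := ⟨i, rfl⟩
      rw [hg] at this
      exact this
    have htree : (⟨s(g i, g j), hmem⟩ : Edge n) ∈ treeEdges (T.map g) := by
      by_contra hcon
      refine absurd (h3 _ (Finset.mem_union_left _ (Finset.mem_sdiff.2 ⟨?_, hcon⟩))) (not_lt.2 hle)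
      exact mem_edgesBetween.2 ⟨g i, hgS i, g j, hgS j, rfl⟩
    have hadj : (T.map g).Adj (g i) (g j) := by
      rw [← SimpleGraph.mem_edgeSet]
      simpa [treeEdges] using htree
    simpa using hadj
  have hsub : ⋃ T ∈ spanningTrees k,
      {ω : Env n | (∀ e ∈ treeEdges (T.map g), ω e ≤ p) ∧ ∀ e ∈ B T, p < ω e} ⊆
      {ω : Env n | IsComponent (openGraph p ω) S} := by
    intro ω hω
    simp only [Set.mem_iUnion, exists_prop] at hω
    obtain ⟨T, hT, h2, h3⟩ := hω
    refine (isComponent_openGraph_iff hk hg).2 ⟨?_, fun e he => h3 e (Finset.mem_union_right _ he)⟩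
    rw [hmap T ω h2 h3]
    exact (mem_spanningTrees.1 hT).connected
  refine le_trans ?_ (measureReal_mono hsub (measure_ne_top _ _))
  rw [measureReal_biUnion_finset]
  · rw [treeComponentProb, mul_assoc, ← nsmul_eq_mul]
    refine Finset.card_nsmul_le_sum _ _ _ fun T hT => ?_
    have hdisj : Disjoint (treeEdges (T.map g)) (B T) :=
      Finset.disjoint_union_right.2 ⟨Finset.disjoint_sdiff, disjoint_treeEdges_boundary hg T⟩
    rw [envLaw, measureReal_cylinder hdisj h0 h1, card_treeEdges_map g (mem_spanningTrees.1 hT),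
      mul_assoc, ← pow_add]
    refine mul_le_mul_of_nonneg_left ?_ (pow_nonneg h0 _)
    refine pow_le_pow_of_le_one (by linarith) (by linarith) ?_
    refine (Finset.card_union_le _ _).trans ?_
    rw [card_boundary hS, add_comm]
    gcongr
    refine (Finset.card_le_card Finset.sdiff_subset).trans ?_
    have := card_edgesBetween_le S S
    rwa [hS] at this
  · intro T _ T' _ hne
    rw [Function.onFun, Set.disjoint_left]
    rintro ω ⟨h2, h3⟩ ⟨h4, h5⟩
    exact hne ((hmap T ω h2 h3).symm.trans (hmap T' ω h4 h5))
  · intro T _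
    exact measurableSet_cylinder _ _ _

/-- Intersecting distinct sets cannot both be components. For disjoint ones the two boundaries share
only edges between S and S', at most k² of them; the factor (1-p)^(k²) pays for these being counted
once instead of twice. -/
lemma measureReal_isComponent_inter_le {p : ℝ} (h0 : 0 ≤ p) (h1 : p ≤ 1) {k : ℕ} (hk : 0 < k)
    {S S' : Finset (Fin n)} (hS : S.card = k) (hS' : S'.card = k) (hne : S ≠ S') :
    (1 - p) ^ (k * k) * (envLaw n).real {ω | IsComponent (openGraph p ω) S ∧
      IsComponent (openGraph p ω) S'} ≤ treeComponentProb n k p ^ 2 := by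
  classical
  by_cases hdisj : Disjoint S S'
  swap
  · have hempty : {ω : Env n | IsComponent (openGraph p ω) S ∧ IsComponent (openGraph p ω) S'} =
        ∅ := by
      rw [Set.eq_empty_iff_forall_notMem]
      rintro ω ⟨h2, h3⟩
      obtain ⟨v, hv, hv'⟩ := Finset.not_disjoint_iff.1 hdisj
      exact hne (h2.eq_of_mem h3 hv hv')
    rw [hempty]
    simp [sq_nonneg]
  obtain ⟨g, hg⟩ := exists_embedding_range_eq hS
  obtain ⟨g', hg'⟩ := exists_embedding_range_eq hS'
  set D := edgesBetween S Sᶜ ∪ edgesBetween S' S'ᶜ with hD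
  have hsub : {ω : Env n | IsComponent (openGraph p ω) S ∧ IsComponent (openGraph p ω) S'} ⊆
      ⋃ q ∈ spanningTrees k ×ˢ spanningTrees k,
      {ω : Env n | (∀ e ∈ treeEdges (q.1.map g) ∪ treeEdges (q.2.map g'), ω e ≤ p) ∧
        ∀ e ∈ D, p < ω e} := by
    rintro ω ⟨h2, h3⟩
    obtain ⟨T, hT, h4, h5⟩ := exists_tree_of_isComponent hk hg h2
    obtain ⟨T', hT', h6, h7⟩ := exists_tree_of_isComponent hk hg' h3
    refine Set.mem_biUnion (x := (T, T')) (Finset.mem_product.2 ⟨hT, hT'⟩) ⟨?_, ?_⟩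
    · intro e he
      exact (Finset.mem_union.1 he).elim (h4 e) (h6 e)
    · intro e he
      exact (Finset.mem_union.1 he).elim (h5 e) (h7 e)
  have hcardD : D.card + (edgesBetween S Sᶜ ∩ edgesBetween S' S'ᶜ).card = 2 * (k * (n - k)) := by
    rw [hD, Finset.card_union_add_card_inter, card_boundary hS, card_boundary hS']
    ring
  have hinter : (edgesBetween S Sᶜ ∩ edgesBetween S' S'ᶜ).card ≤ k * k := by
    have h2 := card_edgesBetween_le S S'
    rw [hS, hS'] at h2
    refine (Finset.card_le_card ?_).trans h2
    intro e he
    obtain ⟨he1, he2⟩ := Finset.mem_inter.1 he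
    obtain ⟨u, hu, v, hv, h⟩ := mem_edgesBetween.1 he1
    obtain ⟨u', hu', v', hv', h'⟩ := mem_edgesBetween.1 he2
    rcases Sym2.eq_iff.1 (h.symm.trans h') with ⟨rfl, rfl⟩ | ⟨rfl, rfl⟩
    · exact absurd hu' (Finset.disjoint_left.1 hdisj hu)
    · exact mem_edgesBetween.2 ⟨u, hu, v, hu', h⟩
  have hprob : (envLaw n).real {ω | IsComponent (openGraph p ω) S ∧
      IsComponent (openGraph p ω) S'} ≤ ((spanningTrees k).card * (spanningTrees k).card : ℕ) *
        ((p ^ (k - 1)) ^ 2 * (1 - p) ^ D.card) := by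
    refine (measureReal_mono hsub (measure_ne_top _ _)).trans ((measureReal_biUnion_finset_le _ _).trans ?_)
    rw [← Finset.card_product, ← nsmul_eq_mul]
    refine Finset.sum_le_card_nsmul _ _ _ fun q hq => le_of_eq ?_
    obtain ⟨hT, hT'⟩ := Finset.mem_product.1 hq
    have hd1 : Disjoint (treeEdges (q.1.map g)) (treeEdges (q.2.map g')) :=
      Disjoint.mono (treeEdges_map_subset hg _) (treeEdges_map_subset hg' _)
        (disjoint_edgesBetween (Or.inl hdisj) (Or.inl hdisj))
    have hd2 : Disjoint (treeEdges (q.1.map g)) (edgesBetween S' S'ᶜ) :=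
      Disjoint.mono_left (treeEdges_map_subset hg _)
        (disjoint_edgesBetween (Or.inl hdisj) (Or.inr hdisj))
    have hd3 : Disjoint (treeEdges (q.2.map g')) (edgesBetween S Sᶜ) :=
      Disjoint.mono_left (treeEdges_map_subset hg' _)
        (disjoint_edgesBetween (Or.inl hdisj.symm) (Or.inr hdisj.symm))
    have hd : Disjoint (treeEdges (q.1.map g) ∪ treeEdges (q.2.map g')) D := by
      rw [hD, Finset.disjoint_union_left, Finset.disjoint_union_right, Finset.disjoint_union_right]
      exact ⟨⟨disjoint_treeEdges_boundary hg _, hd2⟩, hd3, disjoint_treeEdges_boundary hg' _⟩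
    rw [envLaw, measureReal_cylinder hd h0 h1, Finset.card_union_of_disjoint hd1,
      card_treeEdges_map g (mem_spanningTrees.1 hT), card_treeEdges_map g' (mem_spanningTrees.1 hT')]
    ring
  have hq : 0 ≤ 1 - p := by linarith
  calc (1 - p) ^ (k * k) * (envLaw n).real {ω | IsComponent (openGraph p ω) S ∧
      IsComponent (openGraph p ω) S'}
      ≤ (1 - p) ^ (edgesBetween S Sᶜ ∩ edgesBetween S' S'ᶜ).card *
        (((spanningTrees k).card * (spanningTrees k).card : ℕ) *
        ((p ^ (k - 1)) ^ 2 * (1 - p) ^ D.card)) :=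
        mul_le_mul (pow_le_pow_of_le_one hq (by linarith) hinter) hprob measureReal_nonneg
          (pow_nonneg hq _)
    _ = ((spanningTrees k).card * (spanningTrees k).card : ℕ) * (p ^ (k - 1)) ^ 2 *
        (1 - p) ^ (D.card + (edgesBetween S Sᶜ ∩ edgesBetween S' S'ᶜ).card) := by
        rw [pow_add]; ring
    _ = treeComponentProb n k p ^ 2 := by
        rw [hcardD, treeComponentProb, mul_comm 2 (k * (n - k)), pow_mul _ _ 2]
        push_cast
        ring

end ComponentProbability

/-! ### First and second moments of component counts. -/

section Moments

variable {n : ℕ}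

open Classical in
lemma componentCount_eq_sum_indicator (p : ℝ) (ω : Env n) (k : ℕ) :
    (componentCount (openGraph p ω) k : ℝ) = ∑ S ∈ Finset.univ.powersetCard k,
      Set.indicator {ω : Env n | IsComponent (openGraph p ω) S} (fun _ => (1 : ℝ)) ω := by
  rw [componentCount, Finset.card_filter]
  push_cast
  exact Finset.sum_congr rfl fun S _ => by simp [Set.indicator_apply]

lemma integral_componentCount (p : ℝ) (k : ℕ) :
    ∫ ω, (componentCount (openGraph p ω) k : ℝ) ∂(envLaw n) =
      ∑ S ∈ Finset.univ.powersetCard k,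
        (envLaw n).real {ω | IsComponent (openGraph p ω) S} := by
  simp only [componentCount_eq_sum_indicator]
  rw [integral_finsetSum _ fun S _ => (integrable_const (1 : ℝ)).indicator
    (measurableSet_setOf_openGraph (fun G => IsComponent G S) p)]
  exact Finset.sum_congr rfl fun S _ => by
    rw [integral_indicator_const _ (measurableSet_setOf_openGraph (fun G => IsComponent G S) p)]
    simp

lemma integral_componentCount_sq (p : ℝ) (k : ℕ) :
    ∫ ω, (componentCount (openGraph p ω) k : ℝ) ^ 2 ∂(envLaw n) =
      ∑ S ∈ Finset.univ.powersetCard k, ∑ S' ∈ Finset.univ.powersetCard k,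
        (envLaw n).real {ω | IsComponent (openGraph p ω) S ∧ IsComponent (openGraph p ω) S'} := by
  classical
  have hmeas : ∀ S S', MeasurableSet {ω : Env n | IsComponent (openGraph p ω) S ∧
      IsComponent (openGraph p ω) S'} := fun S S' =>
    measurableSet_setOf_openGraph (fun G => IsComponent G S ∧ IsComponent G S') p
  have hpt : ∀ ω : Env n, (componentCount (openGraph p ω) k : ℝ) ^ 2 =
      ∑ S ∈ Finset.univ.powersetCard k, ∑ S' ∈ Finset.univ.powersetCard k,
        Set.indicator {ω : Env n | IsComponent (openGraph p ω) S ∧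
          IsComponent (openGraph p ω) S'} (fun _ => (1 : ℝ)) ω := by
    intro ω
    rw [componentCount_eq_sum_indicator, sq, Finset.sum_mul_sum]
    refine Finset.sum_congr rfl fun S _ => Finset.sum_congr rfl fun S' _ => ?_
    by_cases h : IsComponent (openGraph p ω) S <;> by_cases h' : IsComponent (openGraph p ω) S' <;>
      simp [h, h']
  simp only [hpt]
  rw [integral_finsetSum _ fun S _ => integrable_finsetSum _ fun S' _ =>
    (integrable_const (1 : ℝ)).indicator (hmeas S S')]
  refine Finset.sum_congr rfl fun S _ => ?_
  rw [integral_finsetSum _ fun S' _ => (integrable_const (1 : ℝ)).indicator (hmeas S S')]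
  refine Finset.sum_congr rfl fun S' _ => ?_
  rw [integral_indicator_const _ (hmeas S S')]
  simp

/-- The approximate expected number of components with `k` vertices. -/
def treeComponentMean (n k : ℕ) (p : ℝ) : ℝ := n.choose k * treeComponentProb n k p

variable {p : ℝ} {k : ℕ}

lemma integral_componentCount_le (h0 : 0 ≤ p) (h1 : p ≤ 1) (hk : 0 < k) :
    ∫ ω, (componentCount (openGraph p ω) k : ℝ) ∂(envLaw n) ≤ treeComponentMean n k p := by
  have hcard : (Finset.powersetCard k (Finset.univ : Finset (Fin n))).card = n.choose k := by simp
  rw [integral_componentCount, treeComponentMean, ← hcard, ← nsmul_eq_mul]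
  exact Finset.sum_le_card_nsmul _ _ _ fun S hS =>
    measureReal_isComponent_le h0 h1 hk (Finset.mem_powersetCard.1 hS).2

lemma le_integral_componentCount (h0 : 0 ≤ p) (h1 : p ≤ 1) (hk : 0 < k) :
    treeComponentMean n k p * (1 - p) ^ (k * k) ≤
      ∫ ω, (componentCount (openGraph p ω) k : ℝ) ∂(envLaw n) := by
  have hcard : (Finset.powersetCard k (Finset.univ : Finset (Fin n))).card = n.choose k := by simp
  rw [integral_componentCount, treeComponentMean, ← hcard, mul_assoc, ← nsmul_eq_mul]
  exact Finset.card_nsmul_le_sum _ _ _ fun S hS =>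
    le_measureReal_isComponent h0 h1 hk (Finset.mem_powersetCard.1 hS).2

/-- The diagonal pairs contribute at most the mean, the others at most its square. -/
lemma integral_componentCount_sq_le (h0 : 0 ≤ p) (h1 : p ≤ 1) (hk : 0 < k) :
    (1 - p) ^ (k * k) * ∫ ω, (componentCount (openGraph p ω) k : ℝ) ^ 2 ∂(envLaw n) ≤
      treeComponentMean n k p + treeComponentMean n k p ^ 2 := by
  classical
  set P : Finset (Finset (Fin n)) := Finset.powersetCard k Finset.univ with hP
  have hcard : P.card = n.choose k := by simp [hP]
  have hS : ∀ S ∈ P, S.card = k := fun S h => (Finset.mem_powersetCard.1 h).2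
  have hq0 : 0 ≤ (1 - p) ^ (k * k) := pow_nonneg (by linarith) _
  have hq1 : (1 - p) ^ (k * k) ≤ 1 := pow_le_one₀ (by linarith) (by linarith)
  rw [integral_componentCount_sq, Finset.mul_sum]
  have hrow : ∀ S ∈ P, (1 - p) ^ (k * k) * ∑ S' ∈ P, (envLaw n).real
      {ω | IsComponent (openGraph p ω) S ∧ IsComponent (openGraph p ω) S'} ≤
      treeComponentProb n k p + P.card * treeComponentProb n k p ^ 2 := by
    intro S hSP
    rw [Finset.mul_sum, ← nsmul_eq_mul, ← Finset.sum_const]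
    have hself : treeComponentProb n k p =
        ∑ S' ∈ P, if S = S' then treeComponentProb n k p else 0 := by
      rw [Finset.sum_ite_eq, if_pos hSP]
    conv_rhs => enter [1]; rw [hself]
    rw [← Finset.sum_add_distrib]
    refine Finset.sum_le_sum fun S' hS'P => ?_
    by_cases h : S = S'
    · subst h
      simp only [and_self, if_true]
      have h2 := measureReal_isComponent_le (n := n) h0 h1 hk (hS S hSP)
      have h3 : 0 ≤ treeComponentProb n k p ^ 2 := sq_nonneg _
      have h4 : (0 : ℝ) ≤ (envLaw n).real {ω | IsComponent (openGraph p ω) S} := measureReal_nonneg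
      nlinarith
    · simp only [h, if_false, zero_add]
      exact measureReal_isComponent_inter_le h0 h1 hk (hS S hSP) (hS S' hS'P) h
  refine (Finset.sum_le_sum hrow).trans (le_of_eq ?_)
  rw [Finset.sum_const, nsmul_eq_mul, hcard, treeComponentMean]
  ring

end Moments

/-! ### The limiting component density and ζ(3). -/

section TreeDensity

/-- The limiting number, per vertex, of tree components of size `k` at mean degree `x`. -/
def treeDensity (k : ℕ) (x : ℝ) : ℝ :=
  (spanningTrees k).card / (k.factorial : ℝ) * (x ^ (k - 1) * Real.exp (-(k * x)))

/-- The limiting number of components per vertex at mean degree `x`. -/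
def componentDensity (x : ℝ) : ℝ := ∑' k : ℕ, treeDensity (k + 1) x

lemma sq_mul_card_spanningTrees {k : ℕ} (hk : 0 < k) :
    (k : ℝ) ^ 2 * (spanningTrees k).card = (k : ℝ) ^ k := by
  rw [sq, mul_assoc, card_spanningTrees hk, ← pow_succ', Nat.sub_add_cancel hk]

lemma card_spanningTrees_le_pow {k : ℕ} (hk : 0 < k) :
    ((spanningTrees k).card : ℝ) ≤ (k : ℝ) ^ k := by
  rw [← sq_mul_card_spanningTrees hk]
  have h1 : (1 : ℝ) ≤ (k : ℝ) ^ 2 := one_le_pow₀ (by exact_mod_cast hk)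
  nlinarith [(Nat.cast_nonneg (spanningTrees k).card : (0 : ℝ) ≤ _)]

lemma treeDensity_nonneg (k : ℕ) {x : ℝ} (hx : 0 ≤ x) : 0 ≤ treeDensity k x := by
  unfold treeDensity; positivity

lemma self_pow_div_factorial_le (k : ℕ) : (k : ℝ) ^ k / k.factorial ≤ Real.exp 1 ^ k := by
  rw [← Real.exp_nat_mul, mul_one]
  exact Real.pow_div_factorial_le_exp _ (Nat.cast_nonneg k) k

/-- From k^k/k! ≤ e^k and x e^(-x) ≤ e⁻¹ the exponential factors cancel exactly, leaving the 1/k²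
that comes from Cayley's formula. -/
lemma treeDensity_le {k : ℕ} (hk : 0 < k) {x : ℝ} (hx : 0 < x) :
    treeDensity k x ≤ x⁻¹ * (1 / (k : ℝ) ^ 2) := by
  have hk' : (0 : ℝ) < k := by exact_mod_cast hk
  have h1 : treeDensity k x * ((k : ℝ) ^ 2 * x) =
      (k : ℝ) ^ k / k.factorial * (x * Real.exp (-x)) ^ k := by
    have h2 : x ^ k = x ^ (k - 1) * x := by rw [← pow_succ, Nat.sub_add_cancel hk]
    have h3 : Real.exp (-x) ^ k = Real.exp (-(k * x)) := by
      rw [← Real.exp_nat_mul]; ring_nf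
    rw [mul_pow, h2, h3, ← sq_mul_card_spanningTrees hk, treeDensity]
    ring
  have h2 : treeDensity k x * ((k : ℝ) ^ 2 * x) ≤ 1 := by
    rw [h1]
    have h4 : x * Real.exp (-x) ≤ Real.exp (-1) := by
      have := Real.add_one_le_exp (x - 1)
      rw [sub_add_cancel] at this
      calc x * Real.exp (-x) ≤ Real.exp (x - 1) * Real.exp (-x) := by gcongr
        _ = Real.exp (-1) := by rw [← Real.exp_add]; ring_nf
    calc (k : ℝ) ^ k / k.factorial * (x * Real.exp (-x)) ^ k
        ≤ Real.exp 1 ^ k * Real.exp (-1) ^ k := by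
          gcongr
          exact self_pow_div_factorial_le k
      _ = 1 := by rw [← mul_pow, ← Real.exp_add]; simp
  calc treeDensity k x ≤ 1 / ((k : ℝ) ^ 2 * x) := (le_div_iff₀ (by positivity)).2 h2
    _ = x⁻¹ * (1 / (k : ℝ) ^ 2) := by field_simp

lemma summable_treeDensity {x : ℝ} (hx : 0 < x) :
    Summable fun k : ℕ => treeDensity (k + 1) x := by
  refine Summable.of_nonneg_of_le (fun k => treeDensity_nonneg _ hx.le)
    (fun k => treeDensity_le k.succ_pos hx) (Summable.mul_left _ ?_)
  exact (summable_nat_add_iff 1).2 (Real.summable_one_div_nat_pow.2 one_lt_two)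

lemma componentDensity_nonneg {x : ℝ} (hx : 0 < x) : 0 ≤ componentDensity x :=
  tsum_nonneg fun _ => treeDensity_nonneg _ hx.le

/-- The Gamma integral equals (k-1)!/k^k, and the coefficient is k^(k-2)/k!. -/
lemma integral_treeDensity {k : ℕ} (hk : 0 < k) :
    ∫ x in Set.Ioi (0 : ℝ), treeDensity k x = 1 / (k : ℝ) ^ 3 := by
  have hk' : (0 : ℝ) < k := by exact_mod_cast hk
  have h1 := Real.integral_rpow_mul_exp_neg_mul_Ioi hk' hk'
  have h2 : ∀ x : ℝ, x ^ ((k : ℝ) - 1) = x ^ (k - 1) := fun x => by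
    rw [← Real.rpow_natCast, Nat.cast_sub hk, Nat.cast_one]
  have hG : Real.Gamma k = ((k - 1).factorial : ℝ) := by
    have := Real.Gamma_nat_eq_factorial (k - 1)
    rwa [Nat.cast_sub hk, Nat.cast_one, sub_add_cancel] at this
  simp only [h2, hG, Real.rpow_natCast] at h1
  simp only [treeDensity]
  rw [integral_const_mul, h1, ← Nat.mul_factorial_pred hk.ne']
  have h3 := sq_mul_card_spanningTrees hk
  have h4 : ((k - 1).factorial : ℝ) ≠ 0 := by exact_mod_cast (k - 1).factorial_ne_zero
  have h5 : ((spanningTrees k).card : ℝ) = (k : ℝ) ^ k / (k : ℝ) ^ 2 := by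
    rw [← h3]; field_simp
  rw [h5]
  push_cast
  rw [div_pow, one_pow]
  field_simp

/-- A non-integrable function has Bochner integral 0, but the integral computed above is positive.
-/
lemma integrable_treeDensity {k : ℕ} (hk : 0 < k) :
    IntegrableOn (treeDensity k) (Set.Ioi 0) := by
  by_contra h
  have h1 := integral_treeDensity hk
  rw [integral_undef h] at h1
  have hk' : (0 : ℝ) < k := by exact_mod_cast hk
  exact absurd h1 (by positivity)

lemma zetaThree_pos : 0 < zetaThree := by
  have hs : Summable fun k : ℕ => 1 / ((k : ℝ) + 1) ^ 3 := by
    have := (summable_nat_add_iff 1).2 (Real.summable_one_div_nat_pow.2 (by norm_num : 1 < 3))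
    simpa using this
  exact hs.tsum_pos (fun k => by positivity) 0 (by simp)

lemma integral_componentDensity :
    ∫ x in Set.Ioi (0 : ℝ), componentDensity x = zetaThree := by
  have hint : ∀ k : ℕ, ∫ x in Set.Ioi (0 : ℝ), ‖treeDensity (k + 1) x‖ = 1 / ((k : ℝ) + 1) ^ 3 := by
    intro k
    rw [setIntegral_congr_fun (g := treeDensity (k + 1)) measurableSet_Ioi
      fun x hx => Real.norm_of_nonneg (treeDensity_nonneg _ (le_of_lt hx)),
      integral_treeDensity k.succ_pos]
    push_cast
    rfl
  have hs : Summable fun k : ℕ => ∫ x in Set.Ioi (0 : ℝ), ‖treeDensity (k + 1) x‖ := by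
    simp only [hint]
    have := (summable_nat_add_iff 1).2 (Real.summable_one_div_nat_pow.2 (by norm_num : 1 < 3))
    simpa using this
  have h := hasSum_integral_of_summable_integral_norm
    (fun k : ℕ => integrable_treeDensity k.succ_pos) hs
  refine h.tsum_eq.symm.trans ?_
  rw [zetaThree]
  refine tsum_congr fun k => ?_
  rw [integral_treeDensity k.succ_pos]
  push_cast
  rfl

lemma integrable_componentDensity : IntegrableOn componentDensity (Set.Ioi 0) := by
  by_contra h
  have h1 := integral_componentDensity
  rw [integral_undef h] at h1
  exact zetaThree_pos.ne h1

end TreeDensity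

/-! ### Limit and tail bound of the mean component counts. -/

section MeanLimit

lemma tendsto_natCast_mul_div (x : ℝ) : Tendsto (fun n : ℕ => (n : ℝ) * (x / n)) atTop (𝓝 x) :=
  tendsto_const_nhds.congr' (by
    filter_upwards [eventually_gt_atTop 0] with n hn
    field_simp)

lemma tendsto_one_sub_div_pow (x : ℝ) (k : ℕ) :
    Tendsto (fun n : ℕ => (1 - x / n) ^ k) atTop (𝓝 1) := by
  have h : Tendsto (fun n : ℕ => 1 - x / n) atTop (𝓝 (1 - 0)) :=
    tendsto_const_nhds.sub (tendsto_const_div_atTop_nhds_zero_nat x)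
  simpa using h.pow k

lemma tendsto_one_sub_div_pow_sub (x : ℝ) (k : ℕ) :
    Tendsto (fun n : ℕ => (1 - x / n) ^ (n - k)) atTop (𝓝 (Real.exp (-x))) := by
  have h1 : Tendsto (fun n : ℕ => (1 + -(x / n)) ^ n) atTop (𝓝 (Real.exp (-x))) :=
    Real.tendsto_one_add_pow_exp_of_tendsto (by simpa using (tendsto_natCast_mul_div x).neg)
  have h2 := h1.div (tendsto_one_sub_div_pow x k) one_ne_zero
  rw [div_one] at h2
  refine h2.congr' ?_
  filter_upwards [eventually_ge_atTop k, eventually_gt_atTop 0,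
    (tendsto_const_div_atTop_nhds_zero_nat x).eventually_lt_const zero_lt_one] with n hn hn0 hx
  rw [pow_sub₀ _ (by linarith) hn, ← div_eq_mul_inv, Pi.div_apply, ← sub_eq_add_neg]

lemma treeComponentMean_div {n k : ℕ} (hk : 0 < k) (hn : 0 < n) {x : ℝ} (hx : 0 < x) :
    treeComponentMean n k (x / n) / n = (spanningTrees k).card / x *
      (n.choose k * (x / n) ^ k) * ((1 - x / n) ^ (n - k)) ^ k := by
  have hn' : (0 : ℝ) < n := by exact_mod_cast hn
  have h2 : (x / n) ^ k = (x / n) ^ (k - 1) * (x / n) := by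
    rw [← pow_succ, Nat.sub_add_cancel hk]
  rw [treeComponentMean, treeComponentProb, h2, mul_comm k, pow_mul]
  field_simp

lemma tendsto_treeComponentMean_div {k : ℕ} (hk : 0 < k) {x : ℝ} (hx : 0 < x) :
    Tendsto (fun n : ℕ => treeComponentMean n k (x / n) / n) atTop (𝓝 (treeDensity k x)) := by
  have h1 := (((ProbabilityTheory.tendsto_choose_mul_pow_atTop k (tendsto_natCast_mul_div x)).const_mul
    ((spanningTrees k).card / x)).mul ((tendsto_one_sub_div_pow_sub x k).pow k))
  have h2 : (spanningTrees k).card / x * (x ^ k / k.factorial) * Real.exp (-x) ^ k =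
      treeDensity k x := by
    have h2 : x ^ k = x ^ (k - 1) * x := by rw [← pow_succ, Nat.sub_add_cancel hk]
    have h3 : Real.exp (-x) ^ k = Real.exp (-(k * x)) := by
      rw [← Real.exp_nat_mul]; ring_nf
    rw [h2, h3, treeDensity]
    field_simp
  rw [h2] at h1
  refine h1.congr' ?_
  filter_upwards [eventually_gt_atTop 0] with n hn
  rw [treeComponentMean_div hk hn hx]

/-- For k ≤ n/2 each vertex has at least n/2 boundary edges, so closing the boundary costs at most
exp(-kx/2). Half of this exponent absorbs x^k through x ≤ 4 exp(x/4), and k^k/k! gives the factor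
e^k. -/
lemma treeComponentMean_div_le {n k : ℕ} (hk : 0 < k) (hkn : 2 * k ≤ n) {x : ℝ} (hx : 1 ≤ x)
    (hxn : x ≤ n) :
    treeComponentMean n k (x / n) / n ≤ (4 * Real.exp 1 * Real.exp (-(x / 4))) ^ k := by
  have hx0 : 0 < x := by linarith
  have hn : 0 < n := by omega
  have hn' : (0 : ℝ) < n := by exact_mod_cast hn
  have hp1 : x / n ≤ 1 := by rw [div_le_one hn']; exact hxn
  have h1 : (1 - x / n) ^ (n - k) ≤ Real.exp (-(x / 2)) := by
    calc (1 - x / n) ^ (n - k) ≤ Real.exp (-(x / n)) ^ (n - k) :=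
          pow_le_pow_left₀ (by linarith) (Real.one_sub_le_exp_neg _) _
      _ = Real.exp ((n - k : ℕ) * -(x / n)) := by rw [Real.exp_nat_mul]
      _ ≤ Real.exp (-(x / 2)) := by
          rw [Real.exp_le_exp, Nat.cast_sub (by omega)]
          have h2 : 2 * (k : ℝ) ≤ n := by exact_mod_cast hkn
          have h3 : x / 2 ≤ (n - k) * (x / n) := by
            rw [mul_div_assoc', div_le_div_iff₀ two_pos hn']
            nlinarith
          linarith
  have h2 : (n.choose k : ℝ) * (x / n) ^ k ≤ x ^ k / k.factorial := by
    have := Nat.choose_le_pow_div (α := ℝ) k n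
    calc (n.choose k : ℝ) * (x / n) ^ k ≤ (n : ℝ) ^ k / k.factorial * (x / n) ^ k := by gcongr
      _ = x ^ k / k.factorial := by rw [div_pow]; field_simp
  have h3 : ((spanningTrees k).card : ℝ) / x ≤ (k : ℝ) ^ k :=
    (div_le_self (Nat.cast_nonneg _) hx).trans (card_spanningTrees_le_pow hk)
  have h4 : x * Real.exp (-(x / 2)) ≤ 4 * Real.exp (-(x / 4)) := by
    have h5 : x ≤ 4 * Real.exp (x / 4) := by linarith [Real.add_one_le_exp (x / 4)]
    calc x * Real.exp (-(x / 2)) ≤ 4 * Real.exp (x / 4) * Real.exp (-(x / 2)) := by gcongr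
      _ = 4 * Real.exp (-(x / 4)) := by rw [mul_assoc, ← Real.exp_add]; ring_nf
  have hq : 0 ≤ (1 - x / n) ^ (n - k) := pow_nonneg (by linarith) _
  rw [treeComponentMean_div hk hn hx0]
  calc (spanningTrees k).card / x * (n.choose k * (x / n) ^ k) * ((1 - x / n) ^ (n - k)) ^ k
      ≤ (k : ℝ) ^ k * (x ^ k / k.factorial) * Real.exp (-(x / 2)) ^ k := by gcongr
    _ = (k : ℝ) ^ k / k.factorial * (x * Real.exp (-(x / 2))) ^ k := by rw [mul_pow]; ring
    _ ≤ Real.exp 1 ^ k * (4 * Real.exp (-(x / 4))) ^ k := by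
        gcongr
        exact self_pow_div_factorial_le k
    _ = _ := by rw [← mul_pow]; ring

end MeanLimit

/-! ### Convergence of the number of components at fixed mean degree. -/

section PointwiseLimit

variable {n : ℕ}

lemma integrable_comp_openGraph (f : SimpleGraph (Fin n) → ℝ) (p : ℝ) :
    Integrable (fun ω => f (openGraph p ω)) (envLaw n) := by
  classical
  refine Integrable.of_bound (measurable_comp_openGraph_right f p).aestronglyMeasurable
    (∑ G, |f G|) (ae_of_all _ fun ω => ?_)
  exact Finset.single_le_sum (f := fun G => |f G|) (fun _ _ => abs_nonneg _) (Finset.mem_univ _)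

/-- Nonnegativity of the variance of |f| serves as Cauchy–Schwarz. -/
lemma tendsto_integral_abs_of_sq {f : ∀ n, Env n → ℝ}
    (hf : ∀ n, Integrable (f n) (envLaw n))
    (hf2 : ∀ n, Integrable (fun ω => f n ω ^ 2) (envLaw n))
    (h : Tendsto (fun n => ∫ ω, f n ω ^ 2 ∂(envLaw n)) atTop (𝓝 0)) :
    Tendsto (fun n => ∫ ω, |f n ω| ∂(envLaw n)) atTop (𝓝 0) := by
  refine squeeze_zero (fun n => integral_nonneg fun ω => abs_nonneg _) (fun n => ?_)
    (by simpa using h.sqrt)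
  refine Real.le_sqrt_of_sq_le ?_
  have := ((memLp_two_iff_integrable_sq (hf n).abs.1).2 (by simpa using hf2 n)).integrable one_le_two
  have h1 := ProbabilityTheory.variance_nonneg (fun ω => |f n ω|) (envLaw n)
  rw [ProbabilityTheory.variance_eq_sub
    ((memLp_two_iff_integrable_sq (hf n).abs.1).2 (by simpa using hf2 n))] at h1
  simpa using h1

/-- The square is expanded, with the second moment bounded above and the first below. When the
normalized mean tends to t and p to 0, the bound tends to t² - 2t² + t² = 0. -/
lemma integral_sq_componentCount_div_sub_le {k : ℕ} (hk : 0 < k) {p t : ℝ} (h0 : 0 ≤ p)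
    (h1 : p < 1) (ht : 0 ≤ t) :
    ∫ ω, ((componentCount (openGraph p ω) k : ℝ) / n - t) ^ 2 ∂(envLaw n) ≤
      (treeComponentMean n k p / n * (n : ℝ)⁻¹ + (treeComponentMean n k p / n) ^ 2) /
        (1 - p) ^ (k * k) - 2 * t * (treeComponentMean n k p / n * (1 - p) ^ (k * k)) + t ^ 2 := by
  have hq : 0 < (1 - p) ^ (k * k) := pow_pos (by linarith) _
  have hI1 := integrable_comp_openGraph
    (fun G : SimpleGraph (Fin n) => ((n : ℝ)⁻¹) ^ 2 * (componentCount G k : ℝ) ^ 2) p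
  have hI2 := integrable_comp_openGraph
    (fun G : SimpleGraph (Fin n) => 2 * t * (n : ℝ)⁻¹ * (componentCount G k : ℝ)) p
  have hpt : ∀ ω : Env n, ((componentCount (openGraph p ω) k : ℝ) / n - t) ^ 2 =
      ((n : ℝ)⁻¹) ^ 2 * (componentCount (openGraph p ω) k : ℝ) ^ 2 -
        2 * t * (n : ℝ)⁻¹ * (componentCount (openGraph p ω) k : ℝ) + t ^ 2 := fun ω => by ring
  have hI3 : Integrable (fun ω => ((n : ℝ)⁻¹) ^ 2 * (componentCount (openGraph p ω) k : ℝ) ^ 2 -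
        2 * t * (n : ℝ)⁻¹ * (componentCount (openGraph p ω) k : ℝ)) (envLaw n) := hI1.sub hI2
  simp only [hpt]
  rw [integral_add hI3 (integrable_const _), integral_sub hI1 hI2, integral_const_mul,
    integral_const_mul]
  have hsq := integral_componentCount_sq_le (n := n) h0 h1.le hk
  have hm := le_integral_componentCount (n := n) h0 h1.le hk
  rw [← le_div_iff₀' hq] at hsq
  have h2 : ((n : ℝ)⁻¹) ^ 2 * ∫ ω, (componentCount (openGraph p ω) k : ℝ) ^ 2 ∂(envLaw n) ≤
      ((n : ℝ)⁻¹) ^ 2 * ((treeComponentMean n k p + treeComponentMean n k p ^ 2) /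
        (1 - p) ^ (k * k)) := by gcongr
  have h3 : 2 * t * (n : ℝ)⁻¹ * (treeComponentMean n k p * (1 - p) ^ (k * k)) ≤
      2 * t * (n : ℝ)⁻¹ * ∫ ω, (componentCount (openGraph p ω) k : ℝ) ∂(envLaw n) := by gcongr
  simp only [integral_const, probReal_univ, one_smul]
  refine (add_le_add (sub_le_sub h2 h3) le_rfl).trans (le_of_eq ?_)
  ring

lemma tendsto_integral_abs_componentCount {k : ℕ} (hk : 0 < k) {x : ℝ} (hx : 0 < x) :
    Tendsto (fun n : ℕ => ∫ ω, |(componentCount (openGraph (x / n) ω) k : ℝ) / n -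
      treeDensity k x| ∂(envLaw n)) atTop (𝓝 0) := by
  refine tendsto_integral_abs_of_sq (f := fun n ω =>
    (componentCount (openGraph (x / n) ω) k : ℝ) / n - treeDensity k x) (fun n => ?_) (fun n => ?_) ?_
  · exact integrable_comp_openGraph (fun G => (componentCount G k : ℝ) / n - treeDensity k x) _
  · exact integrable_comp_openGraph
      (fun G => ((componentCount G k : ℝ) / n - treeDensity k x) ^ 2) _
  have hm := tendsto_treeComponentMean_div hk hx
  have hq := tendsto_one_sub_div_pow x (k * k)
  have hlim := (((((hm.mul (tendsto_inv_atTop_nhds_zero_nat (𝕜 := ℝ))).add (hm.pow 2)).div hq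
    one_ne_zero).sub ((hm.mul hq).const_mul (2 * treeDensity k x))).add_const
      (treeDensity k x ^ 2))
  have hz : (treeDensity k x * 0 + treeDensity k x ^ 2) / 1 -
      2 * treeDensity k x * (treeDensity k x * 1) + treeDensity k x ^ 2 = 0 := by ring
  rw [hz] at hlim
  refine squeeze_zero' (Eventually.of_forall fun n => integral_nonneg fun ω => sq_nonneg _) ?_ hlim
  filter_upwards [(tendsto_const_div_atTop_nhds_zero_nat x).eventually_lt_const zero_lt_one] with n hn
  exact integral_sq_componentCount_div_sub_le hk (by positivity) hn (treeDensity_nonneg k hx.le)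

lemma abs_numComponents_div_sub_le {K : ℕ} (hK : 0 < K) (hn : 0 < n) (G : SimpleGraph (Fin n)) :
    |((numComponents G : ℝ) - 1) / n - ∑ k ∈ Finset.range K, (componentCount G (k + 1) : ℝ) / n| ≤
      1 / n + 1 / K := by
  have hn' : (0 : ℝ) < n := by exact_mod_cast hn
  have hK' : (0 : ℝ) < K := by exact_mod_cast hK
  have h1 : ∑ k ∈ Finset.range K, (componentCount G (k + 1) : ℝ) ≤ numComponents G := by
    have := sum_componentCount_le G ((Finset.range K).map ⟨Nat.succ, Nat.succ_injective⟩)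
    rw [Finset.sum_map] at this
    exact_mod_cast this
  have h2 : (K : ℝ) * numComponents G ≤
      K * ∑ k ∈ Finset.range K, (componentCount G (k + 1) : ℝ) + n := by
    have := numComponents_le_sum_add G K
    rw [Fintype.card_fin] at this
    exact_mod_cast this
  have h3 : (numComponents G : ℝ) - ∑ k ∈ Finset.range K, (componentCount G (k + 1) : ℝ) ≤ n / K := by
    rw [le_div_iff₀ hK']
    linarith
  rw [← Finset.sum_div, ← sub_div, abs_div, abs_of_pos hn', div_le_iff₀ hn']
  have h4 : (1 / (n : ℝ) + 1 / K) * n = 1 + n / K := by field_simp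
  have h5 : (0 : ℝ) ≤ n / K := by positivity
  rw [h4, abs_le]
  constructor <;> linarith

lemma tendsto_integral_abs_numComponents {x : ℝ} (hx : 0 < x) :
    Tendsto (fun n : ℕ => ∫ ω, |((numComponents (openGraph (x / n) ω) : ℝ) - 1) / n -
      componentDensity x| ∂(envLaw n)) atTop (𝓝 0) := by
  have htail : Tendsto (fun K : ℕ => (1 : ℝ) / K +
      |∑ k ∈ Finset.range K, treeDensity (k + 1) x - componentDensity x|) atTop (𝓝 0) := by
    have h1 := (summable_treeDensity hx).hasSum.tendsto_sum_nat.sub_const (componentDensity x)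
    rw [show ∑' k : ℕ, treeDensity (k + 1) x = componentDensity x from rfl, sub_self] at h1
    simpa using tendsto_one_div_atTop_nhds_zero_nat.add h1.abs
  rw [tendsto_order]
  refine ⟨fun a ha => Eventually.of_forall fun n =>
    ha.trans_le (integral_nonneg fun ω => abs_nonneg _), fun ε hε => ?_⟩
  -- The truncation level K is fixed before n grows; 1/K accounts for the large components of the
  -- graph and the absolute value for the tail of the limiting series.
  obtain ⟨K, hKε, hK⟩ := ((htail.eventually_lt_const hε).and (eventually_gt_atTop 0)).exists
  have hlim : Tendsto (fun n : ℕ => 1 / (n : ℝ) + (1 / (K : ℝ) +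
      |∑ k ∈ Finset.range K, treeDensity (k + 1) x - componentDensity x|) +
      ∑ k ∈ Finset.range K, ∫ ω, |(componentCount (openGraph (x / n) ω) (k + 1) : ℝ) / n -
      treeDensity (k + 1) x| ∂(envLaw n)) atTop (𝓝 (0 + (1 / (K : ℝ) +
      |∑ k ∈ Finset.range K, treeDensity (k + 1) x - componentDensity x|) +
      ∑ k ∈ Finset.range K, 0)) :=
    (tendsto_one_div_atTop_nhds_zero_nat.add_const _).add
      (tendsto_finsetSum _ fun k _ => tendsto_integral_abs_componentCount k.succ_pos hx)
  rw [zero_add, Finset.sum_const_zero, add_zero] at hlim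
  filter_upwards [hlim.eventually_lt_const hKε, eventually_gt_atTop 0] with n hn hn0
  refine lt_of_le_of_lt ?_ hn
  have hI : ∀ k, Integrable (fun ω => |(componentCount (openGraph (x / n) ω) (k + 1) : ℝ) / n -
      treeDensity (k + 1) x|) (envLaw n) := fun k => integrable_comp_openGraph
        (fun G => |(componentCount G (k + 1) : ℝ) / n - treeDensity (k + 1) x|) _
  rw [← integral_finsetSum _ fun k _ => hI k]
  set c := 1 / (n : ℝ) + (1 / (K : ℝ) +
      |∑ k ∈ Finset.range K, treeDensity (k + 1) x - componentDensity x|) with hc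
  have hcI : ∫ _ω : Env n, c ∂(envLaw n) = c := by simp
  rw [← hcI, ← integral_add (integrable_const _) (integrable_finsetSum _ fun k _ => hI k)]
  refine integral_mono (integrable_comp_openGraph
    (fun G => |((numComponents G : ℝ) - 1) / n - componentDensity x|) _)
    ((integrable_const _).add (integrable_finsetSum _ fun k _ => hI k)) fun ω => ?_
  have h1 := abs_numComponents_div_sub_le hK hn0 (openGraph (x / n) ω)
  have h2 : |∑ k ∈ Finset.range K, (componentCount (openGraph (x / n) ω) (k + 1) : ℝ) / n -
      ∑ k ∈ Finset.range K, treeDensity (k + 1) x| ≤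
      ∑ k ∈ Finset.range K, |(componentCount (openGraph (x / n) ω) (k + 1) : ℝ) / n -
        treeDensity (k + 1) x| := by
    rw [← Finset.sum_sub_distrib]
    exact Finset.abs_sum_le_sum_abs _ _
  have h3 := abs_sub_le (((numComponents (openGraph (x / n) ω) : ℝ) - 1) / n)
    (∑ k ∈ Finset.range K, (componentCount (openGraph (x / n) ω) (k + 1) : ℝ) / n)
    (componentDensity x)
  have h4 := abs_sub_le
    (∑ k ∈ Finset.range K, (componentCount (openGraph (x / n) ω) (k + 1) : ℝ) / n)
    (∑ k ∈ Finset.range K, treeDensity (k + 1) x) (componentDensity x)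
  show _ ≤ c + ∑ k ∈ Finset.range K, _
  rw [hc]
  linarith

end PointwiseLimit

/-! ### An integrable majorant in the mean degree. -/

section Domination

variable {n : ℕ}

lemma numComponents_le (G : SimpleGraph (Fin n)) : numComponents G ≤ n := by
  have := numComponents_le_of_le (bot_le : ⊥ ≤ G)
  rwa [numComponents_bot, Nat.card_eq_fintype_card, Fintype.card_fin] at this

lemma one_le_numComponents (hn : 0 < n) (G : SimpleGraph (Fin n)) : 1 ≤ numComponents G := by
  have : Nonempty (Fin n) := ⟨⟨0, hn⟩⟩
  have h := numComponents_le_of_le (le_top : G ≤ ⊤)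
  rwa [numComponents_of_connected SimpleGraph.connected_top] at h

lemma sum_pow_succ_le {r : ℝ} (h0 : 0 ≤ r) (h1 : r ≤ 1 / 2) (s : Finset ℕ) :
    ∑ k ∈ s, r ^ (k + 1) ≤ 2 * r := by
  have hs := summable_geometric_of_lt_one h0 (by linarith)
  calc ∑ k ∈ s, r ^ (k + 1) = r * ∑ k ∈ s, r ^ k := by
        rw [Finset.mul_sum]; exact Finset.sum_congr rfl fun k _ => pow_succ' r k
    _ ≤ r * 2 := by
        gcongr
        refine (hs.sum_le_tsum s fun k _ => pow_nonneg h0 k).trans ?_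
        rw [tsum_geometric_of_lt_one h0 (by linarith)]
        refine inv_le_of_inv_le₀ two_pos (by linarith)
    _ = 2 * r := mul_comm _ _

lemma integral_numComponents_div_le (hn : 0 < n) {x : ℝ} (hx : 0 < x) (hxn : x ≤ n) :
    ∫ ω, ((numComponents (openGraph (x / n) ω) : ℝ) - 1) / n ∂(envLaw n) ≤
      2 * (4 * Real.exp 1 * Real.exp (-(x / 4))) := by
  have hn' : (0 : ℝ) < n := by exact_mod_cast hn
  set r := 4 * Real.exp 1 * Real.exp (-(x / 4)) with hr
  have hI := integrable_comp_openGraph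
    (fun G : SimpleGraph (Fin n) => ((numComponents G : ℝ) - 1) / n) (x / n)
  -- If r > 1/2 the trivial bound 1 suffices. Otherwise x ≥ 1, and the sum over component sizes up
  -- to n/2 is dominated by a geometric series of ratio r.
  rcases lt_or_ge (1 / 2) r with h | h
  · have h1 : ∫ ω, ((numComponents (openGraph (x / n) ω) : ℝ) - 1) / n ∂(envLaw n) ≤
        ∫ _ω, (1 : ℝ) ∂(envLaw n) := by
      refine integral_mono hI (integrable_const _) fun ω => ?_
      rw [div_le_one hn']
      have : (numComponents (openGraph (x / n) ω) : ℝ) ≤ n := by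
        exact_mod_cast numComponents_le _
      linarith
    simp only [integral_const, probReal_univ, one_smul] at h1
    linarith
  have hx1 : 1 ≤ x := by
    by_contra hlt
    have h2 : 2 ≤ Real.exp 1 := by linarith [Real.add_one_le_exp (1 : ℝ)]
    have h3 : 3 / 4 ≤ Real.exp (-(x / 4)) := by linarith [Real.add_one_le_exp (-(x / 4))]
    nlinarith
  have hp0 : 0 ≤ x / n := by positivity
  have hp1 : x / n ≤ 1 := by rw [div_le_one hn']; exact hxn
  set s := (Finset.range n).filter fun k => 2 * (k + 1) ≤ n with hs
  have hIk : ∀ k, Integrable (fun ω => (componentCount (openGraph (x / n) ω) (k + 1) : ℝ) / n)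
      (envLaw n) := fun k =>
    integrable_comp_openGraph (fun G => (componentCount G (k + 1) : ℝ) / n) _
  calc ∫ ω, ((numComponents (openGraph (x / n) ω) : ℝ) - 1) / n ∂(envLaw n)
      ≤ ∫ ω, ∑ k ∈ s, (componentCount (openGraph (x / n) ω) (k + 1) : ℝ) / n ∂(envLaw n) := by
        refine integral_mono hI (integrable_finsetSum _ fun k _ => hIk k) fun ω => ?_
        have h1 := numComponents_le_sum_half (openGraph (x / n) ω)
        simp only [Fintype.card_fin] at h1
        have h2 : (numComponents (openGraph (x / n) ω) : ℝ) ≤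
            ∑ k ∈ s, (componentCount (openGraph (x / n) ω) (k + 1) : ℝ) + 1 := by exact_mod_cast h1
        rw [← Finset.sum_div]
        gcongr
        linarith
    _ = ∑ k ∈ s, (∫ ω, (componentCount (openGraph (x / n) ω) (k + 1) : ℝ) ∂(envLaw n)) / n := by
        rw [integral_finsetSum _ fun k _ => hIk k]
        exact Finset.sum_congr rfl fun k _ => integral_div _ _
    _ ≤ ∑ k ∈ s, r ^ (k + 1) := by
        refine Finset.sum_le_sum fun k hk => ?_
        refine (div_le_div_of_nonneg_right (integral_componentCount_le hp0 hp1 k.succ_pos)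
          hn'.le).trans ?_
        exact treeComponentMean_div_le k.succ_pos (Finset.mem_filter.1 hk).2 hx1 hxn
    _ ≤ 2 * r := sum_pow_succ_le (by positivity) h s

end Domination

/-! ### Convergence of the minimal length to ζ(3), and the low-temperature asymptotics. -/

section LengthLimit

variable {n : ℕ}

/-- The normalized excess number of components at mean degree `x`, cut off at `x = n`. -/
def componentExcess (n : ℕ) (x : ℝ) (ω : Env n) : ℝ :=
  (Set.Iic (n : ℝ)).indicator (fun x => ((numComponents (openGraph (x / n) ω) : ℝ) - 1) / n) x

lemma measurable_componentExcess :
    Measurable fun q : ℝ × Env n => componentExcess n q.1 q.2 := by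
  have h := (measurable_comp_openGraph (fun G : SimpleGraph (Fin n) =>
    ((numComponents G : ℝ) - 1) / n)).comp
      ((measurable_fst.div_const (n : ℝ)).prodMk measurable_snd : Measurable fun q : ℝ × Env n => _)
  exact h.indicator (measurable_fst measurableSet_Iic)

/-- Substitution p = x/n; the cutoff puts all n on the common domain (0, ∞), as dominated
convergence requires. -/
lemma percolationLength_eq (hn : 0 < n) (ω : Env n) :
    percolationLength ω = ∫ x in Set.Ioi (0 : ℝ), componentExcess n x ω := by
  have hn' : (0 : ℝ) < n := by exact_mod_cast hn
  have h1 := intervalIntegral.integral_comp_div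
    (fun p => (numComponents (openGraph p ω) : ℝ) - 1) (a := 0) (b := n) hn'.ne'
  rw [zero_div, div_self hn'.ne', smul_eq_mul] at h1
  simp only [componentExcess]
  rw [setIntegral_indicator measurableSet_Iic, Set.Ioi_inter_Iic,
    ← intervalIntegral.integral_of_le hn'.le, intervalIntegral.integral_div, h1, percolationLength,
    mul_div_cancel_left₀ _ hn'.ne']

lemma integrable_componentExcess (x : ℝ) : Integrable (componentExcess n x) (envLaw n) := by
  by_cases hx : x ≤ n
  · refine (integrable_comp_openGraph
      (fun G : SimpleGraph (Fin n) => ((numComponents G : ℝ) - 1) / n) (x / n)).congr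
        (ae_of_all _ fun ω => ?_)
    simp [componentExcess, hx]
  · refine (integrable_zero _ _ _).congr (ae_of_all _ fun ω => ?_)
    simp [componentExcess, hx]

lemma integrableOn_componentExcess (hn : 0 < n) (ω : Env n) :
    IntegrableOn (fun x => componentExcess n x ω) (Set.Ioi 0) := by
  have hn' : (0 : ℝ) < n := by exact_mod_cast hn
  have h1 : IntegrableOn (fun x => ((numComponents (openGraph (x / n) ω) : ℝ) - 1) / n)
      (Set.Iic (n : ℝ) ∩ Set.Ioi 0) := by
    rw [Set.inter_comm, Set.Ioi_inter_Iic]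
    refine Measure.integrableOn_of_bounded (M := 1) (by simp) ?_ (ae_of_all _ fun x => ?_)
    · exact ((measurable_comp_openGraph (fun G : SimpleGraph (Fin n) =>
        ((numComponents G : ℝ) - 1) / n)).comp
          ((measurable_id.div_const (n : ℝ)).prodMk measurable_const)).aestronglyMeasurable
    · have h1 : (1 : ℝ) ≤ numComponents (openGraph (x / n) ω) := by
        exact_mod_cast one_le_numComponents hn _
      have h2 : (numComponents (openGraph (x / n) ω) : ℝ) ≤ n := by exact_mod_cast numComponents_le _
      rw [Real.norm_of_nonneg (div_nonneg (by linarith) hn'.le), div_le_one hn']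
      linarith
  refine (integrable_indicator_iff measurableSet_Ioi).1 ?_
  rw [← integrable_indicator_iff (measurableSet_Iic.inter measurableSet_Ioi)] at h1
  refine h1.congr (ae_of_all _ fun x => ?_)
  simp only [componentExcess, Set.indicator_apply, Set.mem_inter_iff]
  by_cases hx : x ∈ Set.Ioi (0 : ℝ) <;> by_cases hx' : x ∈ Set.Iic (n : ℝ) <;> simp [hx, hx']

lemma componentExcess_nonneg (hn : 0 < n) (x : ℝ) (ω : Env n) : 0 ≤ componentExcess n x ω := by
  refine Set.indicator_nonneg (fun y _ => ?_) x
  have h1 : (1 : ℝ) ≤ numComponents (openGraph (y / n) ω) := by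
    exact_mod_cast one_le_numComponents hn _
  exact div_nonneg (by linarith) (Nat.cast_nonneg _)

lemma integral_componentExcess_le (hn : 0 < n) {x : ℝ} (hx : 0 < x) :
    ∫ ω, componentExcess n x ω ∂(envLaw n) ≤ 2 * (4 * Real.exp 1 * Real.exp (-(x / 4))) := by
  by_cases hxn : x ≤ n
  · simpa [componentExcess, hxn] using integral_numComponents_div_le hn hx hxn
  · simp only [componentExcess, Set.mem_Iic, hxn, not_false_eq_true, Set.indicator_of_notMem,
      integral_zero]
    positivity

lemma integral_abs_componentExcess_sub_le (hn : 0 < n) {x : ℝ} (hx : 0 < x) :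
    ∫ ω, |componentExcess n x ω - componentDensity x| ∂(envLaw n) ≤
      2 * (4 * Real.exp 1 * Real.exp (-(x / 4))) + componentDensity x := by
  have hI := integrable_componentExcess (n := n) x
  calc ∫ ω, |componentExcess n x ω - componentDensity x| ∂(envLaw n)
      ≤ ∫ ω, (componentExcess n x ω + componentDensity x) ∂(envLaw n) := by
        refine integral_mono (hI.sub (integrable_const _)).abs (hI.add (integrable_const _))
          fun ω => ?_
        refine (abs_sub _ _).trans (le_of_eq ?_)
        rw [abs_of_nonneg (componentExcess_nonneg hn x ω), abs_of_nonneg (componentDensity_nonneg hx)]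
    _ = ∫ ω, componentExcess n x ω ∂(envLaw n) + componentDensity x := by
        rw [integral_add hI (integrable_const _)]
        simp
    _ ≤ _ := by gcongr; exact integral_componentExcess_le hn hx

lemma tendsto_integral_abs_componentExcess {x : ℝ} (hx : 0 < x) :
    Tendsto (fun n : ℕ => ∫ ω, |componentExcess n x ω - componentDensity x| ∂(envLaw n)) atTop
      (𝓝 0) := by
  refine (tendsto_integral_abs_numComponents hx).congr' ?_
  filter_upwards [tendsto_natCast_atTop_atTop.eventually_ge_atTop x] with n hn
  simp [componentExcess, hn]

lemma aemeasurable_componentExcess_sub : AEMeasurable (fun q : ℝ × Env n =>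
    ENNReal.ofReal |componentExcess n q.1 q.2 - componentDensity q.1|)
      ((volume.restrict (Set.Ioi (0 : ℝ))).prod (envLaw n)) := by
  have h1 : AEMeasurable (fun q : ℝ × Env n => componentDensity q.1)
      ((volume.restrict (Set.Ioi (0 : ℝ))).prod (envLaw n)) :=
    (AEStronglyMeasurable.comp_fst integrable_componentDensity.1).aemeasurable
  exact (measurable_componentExcess.aemeasurable.sub h1).abs.ennreal_ofReal

lemma lintegral_abs_componentExcess_sub (x : ℝ) :
    ∫⁻ ω, ENNReal.ofReal |componentExcess n x ω - componentDensity x| ∂(envLaw n) =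
      ENNReal.ofReal (∫ ω, |componentExcess n x ω - componentDensity x| ∂(envLaw n)) :=
  (ofReal_integral_eq_lintegral_ofReal
    ((integrable_componentExcess x).sub (integrable_const _)).abs
    (ae_of_all _ fun _ => abs_nonneg _)).symm

lemma tendsto_lintegral_componentExcess :
    Tendsto (fun n : ℕ => ∫⁻ x in Set.Ioi (0 : ℝ), ∫⁻ ω,
      ENNReal.ofReal |componentExcess n x ω - componentDensity x| ∂(envLaw n)) atTop (𝓝 0) := by
  -- The index is shifted because the majorant holds only for n > 0.
  rw [← tendsto_add_atTop_iff_nat 1]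
  have hbound : IntegrableOn (fun x : ℝ => 2 * (4 * Real.exp 1 * Real.exp (-(x / 4))) +
      componentDensity x) (Set.Ioi 0) := by
    refine Integrable.add ?_ integrable_componentDensity
    have h := exp_neg_integrableOn_Ioi (0 : ℝ) (b := 1 / 4) (by norm_num)
    refine ((h.const_mul (4 * Real.exp 1)).const_mul 2).congr (ae_of_all _ fun x => ?_)
    simp only
    ring_nf
  have h := tendsto_lintegral_of_dominated_convergence' (μ := volume.restrict (Set.Ioi (0 : ℝ)))
    (F := fun n x => ∫⁻ ω, ENNReal.ofReal |componentExcess (n + 1) x ω - componentDensity x|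
      ∂(envLaw (n + 1))) (f := fun _ => 0)
    (fun x => ENNReal.ofReal (2 * (4 * Real.exp 1 * Real.exp (-(x / 4))) + componentDensity x))
    (fun n => aemeasurable_componentExcess_sub.lintegral_prod_right') (fun n => ?_) ?_ ?_
  · simpa using h
  · filter_upwards [ae_restrict_mem measurableSet_Ioi] with x hx
    rw [lintegral_abs_componentExcess_sub]
    exact ENNReal.ofReal_le_ofReal (integral_abs_componentExcess_sub_le n.succ_pos hx)
  · exact hbound.lintegral_lt_top.ne
  · filter_upwards [ae_restrict_mem measurableSet_Ioi] with x hx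
    simp only [lintegral_abs_componentExcess_sub]
    have h1 := (tendsto_add_atTop_iff_nat 1).2 (tendsto_integral_abs_componentExcess hx)
    simpa using ENNReal.tendsto_ofReal h1

/-- Both lengths are integrals over x, so Tonelli's theorem bounds the mean deviation by the
integral of the deviations at fixed x. -/
lemma lintegral_abs_percolationLength_sub_le (hn : 0 < n) :
    ∫⁻ ω, ENNReal.ofReal |percolationLength ω - zetaThree| ∂(envLaw n) ≤
      ∫⁻ x in Set.Ioi (0 : ℝ), ∫⁻ ω,
        ENNReal.ofReal |componentExcess n x ω - componentDensity x| ∂(envLaw n) := by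
  rw [lintegral_lintegral_swap (f := fun x ω =>
    ENNReal.ofReal |componentExcess n x ω - componentDensity x|) aemeasurable_componentExcess_sub]
  refine lintegral_mono fun ω => ?_
  have hI : IntegrableOn (fun x => componentExcess n x ω - componentDensity x) (Set.Ioi 0) :=
    (integrableOn_componentExcess hn ω).sub integrable_componentDensity
  simp only
  rw [percolationLength_eq hn, ← integral_componentDensity,
    ← integral_sub (integrableOn_componentExcess hn ω) integrable_componentDensity,
    ← ofReal_integral_eq_lintegral_ofReal hI.abs (ae_of_all _ fun _ => abs_nonneg _)]
  exact ENNReal.ofReal_le_ofReal (abs_integral_le_integral_abs)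

lemma integral_abs_quenchedLength_sub_le (hn : 0 < n) {β : ℝ} (hβ : 0 < β) :
    ENNReal.ofReal (∫ ω, |quenchedLength β ω - zetaThree| ∂(envLaw n)) ≤
      ENNReal.ofReal (n * Real.log n / β) + ∫⁻ x in Set.Ioi (0 : ℝ), ∫⁻ ω,
        ENNReal.ofReal |componentExcess n x ω - componentDensity x| ∂(envLaw n) := by
  have hI : Integrable (fun ω : Env n => quenchedLength β ω - zetaThree) (envLaw n) :=
    (integrable_quenchedLength β).sub (integrable_const _)
  rw [ofReal_integral_eq_lintegral_ofReal hI.abs (ae_of_all _ fun _ => abs_nonneg _)]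
  calc ∫⁻ ω, ENNReal.ofReal |quenchedLength β ω - zetaThree| ∂(envLaw n)
      ≤ ∫⁻ ω, (ENNReal.ofReal (n * Real.log n / β) +
        ENNReal.ofReal |percolationLength ω - zetaThree|) ∂(envLaw n) := by
        refine lintegral_mono_ae ?_
        filter_upwards [ae_mem_cube] with ω hω
        have h1 := abs_quenchedLength_sub_percolationLength_le hn hβ hω
        have h2 := abs_sub_le (quenchedLength β ω) (percolationLength ω) zetaThree
        exact (ENNReal.ofReal_le_ofReal (h2.trans (add_le_add_left h1 _))).trans
          ENNReal.ofReal_add_le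
    _ = ENNReal.ofReal (n * Real.log n / β) +
        ∫⁻ ω, ENNReal.ofReal |percolationLength ω - zetaThree| ∂(envLaw n) := by
        rw [lintegral_add_left measurable_const]
        simp
    _ ≤ _ := by gcongr; exact lintegral_abs_percolationLength_sub_le hn

end LengthLimit

theorem asymp_low_temperature {β : ℕ → ℝ} (hnn : ∀ n, 0 ≤ β n)
    (hβ : (fun n : ℕ => (n : ℝ) * Real.log n ^ 5) =o[atTop] β) :
    AsympWHP (fun n ω => quenchedLength (β n) ω) (fun _ => zetaThree) ∧
      AsympExp (fun n ω => quenchedLength (β n) ω) (fun _ => zetaThree) := by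
  have hlog : Tendsto (fun n : ℕ => Real.log n) atTop atTop :=
    Real.tendsto_log_atTop.comp tendsto_natCast_atTop_atTop
  have hpos : ∀ᶠ n : ℕ in atTop, 0 < β n := by
    filter_upwards [hβ.bound one_pos, hlog.eventually_gt_atTop 0, eventually_gt_atTop 0]
      with n hn hl hn0
    have hn' : (0 : ℝ) < n := by exact_mod_cast hn0
    rw [one_mul, Real.norm_of_nonneg (by positivity), Real.norm_of_nonneg (hnn n)] at hn
    exact lt_of_lt_of_le (by positivity) hn
  -- The comparison with the minimal tree costs n log n / β, which therefore tends to zero.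
  have hsmall : (fun n : ℕ => (n : ℝ) * Real.log n) =o[atTop] β := by
    refine IsBigO.trans_isLittleO (IsBigO.of_bound 1 ?_) hβ
    filter_upwards [hlog.eventually_ge_atTop 1] with n hl
    rw [one_mul, norm_mul, norm_mul, norm_pow]
    gcongr
    rw [Real.norm_of_nonneg (by linarith)]
    exact le_self_pow₀ hl (by norm_num)
  have hlim := (ENNReal.tendsto_ofReal hsmall.tendsto_div_nhds_zero).add
    tendsto_lintegral_componentExcess
  rw [ENNReal.ofReal_zero, add_zero] at hlim
  refine asymp_of_integral_abs_sub (fun n => integrable_quenchedLength _)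
    (Eventually.of_forall fun _ => zetaThree_pos) fun ε hε => ?_
  have hε' : (0 : ENNReal) < ENNReal.ofReal (ε * zetaThree) :=
    ENNReal.ofReal_pos.2 (mul_pos hε zetaThree_pos)
  filter_upwards [hlim.eventually_lt_const hε', hpos, eventually_gt_atTop 0] with n hn hb hn0
  rw [← ENNReal.ofReal_le_ofReal_iff (mul_pos hε zetaThree_pos).le]
  exact (integral_abs_quenchedLength_sub_le hn0 hb).trans hn.le

end RSTRE

end

theorem theorem1p3 (β : ℕ → ℝ) :
    ((∀ n, 0 < β n) →
      β =o[atTop] (fun n : ℕ => (n : ℝ) / Real.log n) →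
        RSTRE.AsympWHP (fun n ω => RSTRE.quenchedLength (β n) ω)
          (fun n => (n : ℝ) / β n *
            ((1 - β n * Real.exp (-β n) - Real.exp (-β n)) / (1 - Real.exp (-β n)))) ∧
        RSTRE.AsympExp (fun n ω => RSTRE.quenchedLength (β n) ω)
          (fun n => (n : ℝ) / β n *
            ((1 - β n * Real.exp (-β n) - Real.exp (-β n)) / (1 - Real.exp (-β n))))) ∧
    ((∀ n, 0 ≤ β n) →
      (fun n : ℕ => (n : ℝ) * Real.log n ^ 5) =o[atTop] β →
        RSTRE.AsympWHP (fun n ω => RSTRE.quenchedLength (β n) ω) (fun _ => RSTRE.zetaThree) ∧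
        RSTRE.AsympExp (fun n ω => RSTRE.quenchedLength (β n) ω)
          (fun _ => RSTRE.zetaThree)) := by
  exact ⟨fun hpos h => RSTRE.asymp_high_temperature hpos h,
    fun hnn h => RSTRE.asymp_low_temperature hnn h⟩
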